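/- Let $k\ge 4$ be an even integer. For $\kappa\in\{k,2-k\}$, $z=x+iy\in\mathbb H$ and $\operatorname{Re}(s)>1-\frac{\kappa}{2}$ put $$E_\kappa(z,s)=\frac12\sum_{(m,n)\in\mathbb Z^2\setminus\{(0,0)\}}\frac{y^s}{|mz+n|^{2s}(mz+n)^{\kappa}},$$ $$\widehat{\widehat E}_\kappa(z,s)=\Big(s+\frac \kappa2\Big)\Big(s+\frac \kappa2-1\Big)\pi^{-(s+\frac \kappa2)}\,\Gamma\Big(s+\frac \kappa2+\frac{|\kappa|}2\Big)E_\kappa(z,s).$$ For each $z$ the function $\widehat{\widehat E}_\kappa(z,s)$ extends to an entire function of $s$; write $$\widehat{\widehat E}_k(z,s)=\sum_{n\ge0}G_{n,k}(z)s^n,\qquad \widehat{\widehat E}_{2-k}(z,s)=\sum_{n\ge0}F_{n,2-k}(z)s^n .$$ Let $\xi_\kappa f=2iy^\kappa\,\overline{\partial f/\partial\bar z}$ with $\frac{\partial}{\partial \bar z}=\frac12\big(\frac{\partial}{\partial x}+i\frac{\partial}{\partial y}\big)$, and $\Delta_\kappa=y^2\big(\frac{\partial^2}{\partial x^2}+\frac{\partial^2}{\partial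 y^2}\big)-i\kappa y\big(\frac{\partial}{\partial x}+i\frac{\partial}{\partial y}\big)$. Let $V_\kappa^m(0)$ be the space of smooth $f:\mathbb H\to\mathbb C$ that are modular of weight $\kappa$ for $SL(2,\mathbb Z)$, satisfy $\Delta_\kappa^m f=0$, and are $O(y^\alpha)$ as $y\to\infty$, uniformly in $x$, for some $\alpha\in\mathbb R$. Let $E_\kappa^m(0)$ be the space of all $f\in V_\kappa^m(0)$ that are finite linear combinations of the Taylor coefficients (in $s$, at $s=0$) of $\widehat{\widehat E}_\kappa(z,s)$. (1) There are smooth functions $\widetilde G_{n,k}$ and $\widetilde F_{n,2-k}$ ($n\ge0$) on $\mathbb H$ such that for every integer $m\ge1$ the functions $\widetilde G_{0,k},\dots,\widetilde G_{m-1,k}$ form a basis of $E_k^m(0)$ and $\widetilde F_{0,2-k},\dots,\widetilde F_{m-1,2-k}$ form a basis of $E_{2-k}^m(0)$, and such that for all $n\ge0$, with the convention $\widetilde G_{-1,k}=\widetilde F_{-1,2-k}=0$: (a) ("ramp" relations) $\xi_k\widetilde G_{n,k}=(k-1)\widetilde F_{n-1,2-k}$ and $\xi_{2-k}\widetilde F_{n,2-k}=\widetilde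 G_{n,k}$; (b) ("tower" relations) $\Delta_k\widetilde G_{n,k}=(k-1)\widetilde G_{n-1,k}$ and $\Delta_{2-k}\widetilde F_{n,2-k}=(k-1)\widetilde F_{n-1,2-k}$. (2) One choice of such functions is $$\widetilde G_{n,k}=\sum_{\ell=0}^n\frac{(-1)^\ell}{(k-1)^\ell}\binom{n+\ell}{n}G_{n-\ell,k},\qquad \widetilde F_{n,2-k}=(-1)^n\sum_{\ell=0}^n\frac{1}{(k-1)^\ell}\binom{n+\ell}{n}F_{n-\ell,2-k}.$$ -/

import Mathlib

open UpperHalfPlane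
open scoped ModularForm MatrixGroups ContDiff

noncomputable section

namespace PolyharmonicMaass

/-! ### Differential operators on functions on the upper half-plane -/

/-- `∂f/∂x` at `z = x + iy`. -/
def partialX (f : ℍ → ℂ) (z : ℍ) : ℂ := fderiv ℝ (f ∘ ofComplex) (z : ℂ) 1

/-- `∂f/∂y` at `z = x + iy`. -/
def partialY (f : ℍ → ℂ) (z : ℍ) : ℂ := fderiv ℝ (f ∘ ofComplex) (z : ℂ) Complex.I

/-- The Wirtinger derivative `∂f/∂z̄ = (∂f/∂x + i ∂f/∂y) / 2`. -/
def partialZBar (f : ℍ → ℂ) (z : ℍ) : ℂ := (partialX f z + Complex.I * partialY f z) / 2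

/-- The Bruinier–Funke operator: `ξ_k f = 2 i y^k` times the complex conjugate of `∂f/∂z̄`. -/
def xi (k : ℤ) (f : ℍ → ℂ) (z : ℍ) : ℂ :=
  2 * Complex.I * (z.im : ℂ) ^ k * (starRingEnd ℂ) (partialZBar f z)

/-- The weight `k` hyperbolic Laplacian
`Δ_k = y² (∂²/∂x² + ∂²/∂y²) - i k y (∂/∂x + i ∂/∂y)`. -/
def laplacian (k : ℤ) (f : ℍ → ℂ) (z : ℍ) : ℂ :=
  (z.im : ℂ) ^ 2 * (partialX (partialX f) z + partialY (partialY f) z)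
    - Complex.I * (k : ℂ) * (z.im : ℂ) * (partialX f z + Complex.I * partialY f z)

/-! ### The doubly completed non-holomorphic Eisenstein series -/

/-- `E_k(z, s) = (1/2) ∑_{(m,n) ≠ (0,0)} y^s / (|mz+n|^{2s} (mz+n)^k)`; the series converges
absolutely for `Re s > 1 - k/2`. -/
def eisensteinSeries (k : ℤ) (z : ℍ) (s : ℂ) : ℂ :=
  (1 / 2) * ∑' p : {p : ℤ × ℤ // p ≠ 0},
    (z.im : ℂ) ^ s /
      (((‖(p.1.1 : ℂ) * (z : ℂ) + (p.1.2 : ℂ)‖ : ℝ) : ℂ) ^ (2 * s) *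
        ((p.1.1 : ℂ) * (z : ℂ) + (p.1.2 : ℂ)) ^ k)

/-- The doubly completed series
`(s + k/2) (s + k/2 - 1) π^{-(s + k/2)} Γ(s + k/2 + |k|/2) E_k(z, s)`,
meaningful in the half-plane `Re s > 1 - k/2`. -/
def doublyCompletedSeries (k : ℤ) (z : ℍ) (s : ℂ) : ℂ :=
  (s + (k : ℂ) / 2) * (s + (k : ℂ) / 2 - 1) *
    ((Real.pi : ℂ) ^ (-(s + (k : ℂ) / 2)) *
      Complex.Gamma (s + (k : ℂ) / 2 + ((|k| : ℤ) : ℂ) / 2) * eisensteinSeries k z s)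

/-- `f` is the continuation, to an entire function of `s`, of the doubly completed series of
weight `k` at `z`. By the identity theorem there is at most one such `f`. -/
def IsEntireContinuation (k : ℤ) (z : ℍ) (f : ℂ → ℂ) : Prop :=
  Differentiable ℂ f ∧ ∀ s : ℂ, 1 - (k : ℝ) / 2 < s.re → f s = doublyCompletedSeries k z s

open Classical in
/-- The doubly completed Eisenstein series of weight `k` as an entire function of `s` (the
junk value `0` is only taken if there is no entire continuation). -/
def doublyCompleted (k : ℤ) (z : ℍ) : ℂ → ℂ :=
  if h : ∃ f : ℂ → ℂ, IsEntireContinuation k z f then h.choose else 0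

/-- The coefficient of `s^n` in the Taylor expansion at `s = 0` of the doubly completed
Eisenstein series of weight `k`, as a function of `z`. (Called `F_{n,k}` for `k ≤ 0` and
`G_{n,k}` for `k ≥ 2`.) -/
def taylorCoeff (k : ℤ) (n : ℕ) (z : ℍ) : ℂ :=
  iteratedDeriv n (doublyCompleted k z) 0 / (n.factorial : ℂ)

/-! ### Polyharmonic Maass forms and the polyharmonic Eisenstein space -/

/-- Membership in `V_k^m(0)`: smooth, modular of weight `k` for `SL(2, ℤ)`, annihilated by the
`m`-th power of `Δ_k`, and of moderate growth at the cusp, uniformly in `x`. -/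
structure IsPolyharmonicMaassForm (k : ℤ) (m : ℕ) (f : ℍ → ℂ) : Prop where
  smooth : ContDiffOn ℝ ∞ (f ∘ ofComplex) {z : ℂ | 0 < z.im}
  modular : ∀ γ : SL(2, ℤ), f ∣[k] γ = f
  harmonic : (laplacian k)^[m] f = 0
  growth : ∃ α : ℝ, f =O[atImInfty] fun z : ℍ => z.im ^ α

/-- The polyharmonic Eisenstein space `E_k^m(0)`: the forms in `V_k^m(0)` that are linear
combinations of Taylor coefficients of the doubly completed Eisenstein series of weight `k`. -/
def eisensteinSpace (k : ℤ) (m : ℕ) : Set (ℍ → ℂ) :=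
  {f | IsPolyharmonicMaassForm k m f ∧ f ∈ Submodule.span ℂ (Set.range (taylorCoeff k))}

/-- For every `m ≥ 1` the first `m` functions of the sequence are a basis of `E_k^m(0)`. -/
def IsEisensteinBasis (k : ℤ) (f : ℕ → ℍ → ℂ) : Prop :=
  ∀ m : ℕ, 1 ≤ m →
    LinearIndependent ℂ (fun j : Fin m => f j) ∧
      (Submodule.span ℂ (Set.range fun j : Fin m => f j) : Set (ℍ → ℂ)) = eisensteinSpace k m

/-- `f_{n-1}`, with the convention `f_{-1} = 0`. -/
def prev (f : ℕ → ℍ → ℂ) : ℕ → ℍ → ℂ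
  | 0 => 0
  | n + 1 => f n

/-- `G` (weight `k`) and `F` (weight `2 - k`) are bases of the polyharmonic Eisenstein spaces that
satisfy the ramp and tower relations. -/
structure IsModifiedBasis (k : ℤ) (G F : ℕ → ℍ → ℂ) : Prop where
  basis_G : IsEisensteinBasis k G
  basis_F : IsEisensteinBasis (2 - k) F
  ramp_G : ∀ n, xi k (G n) = ((k : ℂ) - 1) • prev F n
  ramp_F : ∀ n, xi (2 - k) (F n) = G n
  tower_G : ∀ n, laplacian k (G n) = ((k : ℂ) - 1) • prev G n
  tower_F : ∀ n, laplacian (2 - k) (F n) = ((k : ℂ) - 1) • prev F n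

/-- `G̃_{n,k} = ∑_{ℓ=0}^n (-1)^ℓ (k-1)^{-ℓ} C(n+ℓ, n) G_{n-ℓ,k}`. -/
def modifiedG (k : ℤ) (n : ℕ) : ℍ → ℂ := fun z =>
  ∑ l ∈ Finset.range (n + 1),
    (-1) ^ l * (1 / ((k : ℂ) - 1) ^ l) * ((n + l).choose n : ℂ) * taylorCoeff k (n - l) z

/-- `F̃_{n,2-k} = (-1)^n ∑_{ℓ=0}^n (k-1)^{-ℓ} C(n+ℓ, n) F_{n-ℓ,2-k}`; the argument is `k`. -/
def modifiedF (k : ℤ) (n : ℕ) : ℍ → ℂ := fun z =>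
  (-1) ^ n * ∑ l ∈ Finset.range (n + 1),
    (1 / ((k : ℂ) - 1) ^ l) * ((n + l).choose n : ℂ) * taylorCoeff (2 - k) (n - l) z

end PolyharmonicMaass

end

/-! Put a = k - 2 and w = mz + n, so that the two weights are a + 2 and -a. The summands of the
Eisenstein series are w^a / |w|^(2s) in weight -a and w̄^b / |w|^(2(s+b)) in weight b = a + 2. Up to
elementary factors both series are therefore Mellin transforms in t of theta series, the sums of w^a
(or w̄^b) times exp(-πt|w|²/y) over nonzero (m, n).

For exponent 0, with the zero vector included, Poisson summation in n gives θ(1/t) = t θ(t). Each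
∂/∂z̄ multiplies a summand by a constant times t w² / y², so differentiating this identity yields
θ(1/t) = t^(a+1) θ(t) for even a > 0, and the correction from the zero vector disappears
(`tsum_thetaTerm_inv`). Folding the Mellin integral at t = 1 leaves integrals over (1, ∞) that are
entire in s (`mellin_eq_add_of_inv_eq`), which gives the continuation. The same integrals, with
powers of log t, are the Taylor coefficients. They are smooth, modular and of moderate growth
because the Gaussian sums are.

Two computations give the action of ξ. The derivative ∂/∂z̄ turns w^a into t w^(a+2), and after
conjugation ξ_{-a} carries the completed series of weight -a at s to that of weight a + 2 at -s̄
(`xi_negCoeff`). Conversely ξ_{a+2} gives s̄(s̄ + a + 1) times the series of weight -a at -s̄, by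
integration by parts in t; the boundary terms at t = 1 cancel because of the derivative of the
inversion formula there (`tailTheta_parts`, `xi_posCoeff`). The polynomial factors of the double
completion are interchanged by s ↦ -s. Hence, with F'_n = (-1)^n F_n and κ = k - 1, ξF'_n = G_n and
ξG_n = κF'_{n-1} + F'_{n-2}.

The binomial combinations remove the F'_{n-2} term by Pascal's rule (`sum_modifiedCoeff_smul`),
which gives the ramp relations, and Δ_κ = ξ_{2-κ} ξ_κ gives the tower relations. A tower over a
nonzero bottom element is linearly independent, and Δ^m kills exactly the span of its first m
members (`isEisensteinBasis_of_tower`). The bottom G_0 is a nonzero multiple of the holomorphic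
Eisenstein series, and the bottom in weight 2 - k is nonzero because ξ sends it to G_0. -/

noncomputable section

namespace PolyharmonicMaass

open Complex Filter Topology MeasureTheory

/-! ### Wirtinger derivatives -/

/-- `f` is real differentiable at `z` with `df = A dz + B dz̄`. -/
def HasWirtingerDerivAt (f : ℂ → ℂ) (A B z : ℂ) : Prop :=
  HasFDerivAt f (A • (1 : ℂ →L[ℝ] ℂ) + B • (conjCLE : ℂ →L[ℝ] ℂ)) z

namespace HasWirtingerDerivAt

variable {f g : ℂ → ℂ} {A B A' B' z : ℂ}

lemma congr_val (h : HasWirtingerDerivAt f A B z) (hA : A = A') (hB : B = B') :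
    HasWirtingerDerivAt f A' B' z := by subst hA hB; exact h

lemma congr_fun (h : HasWirtingerDerivAt f A B z) (hfg : g =ᶠ[𝓝 z] f) :
    HasWirtingerDerivAt g A B z := HasFDerivAt.congr_of_eventuallyEq h hfg

lemma const (c : ℂ) : HasWirtingerDerivAt (fun _ => c) 0 0 z := by
  refine (hasFDerivAt_const (𝕜 := ℝ) c z).congr_fderiv ?_
  ext v; simp

lemma id' : HasWirtingerDerivAt (fun w => w) 1 0 z := by
  refine (hasFDerivAt_id (𝕜 := ℝ) z).congr_fderiv ?_
  ext v; simp

lemma conj' : HasWirtingerDerivAt (fun w => starRingEnd ℂ w) 0 1 z := by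
  refine ((conjCLE : ℂ →L[ℝ] ℂ).hasFDerivAt (x := z)).congr_fderiv ?_
  ext v; simp

lemma im' : HasWirtingerDerivAt (fun w => (w.im : ℂ)) (-Complex.I / 2) (Complex.I / 2) z := by
  have h : HasFDerivAt (fun w : ℂ => (w.im : ℂ)) (ofRealCLM.comp imCLM) z :=
    (ofRealCLM.comp imCLM).hasFDerivAt
  unfold HasWirtingerDerivAt
  convert h using 1
  ext v
  apply Complex.ext <;> simp <;> ring

lemma add (hf : HasWirtingerDerivAt f A B z) (hg : HasWirtingerDerivAt g A' B' z) :
    HasWirtingerDerivAt (fun w => f w + g w) (A + A') (B + B') z := by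
  unfold HasWirtingerDerivAt at *
  refine (HasFDerivAt.add hf hg).congr_fderiv ?_
  ext v; simp; ring

lemma mul (hf : HasWirtingerDerivAt f A B z) (hg : HasWirtingerDerivAt g A' B' z) :
    HasWirtingerDerivAt (fun w => f w * g w) (A * g z + f z * A') (B * g z + f z * B') z := by
  unfold HasWirtingerDerivAt at *
  refine (HasFDerivAt.mul hf hg).congr_fderiv ?_
  ext v; simp; ring

lemma const_mul (c : ℂ) (hf : HasWirtingerDerivAt f A B z) :
    HasWirtingerDerivAt (fun w => c * f w) (c * A) (c * B) z :=
  ((const c).mul hf).congr_val (by ring) (by ring)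

lemma pow (n : ℕ) (hf : HasWirtingerDerivAt f A B z) :
    HasWirtingerDerivAt (fun w => f w ^ n) (n * f z ^ (n - 1) * A) (n * f z ^ (n - 1) * B) z := by
  unfold HasWirtingerDerivAt at *
  refine (((hasDerivAt_pow n (f z)).hasFDerivAt.restrictScalars ℝ).comp z hf).congr_fderiv ?_
  ext v; simp; ring

lemma exp' (hf : HasWirtingerDerivAt f A B z) :
    HasWirtingerDerivAt (fun w => Complex.exp (f w)) (Complex.exp (f z) * A)
      (Complex.exp (f z) * B) z := by
  unfold HasWirtingerDerivAt at *
  refine (((Complex.hasDerivAt_exp (f z)).hasFDerivAt.restrictScalars ℝ).comp z hf).congr_fderiv ?_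
  ext v; simp; ring

lemma inv (hf : HasWirtingerDerivAt f A B z) (h0 : f z ≠ 0) :
    HasWirtingerDerivAt (fun w => (f w)⁻¹) (-A / f z ^ 2) (-B / f z ^ 2) z := by
  unfold HasWirtingerDerivAt at *
  refine (((hasDerivAt_inv h0).hasFDerivAt.restrictScalars ℝ).comp z hf).congr_fderiv ?_
  ext v; simp; field_simp

/-- The dz̄-coefficient of a real differential L is (L(1) + iL(i))/2. This is what permits applying
∂/∂z̄ to both sides of an identity between theta series. -/
lemma ext_bar (hf : HasWirtingerDerivAt f A B z) (hg : HasWirtingerDerivAt f A' B' z) :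
    B = B' := by
  have h := HasFDerivAt.unique hf hg
  have h1 := DFunLike.congr_fun h 1
  have h2 := DFunLike.congr_fun h Complex.I
  simp at h1 h2
  have hI : Complex.I * Complex.I = -1 := I_mul_I
  linear_combination (h1 + Complex.I * h2) / 2 - (A * hI - B * hI - A' * hI + B' * hI) / 2

end HasWirtingerDerivAt

lemma isOpen_upper : IsOpen {z : ℂ | 0 < z.im} := isOpen_lt continuous_const continuous_im

lemma comp_ofComplex_eventuallyEq {f : ℍ → ℂ} {φ : ℂ → ℂ} (h : ∀ z : ℍ, f z = φ z) (z : ℍ) :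
    (f ∘ ofComplex) =ᶠ[𝓝 (z : ℂ)] φ := by
  filter_upwards [isOpen_upper.mem_nhds z.2] with w hw
  simp [h, ofComplex_apply_of_im_pos hw]

lemma xi_eq_of_hasWirtingerDerivAt {f : ℍ → ℂ} {φ : ℂ → ℂ} (h : ∀ z : ℍ, f z = φ z) {z : ℍ}
    {A B : ℂ} (k : ℤ) (hφ : HasWirtingerDerivAt φ A B z) :
    xi k f z = 2 * Complex.I * (z.im : ℂ) ^ k * starRingEnd ℂ B := by
  have := (hφ.congr_fun (comp_ofComplex_eventuallyEq h z)).fderiv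
  rw [xi, partialZBar, partialX, partialY, this]
  congr 2
  have hI : Complex.I * Complex.I = -1 := I_mul_I
  simp
  linear_combination (A * hI - B * hI) / 2

/-- Smooth functions on the upper half plane. -/
def smoothFunctions : Submodule ℂ (ℍ → ℂ) where
  carrier := {f | ContDiffOn ℝ ∞ (f ∘ ofComplex) {z : ℂ | 0 < z.im}}
  add_mem' := fun hf hg => ContDiffOn.add hf hg
  zero_mem' := contDiffOn_const
  smul_mem' := fun _ _ hf => contDiffOn_const.smul hf

/-! ### Linearity of Δ and ξ, and the factorisation of Δ -/

section smooth

variable {f g : ℍ → ℂ}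

lemma contDiffAt_of_smooth (hf : f ∈ smoothFunctions) (z : ℍ) :
    ContDiffAt ℝ ∞ (f ∘ ofComplex) z :=
  ContDiffOn.contDiffAt hf (isOpen_upper.mem_nhds z.2)

lemma differentiableAt_of_smooth (hf : f ∈ smoothFunctions) (z : ℍ) :
    DifferentiableAt ℝ (f ∘ ofComplex) z :=
  (contDiffAt_of_smooth hf z).differentiableAt (by simp)

lemma partialX_smul_add (hf : f ∈ smoothFunctions) (hg : g ∈ smoothFunctions) (c : ℂ) :
    partialX (c • f + g) = c • partialX f + partialX g := by
  ext z
  have h1 := differentiableAt_of_smooth hf z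
  have h2 := differentiableAt_of_smooth hg z
  have : (c • f + g) ∘ ofComplex = c • (f ∘ ofComplex) + (g ∘ ofComplex) := rfl
  simp only [partialX, this, Pi.add_apply, Pi.smul_apply]
  rw [fderiv_add (h1.const_smul c) h2, fderiv_const_smul h1]
  simp

lemma partialY_smul_add (hf : f ∈ smoothFunctions) (hg : g ∈ smoothFunctions) (c : ℂ) :
    partialY (c • f + g) = c • partialY f + partialY g := by
  ext z
  have h1 := differentiableAt_of_smooth hf z
  have h2 := differentiableAt_of_smooth hg z
  have : (c • f + g) ∘ ofComplex = c • (f ∘ ofComplex) + (g ∘ ofComplex) := rfl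
  simp only [partialY, this, Pi.add_apply, Pi.smul_apply]
  rw [fderiv_add (h1.const_smul c) h2, fderiv_const_smul h1]
  simp

lemma partial_smooth (v : ℂ) (hf : f ∈ smoothFunctions) :
    (fun z : ℍ => fderiv ℝ (f ∘ ofComplex) (z : ℂ) v) ∈ smoothFunctions := by
  have h1 : ContDiffOn ℝ ∞ (fderiv ℝ (f ∘ ofComplex)) {z : ℂ | 0 < z.im} :=
    ContDiffOn.fderiv_of_isOpen hf isOpen_upper (by simp)
  have h2 : ContDiffOn ℝ ∞ (fun w => fderiv ℝ (f ∘ ofComplex) w v) {z : ℂ | 0 < z.im} :=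
    h1.clm_apply contDiffOn_const
  refine h2.congr fun w hw => ?_
  simp [ofComplex_apply_of_im_pos hw]

lemma partialX_smooth (hf : f ∈ smoothFunctions) : partialX f ∈ smoothFunctions :=
  partial_smooth 1 hf

lemma partialY_smooth (hf : f ∈ smoothFunctions) : partialY f ∈ smoothFunctions :=
  partial_smooth Complex.I hf

lemma laplacian_smul_add (k : ℤ) (hf : f ∈ smoothFunctions) (hg : g ∈ smoothFunctions) (c : ℂ) :
    laplacian k (c • f + g) = c • laplacian k f + laplacian k g := by
  ext z
  simp only [laplacian, partialX_smul_add hf hg, partialY_smul_add hf hg,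
    partialX_smul_add (partialX_smooth hf) (partialX_smooth hg),
    partialY_smul_add (partialY_smooth hf) (partialY_smooth hg), Pi.add_apply, Pi.smul_apply,
    smul_eq_mul]
  ring

lemma xi_smul_add (k : ℤ) (hf : f ∈ smoothFunctions) (hg : g ∈ smoothFunctions) (c : ℂ) :
    xi k (c • f + g) = starRingEnd ℂ c • xi k f + xi k g := by
  ext z
  simp only [xi, partialZBar, partialX_smul_add hf hg, partialY_smul_add hf hg, Pi.add_apply,
    Pi.smul_apply, smul_eq_mul, map_add, map_mul, map_div₀]
  ring

/-- The two conjugations combine to 4 y^(2-k) ∂_z (y^k ∂_z̄ f). The mixed second derivatives cancel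
by symmetry, and ∂_z y = -i/2 produces the first-order term. -/
lemma laplacian_eq_xi_xi (k : ℤ) (hf : f ∈ smoothFunctions) :
    laplacian k f = xi (2 - k) (xi k f) := by
  ext z
  set φ := f ∘ ofComplex with hφ
  set D := fderiv ℝ φ with hD
  set H := fderiv ℝ D (z : ℂ) with hH
  have hc := contDiffAt_of_smooth hf z
  have hDd : HasFDerivAt D H (z : ℂ) :=
    ((hc.fderiv_right (m := 1) (by norm_cast)).differentiableAt (by simp)).hasFDerivAt
  have happ (v : ℂ) : HasFDerivAt (fun w => D w v) (H.flip v) (z : ℂ) :=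
    (hDd.clm_apply (hasFDerivAt_const v (z : ℂ))).congr_fderiv (by ext; simp)
  have hsymm : H 1 Complex.I = H Complex.I 1 :=
    (hc.isSymmSndFDerivAt (by simp; norm_cast)) 1 Complex.I
  have hev (v : ℂ) : ((fun z : ℍ => fderiv ℝ φ (z : ℂ) v) ∘ ofComplex) =ᶠ[𝓝 (z : ℂ)]
      fun w => D w v := comp_ofComplex_eventuallyEq (φ := fun w => D w v) (fun _ => rfl) z
  have hX : partialX (partialX f) z = H 1 1 := by
    change fderiv ℝ ((fun z : ℍ => fderiv ℝ φ (z : ℂ) 1) ∘ ofComplex) (z : ℂ) 1 = _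
    rw [(hev 1).fderiv_eq, (happ 1).fderiv]; rfl
  have hY : partialY (partialY f) z = H Complex.I Complex.I := by
    change fderiv ℝ ((fun z : ℍ => fderiv ℝ φ (z : ℂ) Complex.I) ∘ ofComplex) (z : ℂ) Complex.I = _
    rw [(hev Complex.I).fderiv_eq, (happ Complex.I).fderiv]; rfl
  have hy : (z.im : ℂ) ≠ 0 := by exact_mod_cast z.im_ne_zero
  have him : HasFDerivAt (fun w : ℂ => ((w.im : ℂ)) ^ k)
      (((k : ℂ) * (z.im : ℂ) ^ (k - 1)) • (ofRealCLM.comp imCLM)) (z : ℂ) := by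
    have h1 : HasFDerivAt (fun w : ℂ => (w.im : ℂ)) (ofRealCLM.comp imCLM) (z : ℂ) :=
      (ofRealCLM.comp imCLM).hasFDerivAt
    refine (((hasDerivAt_zpow k (z.im : ℂ) (Or.inl hy)).hasFDerivAt.restrictScalars ℝ).comp
      (z : ℂ) h1).congr_fderiv ?_
    ext v; simp; ring
  have hxi : HasFDerivAt (xi k f ∘ ofComplex)
      (((2 * Complex.I * (z.im : ℂ) ^ k) • ((conjCLE : ℂ →L[ℝ] ℂ).comp
        ((1 / 2 : ℂ) • (H.flip 1 + Complex.I • H.flip Complex.I)))) +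
      ((starRingEnd ℂ) ((D z 1 + Complex.I * D z Complex.I) / 2) * (2 * Complex.I)) •
        (((k : ℂ) * (z.im : ℂ) ^ (k - 1)) • (ofRealCLM.comp imCLM))) (z : ℂ) := by
    have h1 : HasFDerivAt (fun w => (1 / 2 : ℂ) • (D w 1 + Complex.I • D w Complex.I))
        ((1 / 2 : ℂ) • (H.flip 1 + Complex.I • H.flip Complex.I)) (z : ℂ) :=
      ((happ 1).fun_add ((happ Complex.I).fun_const_smul Complex.I)).fun_const_smul _
    have h2 := (conjCLE : ℂ →L[ℝ] ℂ).hasFDerivAt.comp (z : ℂ) h1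
    have h3 := (him.const_mul (2 * Complex.I)).mul h2
    refine (h3.congr_of_eventuallyEq ?_).congr_fderiv ?_
    · filter_upwards [isOpen_upper.mem_nhds z.2] with w hw
      simp only [Function.comp, ofComplex_apply_of_im_pos hw, xi, partialZBar, partialX, partialY]
      simp [hD, hφ]
      ring_nf
      simp
    · ext v
      simp
      ring
  rw [laplacian, hX, hY, xi, partialZBar, partialX.eq_1 (xi k f), partialY.eq_1 (xi k f),
    hxi.fderiv]
  have e1 : partialX f z = D z 1 := rfl
  have e2 : partialY f z = D z Complex.I := rfl
  rw [e1, e2]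
  have hz1 : (z.im : ℂ) ^ (k - 1) = (z.im : ℂ) ^ k / z.im := by
    rw [zpow_sub_one₀ hy]; rfl
  have hz2 : (z.im : ℂ) ^ (2 - k) = (z.im : ℂ) ^ 2 / (z.im : ℂ) ^ k := by
    rw [zpow_sub₀ hy]; norm_cast
  have hzk : (z.im : ℂ) ^ k ≠ 0 := zpow_ne_zero _ hy
  simp only [add_apply, smul_apply,
    ContinuousLinearMap.comp_apply, ContinuousLinearMap.flip_apply, hsymm, hz1, hz2]
  simp [← coe_im]
  have hy' : ((z : ℂ).im : ℂ) ≠ 0 := hy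
  have hzk' : ((z : ℂ).im : ℂ) ^ k ≠ 0 := hzk
  field_simp
  have hI : Complex.I ^ 2 = -1 := I_sq
  have hI3 : Complex.I ^ 3 = -Complex.I := by rw [pow_succ, hI]; ring
  have hI4 : Complex.I ^ 4 = 1 := by rw [show 4 = 2 * 2 from rfl, pow_mul, hI]; ring
  ring_nf
  simp only [hI, hI3, hI4]
  ring

end smooth

/-! ### Gaussian lattice sums -/

/-- The linear form `m z + n` attached to `p = (m, n)`. -/
def linForm (p : ℤ × ℤ) (z : ℂ) : ℂ := p.1 * z + p.2

/-- With `w = m z + n`, the summand `m ^ i w ^ a w̄ ^ b exp (-π t |w|² / y)`. -/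
def thetaTerm (i a b : ℕ) (p : ℤ × ℤ) (z : ℂ) (t : ℝ) : ℂ :=
  (p.1 : ℂ) ^ i * linForm p z ^ a * starRingEnd ℂ (linForm p z) ^ b *
    cexp (-(Real.pi * t) * (linForm p z * starRingEnd ℂ (linForm p z) * (z.im : ℂ)⁻¹))

lemma norm_thetaTerm (i a b : ℕ) (p : ℤ × ℤ) (z : ℂ) (t : ℝ) :
    ‖thetaTerm i a b p z t‖ = |(p.1 : ℝ)| ^ i * ‖linForm p z‖ ^ (a + b) *
      Real.exp (-(Real.pi * t * ‖linForm p z‖ ^ 2 / z.im)) := by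
  have : (-(Real.pi * t) * (linForm p z * starRingEnd ℂ (linForm p z) * (z.im : ℂ)⁻¹) : ℂ) =
      ((-(Real.pi * t * ‖linForm p z‖ ^ 2 / z.im) : ℝ) : ℂ) := by
    rw [mul_conj, normSq_eq_norm_sq]; push_cast; ring
  rw [thetaTerm, this, norm_mul, norm_exp_ofReal]
  simp [pow_add]
  ring

lemma norm_prod_int_eq (p : ℤ × ℤ) : ‖![p.1, p.2]‖ = ‖p‖ := by
  rw [EisensteinSeries.norm_eq_max_natAbs, Prod.norm_def]
  simp [Int.norm_eq_abs, Nat.cast_natAbs]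

lemma one_le_norm_of_ne_zero {p : ℤ × ℤ} (hp : p ≠ 0) : 1 ≤ ‖p‖ := by
  rw [Prod.norm_def]
  have : p.1 ≠ 0 ∨ p.2 ≠ 0 := by
    by_contra! h
    exact hp (Prod.ext h.1 h.2)
  rcases this with h | h
  · exact le_max_of_le_left (by rw [Int.norm_eq_abs]; exact_mod_cast Int.one_le_abs h)
  · exact le_max_of_le_right (by rw [Int.norm_eq_abs]; exact_mod_cast Int.one_le_abs h)

/-- One constant serves a whole vertical half-strip; this uniformity is used both for domination
near a point and for growth at the cusp. -/
lemma exists_mul_norm_le_norm_linForm (A : ℝ) {B : ℝ} (hB : 0 < B) :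
    ∃ r : ℝ, 0 < r ∧ ∀ z : ℂ, |z.re| ≤ A → B ≤ z.im → ∀ p : ℤ × ℤ, p ≠ 0 →
      r * ‖p‖ ≤ ‖linForm p z‖ := by
  refine ⟨EisensteinSeries.r ⟨⟨A, B⟩, hB⟩, EisensteinSeries.r_pos _, fun z hA hz p hp => ?_⟩
  have hp' : ![p.1, p.2] ≠ 0 := fun h =>
    hp (Prod.ext (by simpa using congr_fun h 0) (by simpa using congr_fun h 1))
  have h1 := EisensteinSeries.r_mul_max_le ⟨z, hB.trans_le hz⟩ hp'
  have h2 := EisensteinSeries.r_lower_bound_on_verticalStrip ⟨z, hB.trans_le hz⟩ hB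
    (A := A) ⟨hA, hz⟩
  rw [norm_prod_int_eq] at h1
  refine (mul_le_mul_of_nonneg_right h2 (norm_nonneg _)).trans (h1.trans (le_of_eq ?_))
  simp [linForm]

/-- The Gaussian is traded for a power through exp(-u) ≤ N!/u^N. Enough of |w|^(2N) is left to give
the decay ‖p‖^(-3), summable over ℤ², at the price of (y/t)^N. -/
lemma exists_norm_thetaTerm_le (i a b N : ℕ) (hN : i + a + b + 3 ≤ 2 * N) (A : ℝ) {B : ℝ}
    (hB : 0 < B) :
    ∃ C : ℝ, 0 ≤ C ∧ ∀ z : ℂ, |z.re| ≤ A → B ≤ z.im → ∀ p : ℤ × ℤ, p ≠ 0 → ∀ t : ℝ, 0 < t →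
      ‖thetaTerm i a b p z t‖ ≤ C * (z.im / t) ^ N * (‖p‖ ^ 3)⁻¹ := by
  obtain ⟨r, hr, hr'⟩ := exists_mul_norm_le_norm_linForm A hB
  -- d is the power of |w| that remains after |w|^(a+b) is cancelled; the hypothesis on N makes d ≥
  -- i + 3.
  obtain ⟨d, hd⟩ : ∃ d, 2 * N = a + b + d := ⟨2 * N - (a + b), by omega⟩
  refine ⟨N.factorial / Real.pi ^ N / r ^ d, by positivity, fun z hA hz p hp t ht => ?_⟩
  have hy : 0 < z.im := hB.trans_le hz
  have hp1 := one_le_norm_of_ne_zero hp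
  have hw := hr' z hA hz p hp
  set W := ‖linForm p z‖ with hW
  have hWpos : 0 < W := lt_of_lt_of_le (by positivity) hw
  set u := Real.pi * t * W ^ 2 / z.im with hu
  have hupos : 0 < u := by positivity
  rw [norm_thetaTerm]
  have hexp : Real.exp (-u) ≤ N.factorial / u ^ N := by
    have := Real.pow_div_factorial_le_exp u hupos.le N
    rw [Real.exp_neg, ← inv_div]
    exact inv_anti₀ (by positivity) this
  have hm : |(p.1 : ℝ)| ≤ ‖p‖ := by
    rw [← Int.norm_eq_abs]
    exact norm_fst_le p
  calc |(p.1 : ℝ)| ^ i * W ^ (a + b) * Real.exp (-u)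
      ≤ ‖p‖ ^ i * W ^ (a + b) * (N.factorial / u ^ N) := by gcongr
    _ = ‖p‖ ^ i * (N.factorial / Real.pi ^ N) * (z.im / t) ^ N / W ^ d := by
        rw [hu]
        have : (W ^ 2) ^ N = W ^ (a + b) * W ^ d := by rw [← pow_mul, hd, pow_add]
        rw [div_pow, mul_pow, mul_pow, this, div_pow]
        field_simp
    _ ≤ ‖p‖ ^ i * (N.factorial / Real.pi ^ N) * (z.im / t) ^ N / (r * ‖p‖) ^ d := by gcongr
    _ = (N.factorial / Real.pi ^ N / r ^ d) * (z.im / t) ^ N * (‖p‖ ^ i / ‖p‖ ^ d) := by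
        rw [mul_pow]; field_simp
    _ ≤ _ := by
        gcongr
        rw [← one_div, div_le_div_iff₀ (by positivity) (by positivity), ← pow_add, one_mul]
        exact pow_le_pow_right₀ hp1 (by omega)

lemma summable_norm_prod_int_rpow {σ : ℝ} (hσ : 2 < σ) :
    Summable fun p : {p : ℤ × ℤ // p ≠ 0} => ‖p.1‖ ^ (-σ) := by
  have h := EisensteinSeries.summable_one_div_norm_rpow hσ
  rw [← (finTwoArrowEquiv ℤ).symm.summable_iff] at h
  refine (h.subtype {p : ℤ × ℤ | p ≠ 0}).congr fun p => ?_
  simp [← norm_prod_int_eq]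

lemma summable_norm_prod_int :
    Summable fun p : {p : ℤ × ℤ // p ≠ 0} => (‖p.1‖ ^ 3)⁻¹ := by
  refine (summable_norm_prod_int_rpow (σ := 3) (by norm_num)).congr fun p => ?_
  rw [Real.rpow_neg (norm_nonneg _)]
  norm_cast

/-- The family is closed under differentiation: a derivative of w or w̄ gives a factor m, recorded
by `i`. For the exponent, w - w̄ = 2imy yields ∂_z̄(|w|²/y) = -(i/2) w²/y², and the conjugate
formula for ∂_z. -/
lemma hasWirtingerDerivAt_thetaTerm (i a b : ℕ) (p : ℤ × ℤ) {z : ℂ} (hz : 0 < z.im) (t : ℝ) :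
    HasWirtingerDerivAt (fun w => thetaTerm i a b p w t)
      (a * thetaTerm (i + 1) (a - 1) b p z t -
        Complex.I / 2 * Real.pi * ((z.im : ℂ)⁻¹) ^ 2 * (t * thetaTerm i a (b + 2) p z t))
      (b * thetaTerm (i + 1) a (b - 1) p z t +
        Complex.I / 2 * Real.pi * ((z.im : ℂ)⁻¹) ^ 2 * (t * thetaTerm i (a + 2) b p z t)) z := by
  have hy : (z.im : ℂ) ≠ 0 := by exact_mod_cast hz.ne'
  have hw : HasWirtingerDerivAt (fun w => linForm p w) p.1 0 z :=
    ((HasWirtingerDerivAt.id'.const_mul (p.1 : ℂ)).add (.const (p.2 : ℂ))).congr_val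
      (by ring) (by ring)
  have hwb : HasWirtingerDerivAt (fun w => starRingEnd ℂ (linForm p w)) 0 p.1 z := by
    have := ((HasWirtingerDerivAt.conj' (z := z)).const_mul (p.1 : ℂ)).add (.const (p.2 : ℂ))
    refine (this.congr_fun (.of_forall fun w => ?_)).congr_val (by ring) (by ring)
    simp [linForm]
  have hq := (hw.mul hwb).mul (HasWirtingerDerivAt.im'.inv hy)
  have he := (hq.const_mul (-(Real.pi * t))).exp'
  have hsub : linForm p z - starRingEnd ℂ (linForm p z) = 2 * Complex.I * p.1 * z.im := by
    rw [Complex.sub_conj]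
    simp [linForm]; ring
  refine ((((hw.pow a).const_mul ((p.1 : ℂ) ^ i)).mul (hwb.pow b)).mul he).congr_val ?_ ?_
  · simp only [thetaTerm]
    set E := cexp (-(Real.pi * t) * (linForm p z * starRingEnd ℂ (linForm p z) * (z.im : ℂ)⁻¹))
    have hmid : (-(Real.pi * t)) * ((↑p.1 * starRingEnd ℂ (linForm p z) + linForm p z * 0) *
        (z.im : ℂ)⁻¹ + linForm p z * starRingEnd ℂ (linForm p z) * (-(-Complex.I / 2) / (z.im : ℂ) ^ 2)) =
        -(Complex.I / 2 * Real.pi * ((z.im : ℂ)⁻¹) ^ 2 * t * starRingEnd ℂ (linForm p z) ^ 2) := by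
      field_simp
      have hI : Complex.I ^ 2 = -1 := I_sq
      linear_combination (-Complex.I * t * starRingEnd ℂ (linForm p z)) * hsub -
        2 * t * (p.1 : ℂ) * z.im * starRingEnd ℂ (linForm p z) * hI
    rw [hmid]
    ring
  · simp only [thetaTerm]
    set E := cexp (-(Real.pi * t) * (linForm p z * starRingEnd ℂ (linForm p z) * (z.im : ℂ)⁻¹))
    have hmid : (-(Real.pi * t)) * ((0 * starRingEnd ℂ (linForm p z) + linForm p z * ↑p.1) *
        (z.im : ℂ)⁻¹ + linForm p z * starRingEnd ℂ (linForm p z) * (-(Complex.I / 2) / (z.im : ℂ) ^ 2)) =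
        (Complex.I / 2 * Real.pi * ((z.im : ℂ)⁻¹) ^ 2 * t * linForm p z ^ 2) := by
      field_simp
      have hI : Complex.I ^ 2 = -1 := I_sq
      linear_combination (-Complex.I * t * (linForm p z)) * hsub -
        2 * t * (p.1 : ℂ) * z.im * (linForm p z) * hI
    rw [hmid]
    ring

/-! ### Superpositions of Gaussian lattice sums -/

/-- `h` grows at most polynomially, in the sense that `h t / t ^ N` is `ν`-integrable for all
large `N`. -/
def Admissible (ν : Measure ℝ) (h : ℝ → ℂ) : Prop :=
  AEStronglyMeasurable h ν ∧
    ∃ N₀ : ℕ, ∀ N ≥ N₀, Integrable (fun t => ‖h t‖ * (t ^ N)⁻¹) ν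

lemma Admissible.mul_id {ν : Measure ℝ} (hν : ∀ᵐ t ∂ν, 0 < t) {h : ℝ → ℂ} (hh : Admissible ν h) :
    Admissible ν fun t => t * h t := by
  obtain ⟨hm, N₀, hN⟩ := hh
  refine ⟨continuous_ofReal.aestronglyMeasurable.mul hm, N₀ + 1, fun N hN' => ?_⟩
  obtain ⟨M, rfl⟩ : ∃ M, N = M + 1 := ⟨N - 1, by omega⟩
  refine (hN M (by omega)).congr ?_
  filter_upwards [hν] with t ht
  rw [norm_mul, norm_real, Real.norm_of_nonneg ht.le]
  field_simp
  ring

/-- The integral over `t` against `h dν` of the lattice sum of `thetaTerm i a b`. -/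
def thetaIntegral (ν : Measure ℝ) (i a b : ℕ) (h : ℝ → ℂ) (z : ℂ) : ℂ :=
  ∫ x : ℝ × {p : ℤ × ℤ // p ≠ 0}, h x.1 * thetaTerm i a b x.2 z x.1 ∂(ν.prod Measure.count)

section thetaIntegral

variable {ν : Measure ℝ} {h : ℝ → ℂ}

lemma measurable_thetaTerm (i a b : ℕ) (z : ℂ) :
    Measurable fun x : ℝ × {p : ℤ × ℤ // p ≠ 0} => thetaTerm i a b x.2 z x.1 := by
  refine measurable_from_prod_countable_left fun p => Continuous.measurable ?_
  unfold thetaTerm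
  fun_prop

lemma aestronglyMeasurable_mul_thetaTerm (hh : AEStronglyMeasurable h ν) (i a b : ℕ) (z : ℂ) :
    AEStronglyMeasurable (fun x : ℝ × {p : ℤ × ℤ // p ≠ 0} => h x.1 * thetaTerm i a b x.2 z x.1)
      (ν.prod Measure.count) :=
  hh.comp_fst.mul (measurable_thetaTerm i a b z).aestronglyMeasurable

lemma ae_prod_count_pos (hν : ∀ᵐ t ∂ν, 0 < t) :
    ∀ᵐ x ∂(ν.prod (Measure.count : Measure {p : ℤ × ℤ // p ≠ 0})), 0 < x.1 :=
  Measure.quasiMeasurePreserving_fst.ae hν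

/-- The bound separates into a function of (t, p), integrable as a product, and the factor y^N. It
thus serves for differentiation in z and for growth as y → ∞. -/
lemma exists_dominating (hν : ∀ᵐ t ∂ν, 0 < t) (hh : Admissible ν h) (i a b : ℕ) (A : ℝ) {B : ℝ}
    (hB : 0 < B) :
    ∃ (N : ℕ) (g : ℝ × {p : ℤ × ℤ // p ≠ 0} → ℝ), Integrable g (ν.prod Measure.count) ∧
      ∀ᵐ x ∂(ν.prod Measure.count), 0 ≤ g x ∧ ∀ z : ℂ, |z.re| ≤ A → B ≤ z.im →
        ‖h x.1 * thetaTerm i a b x.2 z x.1‖ ≤ z.im ^ N * g x := by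
  obtain ⟨hm, N₀, hN⟩ := hh
  -- Large enough both for integrability of h(t)/t^N and for the lattice bound.
  set N := N₀ + (i + a + b + 3)
  obtain ⟨C, hC, hC'⟩ := exists_norm_thetaTerm_le i a b N (by omega) A hB
  refine ⟨N, fun x => (C * (‖h x.1‖ * (x.1 ^ N)⁻¹)) * (‖x.2.1‖ ^ 3)⁻¹, ?_, ?_⟩
  · refine Integrable.mul_prod (g := fun p : {p : ℤ × ℤ // p ≠ 0} => (‖p.1‖ ^ 3)⁻¹)
      ((hN N (by omega)).const_mul C) (integrable_count_iff.2 ?_)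
    refine summable_norm_prod_int.congr fun p => ?_
    simp
  · filter_upwards [ae_prod_count_pos hν] with x hx
    refine ⟨by positivity, fun z hzA hzB => ?_⟩
    rw [norm_mul]
    calc ‖h x.1‖ * ‖thetaTerm i a b x.2 z x.1‖
        ≤ ‖h x.1‖ * (C * (z.im / x.1) ^ N * (‖x.2.1‖ ^ 3)⁻¹) := by
          gcongr
          exact hC' z hzA hzB _ x.2.2 _ hx
      _ = _ := by rw [div_pow]; ring

lemma integrable_mul_thetaTerm (hν : ∀ᵐ t ∂ν, 0 < t) (hh : Admissible ν h) (i a b : ℕ) {z : ℂ}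
    (hz : 0 < z.im) :
    Integrable (fun x : ℝ × {p : ℤ × ℤ // p ≠ 0} => h x.1 * thetaTerm i a b x.2 z x.1)
      (ν.prod Measure.count) := by
  obtain ⟨N, g, hg, hb⟩ := exists_dominating hν hh i a b |z.re| hz
  refine (hg.const_mul (z.im ^ N)).mono' (aestronglyMeasurable_mul_thetaTerm hh.1 i a b z) ?_
  filter_upwards [hb] with x hx
  exact hx.2 z le_rfl le_rfl

lemma thetaIntegral_eq_integral_tsum [SFinite ν] (hν : ∀ᵐ t ∂ν, 0 < t) (hh : Admissible ν h) (i a b : ℕ)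
    {z : ℂ} (hz : 0 < z.im) :
    thetaIntegral ν i a b h z =
      ∫ t, h t * ∑' p : {p : ℤ × ℤ // p ≠ 0}, thetaTerm i a b p z t ∂ν := by
  have hi := integrable_mul_thetaTerm hν hh i a b hz
  rw [thetaIntegral, integral_prod _ hi]
  refine integral_congr_ae ?_
  filter_upwards [hi.prod_right_ae] with t ht
  rw [integral_countable ht, ← tsum_mul_left]
  simp

/-- Differentiation under the integral over ν × counting measure. Keeping ν general covers lattice
sums at a fixed t (Dirac mass) and integrals over (1, ∞) at once. -/
lemma hasWirtingerDerivAt_thetaIntegral (hν : ∀ᵐ t ∂ν, 0 < t) (hh : Admissible ν h) (i a b : ℕ)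
    {z : ℂ} (hz : 0 < z.im) :
    HasWirtingerDerivAt (thetaIntegral ν i a b h)
      (a * thetaIntegral ν (i + 1) (a - 1) b h z -
        Complex.I / 2 * Real.pi * ((z.im : ℂ)⁻¹) ^ 2 * thetaIntegral ν i a (b + 2) (fun t => t * h t) z)
      (b * thetaIntegral ν (i + 1) a (b - 1) h z +
        Complex.I / 2 * Real.pi * ((z.im : ℂ)⁻¹) ^ 2 * thetaIntegral ν i (a + 2) b (fun t => t * h t) z)
      z := by
  have hh' := hh.mul_id hν
  -- The neighbourhood bounds Im w below for the Gaussian estimate and for 1/y², and above because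
  -- the dominating functions carry a factor (Im w)^N.
  set S : Set ℂ := {w | |w.re| < |z.re| + 1 ∧ z.im / 2 < w.im ∧ w.im < z.im + 1}
  have hS : S ∈ 𝓝 z := by
    refine IsOpen.mem_nhds ?_ ⟨by linarith, by linarith, by linarith⟩
    exact (isOpen_lt (Complex.continuous_re.abs) continuous_const).inter
      ((isOpen_lt continuous_const Complex.continuous_im).inter (isOpen_lt Complex.continuous_im continuous_const))
  have hB : 0 < z.im / 2 := by positivity
  obtain ⟨N₁, g₁, hg₁, hb₁⟩ := exists_dominating hν hh (i + 1) (a - 1) b (|z.re| + 1) hB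
  obtain ⟨N₂, g₂, hg₂, hb₂⟩ := exists_dominating hν hh' i a (b + 2) (|z.re| + 1) hB
  obtain ⟨N₃, g₃, hg₃, hb₃⟩ := exists_dominating hν hh (i + 1) a (b - 1) (|z.re| + 1) hB
  obtain ⟨N₄, g₄, hg₄, hb₄⟩ := exists_dominating hν hh' i (a + 2) b (|z.re| + 1) hB
  set FA : ℂ → ℝ × {p : ℤ × ℤ // p ≠ 0} → ℂ := fun w x =>
    a * (h x.1 * thetaTerm (i + 1) (a - 1) b x.2 w x.1) -
        Complex.I / 2 * Real.pi * ((w.im : ℂ)⁻¹) ^ 2 * ((x.1 * h x.1) * thetaTerm i a (b + 2) x.2 w x.1)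
    with hFA
  set FB : ℂ → ℝ × {p : ℤ × ℤ // p ≠ 0} → ℂ := fun w x =>
    b * (h x.1 * thetaTerm (i + 1) a (b - 1) x.2 w x.1) +
        Complex.I / 2 * Real.pi * ((w.im : ℂ)⁻¹) ^ 2 * ((x.1 * h x.1) * thetaTerm i (a + 2) b x.2 w x.1)
    with hFB
  have i1 := integrable_mul_thetaTerm hν hh (i + 1) (a - 1) b hz
  have i2 := integrable_mul_thetaTerm hν hh' i a (b + 2) hz
  have i3 := integrable_mul_thetaTerm hν hh (i + 1) a (b - 1) hz
  have i4 := integrable_mul_thetaTerm hν hh' i (a + 2) b hz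
  have iA : Integrable (FA z) (ν.prod Measure.count) := (i1.const_mul _).sub (i2.const_mul _)
  have iB : Integrable (FB z) (ν.prod Measure.count) := (i3.const_mul _).add (i4.const_mul _)
  have key := hasFDerivAt_integral_of_dominated_of_fderiv_le (𝕜 := ℝ) (μ := ν.prod Measure.count)
    (F := fun w (x : ℝ × {p : ℤ × ℤ // p ≠ 0}) => h x.1 * thetaTerm i a b x.2 w x.1)
    (F' := fun w x => FA w x • (1 : ℂ →L[ℝ] ℂ) + FB w x • (conjCLE : ℂ →L[ℝ] ℂ))
    (bound := fun x => (a * ((z.im + 1) ^ N₁ * g₁ x) +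
        Real.pi / 2 * (2 / z.im) ^ 2 * ((z.im + 1) ^ N₂ * g₂ x)) * ‖(1 : ℂ →L[ℝ] ℂ)‖ +
      (b * ((z.im + 1) ^ N₃ * g₃ x) +
        Real.pi / 2 * (2 / z.im) ^ 2 * ((z.im + 1) ^ N₄ * g₄ x)) * ‖(conjCLE : ℂ →L[ℝ] ℂ)‖)
    (x₀ := z) hS
    (.of_forall fun w => aestronglyMeasurable_mul_thetaTerm hh.1 i a b w)
    (integrable_mul_thetaTerm hν hh i a b hz)
    ((iA.aestronglyMeasurable.smul_const _).add (iB.aestronglyMeasurable.smul_const _))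
    ?_ ?_ ?_
  · unfold HasWirtingerDerivAt
    refine key.congr_fderiv ?_
    rw [integral_add (iA.smul_const _) (iB.smul_const _), integral_smul_const, integral_smul_const]
    congr 2
    · rw [hFA, integral_sub (i1.const_mul _) (i2.const_mul _), integral_const_mul,
        integral_const_mul]
      rfl
    · rw [hFB, integral_add (i3.const_mul _) (i4.const_mul _), integral_const_mul,
        integral_const_mul]
      rfl
  · filter_upwards [hb₁, hb₂, hb₃, hb₄] with x h₁ h₂ h₃ h₄ w ⟨hw1, hw2, hw3⟩
    have hw0 : 0 < w.im := hB.trans hw2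
    have hc : ‖(Complex.I / 2 * Real.pi * ((w.im : ℂ)⁻¹) ^ 2 : ℂ)‖ ≤ Real.pi / 2 * (2 / z.im) ^ 2 := by
      simp only [norm_mul, norm_div, norm_I, norm_pow, norm_inv, norm_real, Real.norm_eq_abs,
        abs_of_pos Real.pi_pos, abs_of_pos hw0, RCLike.norm_ofNat]
      rw [show (1 : ℝ) / 2 * Real.pi = Real.pi / 2 by ring]
      gcongr
      rw [inv_le_comm₀ hw0 (by positivity), inv_div]
      exact hw2.le
    have hle {N : ℕ} {g : ℝ} {v : ℂ} (hg : 0 ≤ g) (hv : ‖v‖ ≤ w.im ^ N * g) :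
        ‖v‖ ≤ (z.im + 1) ^ N * g := hv.trans (by gcongr)
    refine (norm_add_le _ _).trans (add_le_add ?_ ?_)
    · rw [norm_smul]
      gcongr
      refine (norm_sub_le _ _).trans (add_le_add ?_ ?_)
      · rw [norm_mul, norm_natCast]
        gcongr
        exact hle h₁.1 (h₁.2 w hw1.le hw2.le)
      · rw [norm_mul]
        gcongr
        exact hle h₂.1 (h₂.2 w hw1.le hw2.le)
    · rw [norm_smul]
      gcongr
      refine (norm_add_le _ _).trans (add_le_add ?_ ?_)
      · rw [norm_mul, norm_natCast]
        gcongr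
        exact hle h₃.1 (h₃.2 w hw1.le hw2.le)
      · rw [norm_mul]
        gcongr
        exact hle h₄.1 (h₄.2 w hw1.le hw2.le)
  · exact ((((hg₁.const_mul _).const_mul _).add ((hg₂.const_mul _).const_mul _)).mul_const _).add
      ((((hg₃.const_mul _).const_mul _).add ((hg₄.const_mul _).const_mul _)).mul_const _)
  · refine .of_forall fun x w ⟨hw1, hw2, hw3⟩ => ?_
    refine ((hasWirtingerDerivAt_thetaTerm i a b x.2 (hB.trans hw2) x.1).const_mul
      (h x.1)).congr_val ?_ ?_
    · simp only [hFA]; ring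
    · simp only [hFB]; ring

/-- The derivative is again built from such integrals, with other exponents and with t h(t) for h,
so the induction on the order must let all of these vary. -/
lemma contDiffOn_thetaIntegral (hν : ∀ᵐ t ∂ν, 0 < t) (hh : Admissible ν h) (i a b : ℕ) :
    ContDiffOn ℝ ∞ (thetaIntegral ν i a b h) {z : ℂ | 0 < z.im} := by
  rw [contDiffOn_infty]
  intro n
  induction n generalizing i a b h with
  | zero =>
    simp only [Nat.cast_zero, contDiffOn_zero]
    exact fun z hz =>
      (hasWirtingerDerivAt_thetaIntegral hν hh i a b hz).continuousAt.continuousWithinAt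
  | succ n ih =>
    have hinv : ContDiffOn ℝ n (fun z : ℂ => ((z.im : ℂ)⁻¹) ^ 2) {z : ℂ | 0 < z.im} := by
      refine (ContDiffOn.inv ?_ fun z hz => ?_).pow 2
      · exact (ofRealCLM.comp imCLM).contDiff.contDiffOn
      · exact_mod_cast (ne_of_gt hz)
    have hh' := hh.mul_id hν
    have hd : ∀ z ∈ {z : ℂ | 0 < z.im}, _ := fun z (hz : 0 < z.im) =>
      (show HasFDerivAt _ _ _ from hasWirtingerDerivAt_thetaIntegral hν hh i a b hz)
    push_cast
    rw [contDiffOn_succ_iff_fderiv_of_isOpen isOpen_upper]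
    refine ⟨fun z hz => (hd z hz).differentiableAt.differentiableWithinAt, by simp, ?_⟩
    refine ContDiffOn.congr ?_ fun z hz => (hd z hz).fderiv
    have h1 := ih hh (i + 1) (a - 1) b
    have h2 := ih hh' i a (b + 2)
    have h3 := ih hh (i + 1) a (b - 1)
    have h4 := ih hh' i (a + 2) b
    exact (((contDiffOn_const.mul h1).sub ((contDiffOn_const.mul hinv).mul h2)).smul
      contDiffOn_const).add (((contDiffOn_const.mul h3).add
        ((contDiffOn_const.mul hinv).mul h4)).smul contDiffOn_const)

end thetaIntegral

/-! ### Theta series with harmonic coefficients and their inversion formula -/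

lemma summable_thetaTerm (i a b : ℕ) {z : ℂ} (hz : 0 < z.im) {t : ℝ} (ht : 0 < t) :
    Summable fun p : {p : ℤ × ℤ // p ≠ 0} => thetaTerm i a b p z t := by
  obtain ⟨C, hC, hC'⟩ :=
    exists_norm_thetaTerm_le i a b (i + a + b + 3) (by omega) |z.re| hz
  refine Summable.of_norm_bounded (summable_norm_prod_int.mul_left (C * (z.im / t) ^ _))
    fun p => hC' z le_rfl le_rfl p.1 p.2 t ht

lemma ae_dirac_pos {t : ℝ} (ht : 0 < t) : ∀ᵐ u ∂(Measure.dirac t), 0 < u := by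
  rw [ae_dirac_iff measurableSet_Ioi]
  exact ht

lemma admissible_dirac (t : ℝ) (h : ℝ → ℂ) : Admissible (Measure.dirac t) h :=
  ⟨aestronglyMeasurable_dirac, 0, fun _ _ => integrable_dirac enorm_lt_top⟩

lemma thetaIntegral_dirac (i a b : ℕ) (h : ℝ → ℂ) {z : ℂ} (hz : 0 < z.im) {t : ℝ} (ht : 0 < t) :
    thetaIntegral (Measure.dirac t) i a b h z =
      h t * ∑' p : {p : ℤ × ℤ // p ≠ 0}, thetaTerm i a b p z t := by
  rw [thetaIntegral_eq_integral_tsum (ae_dirac_pos ht) (admissible_dirac t h) i a b hz,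
    integral_dirac]

/-- The case of a point mass at t in the theorem on theta integrals. -/
lemma hasWirtingerDerivAt_tsum_thetaTerm (i a b : ℕ) {z : ℂ} (hz : 0 < z.im) {t : ℝ}
    (ht : 0 < t) :
    HasWirtingerDerivAt (fun w => ∑' p : {p : ℤ × ℤ // p ≠ 0}, thetaTerm i a b p w t)
      (a * ∑' p : {p : ℤ × ℤ // p ≠ 0}, thetaTerm (i + 1) (a - 1) b p z t -
        Complex.I / 2 * Real.pi * ((z.im : ℂ)⁻¹) ^ 2 *
          (t * ∑' p : {p : ℤ × ℤ // p ≠ 0}, thetaTerm i a (b + 2) p z t))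
      (b * ∑' p : {p : ℤ × ℤ // p ≠ 0}, thetaTerm (i + 1) a (b - 1) p z t +
        Complex.I / 2 * Real.pi * ((z.im : ℂ)⁻¹) ^ 2 *
          (t * ∑' p : {p : ℤ × ℤ // p ≠ 0}, thetaTerm i (a + 2) b p z t)) z := by
  refine ((hasWirtingerDerivAt_thetaIntegral (ae_dirac_pos ht) (admissible_dirac t fun _ => 1)
    i a b hz).congr_val ?_ ?_).congr_fun ?_
  · simp only [thetaIntegral_dirac _ _ _ _ hz ht]; ring
  · simp only [thetaIntegral_dirac _ _ _ _ hz ht]; ring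
  · filter_upwards [isOpen_upper.mem_nhds hz] with w hw
    rw [thetaIntegral_dirac _ _ _ _ hw ht, one_mul]

lemma summable_exp_neg_mul_int_sq {c : ℝ} (hc : 0 < c) :
    Summable fun n : ℤ => Real.exp (-Real.pi * c * n ^ 2) := by
  have h := ((summable_jacobiTheta₂_term_iff 0 (c * Complex.I)).2 (by simpa using hc)).norm
  refine h.congr fun n => ?_
  rw [norm_jacobiTheta₂_term]
  congr 1
  simp
  ring

lemma thetaTerm_zero_eq (m n : ℤ) (z : ℂ) (t : ℝ) (hz : 0 < z.im) :
    thetaTerm 0 0 0 (m, n) z t =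
      cexp (-Real.pi * (t * z.im) * m ^ 2) * cexp (-Real.pi / (z.im / t) * (n + m * z.re) ^ 2) := by
  have hy : (z.im : ℂ) ≠ 0 := by exact_mod_cast hz.ne'
  rw [← Complex.exp_add, thetaTerm]
  simp only [pow_zero, one_mul, linForm]
  congr 1
  have h1 : ((m : ℂ) * z + n) * starRingEnd ℂ ((m : ℂ) * z + n) =
      (m * z.re + n) ^ 2 + m ^ 2 * z.im ^ 2 := by
    rw [mul_conj, normSq_apply]; simp; ring
  rw [h1]
  field_simp
  ring

/-- Poisson summation in n only, using |w|² = (n + mx)² + m²y². The resulting exponent is unchanged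
when m ↔ n and t ↔ 1/t are exchanged together. -/
lemma tsum_thetaTerm_zero_eq {z : ℂ} (hz : 0 < z.im) {t : ℝ} (ht : 0 < t) :
    ∑' m : ℤ, ∑' n : ℤ, thetaTerm 0 0 0 (m, n) z t =
      (Real.sqrt (z.im / t) : ℂ) * ∑' m : ℤ, ∑' n : ℤ, cexp (-Real.pi * (t * z.im) * m ^ 2 +
        -Real.pi * (z.im / t) * n ^ 2 - 2 * Real.pi * Complex.I * (m * n * z.re)) := by
  have hyt : 0 < z.im / t := by positivity
  rw [← tsum_mul_left]
  refine tsum_congr fun m => ?_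
  -- With shift parameter b = -imx the square (n + ib)² becomes (n + mx)².
  have hP := Complex.tsum_exp_neg_quadratic (a := ((z.im / t : ℝ) : ℂ))
    (by simpa using hyt) (-Complex.I * (m * z.re))
  have hs : ((z.im / t : ℝ) : ℂ) ^ (1 / 2 : ℂ) = (Real.sqrt (z.im / t) : ℂ) := by
    rw [Real.sqrt_eq_rpow, ofReal_cpow hyt.le]; norm_num
  have hs0 : (Real.sqrt (z.im / t) : ℂ) ≠ 0 := by
    exact_mod_cast (Real.sqrt_pos.2 hyt).ne'
  rw [hs] at hP
  have e1 : ∀ n : ℤ, thetaTerm 0 0 0 (m, n) z t = cexp (-Real.pi * (t * z.im) * m ^ 2) *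
      cexp (-Real.pi / ((z.im / t : ℝ) : ℂ) * (n + Complex.I * (-Complex.I * (m * z.re))) ^ 2) := by
    intro n
    rw [thetaTerm_zero_eq m n z t hz]
    congr 2
    push_cast
    linear_combination
      (-(Real.pi / (z.im / t) * (2 * n * m * z.re + m ^ 2 * z.re ^ 2 * (1 - Complex.I ^ 2))) : ℂ) * I_sq
  simp_rw [e1]
  rw [tsum_mul_left, ← tsum_mul_left]
  have e2 : ∑' n : ℤ, cexp (-Real.pi / ((z.im / t : ℝ) : ℂ) * (n + Complex.I * (-Complex.I * (m * z.re))) ^ 2) =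
      Real.sqrt (z.im / t) * ∑' n : ℤ, cexp (-Real.pi * ((z.im / t : ℝ) : ℂ) * n ^ 2 +
        2 * Real.pi * (-Complex.I * (m * z.re)) * n) := by
    rw [hP]; field_simp
  rw [tsum_mul_left, e2, mul_left_comm, ← tsum_mul_left, ← tsum_mul_left, ← tsum_mul_left]
  refine tsum_congr fun n => ?_
  rw [← Complex.exp_add]
  congr 2
  push_cast
  ring

lemma summable_thetaTerm_prod (a : ℕ) {z : ℂ} (hz : 0 < z.im) {t : ℝ} (ht : 0 < t) :
    Summable fun p : ℤ × ℤ => thetaTerm 0 a 0 p z t := by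
  have := summable_thetaTerm 0 a 0 hz ht
  rw [← Finset.summable_compl_iff {(0 : ℤ × ℤ)}]
  refine (Equiv.subtypeEquivRight (p := fun p : ℤ × ℤ => p ∉ ({0} : Finset (ℤ × ℤ)))
    (q := fun p => p ≠ 0) (by simp)).summable_iff.2 this

/-- By the symmetry of the transformed sum it remains to exchange the order of summation and to
compare prefactors: √(yt) = t √(y/t). -/
lemma tsum_thetaTerm_prod_inv {z : ℂ} (hz : 0 < z.im) {t : ℝ} (ht : 0 < t) :
    ∑' p : ℤ × ℤ, thetaTerm 0 0 0 p z t⁻¹ = t * ∑' p : ℤ × ℤ, thetaTerm 0 0 0 p z t := by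
  have ht' : 0 < t⁻¹ := by positivity
  have htc : (t : ℂ) ≠ 0 := by exact_mod_cast ht.ne'
  rw [(summable_thetaTerm_prod 0 hz ht).tsum_prod, (summable_thetaTerm_prod 0 hz ht').tsum_prod,
    tsum_thetaTerm_zero_eq hz ht, tsum_thetaTerm_zero_eq hz ht']
  have hs : (Real.sqrt (z.im / t⁻¹) : ℂ) = t * Real.sqrt (z.im / t) := by
    have : z.im / t⁻¹ = t ^ 2 * (z.im / t) := by field_simp
    rw [this, Real.sqrt_mul (by positivity), Real.sqrt_sq ht.le]
    push_cast; rfl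
  rw [hs, mul_assoc]
  congr 2
  have hsum : Summable fun p : ℤ × ℤ => cexp (-Real.pi * (t * z.im) * p.1 ^ 2 +
      -Real.pi * (z.im / t) * p.2 ^ 2 - 2 * Real.pi * Complex.I * (p.1 * p.2 * z.re)) := by
    refine Summable.of_norm ?_
    refine ((summable_exp_neg_mul_int_sq (c := t * z.im) (by positivity)).mul_of_nonneg
      (summable_exp_neg_mul_int_sq (c := z.im / t) (by positivity)) (fun _ => by positivity)
      (fun _ => by positivity)).congr fun p => ?_
    rw [Complex.norm_exp, ← Real.exp_add]
    congr 1
    have : (-Real.pi * (t * z.im) * p.1 ^ 2 +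
      -Real.pi * (z.im / t) * p.2 ^ 2 - 2 * Real.pi * Complex.I * (p.1 * p.2 * z.re) : ℂ) =
      ((-Real.pi * (t * z.im) * p.1 ^ 2 + -Real.pi * (z.im / t) * p.2 ^ 2 : ℝ) : ℂ) +
        ((-(2 * Real.pi * (p.1 * p.2 * z.re)) : ℝ) : ℂ) * Complex.I := by push_cast; ring
    rw [this]
    simp only [add_re, ofReal_re, re_ofReal_mul, Complex.I_re, mul_zero, add_zero]
  rw [← Summable.tsum_comm (f := fun m n : ℤ => cexp (-Real.pi * (t * z.im) * m ^ 2 +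
      -Real.pi * (z.im / t) * n ^ 2 - 2 * Real.pi * Complex.I * (m * n * z.re))) hsum]
  refine tsum_congr fun m => tsum_congr fun n => ?_
  congr 1
  push_cast
  field_simp
  ring

lemma tsum_thetaTerm_prod_eq {z : ℂ} (hz : 0 < z.im) {t : ℝ} (ht : 0 < t) :
    ∑' p : ℤ × ℤ, thetaTerm 0 0 0 p z t =
      1 + ∑' p : {p : ℤ × ℤ // p ≠ 0}, thetaTerm 0 0 0 p z t := by
  rw [← (summable_thetaTerm_prod 0 hz ht).sum_add_tsum_subtype_compl {(0 : ℤ × ℤ)}]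
  congr 1
  · simp [thetaTerm, linForm]
  · exact (Equiv.subtypeEquivRight (p := fun p : ℤ × ℤ => p ∉ ({0} : Finset (ℤ × ℤ)))
      (q := fun p => p ≠ 0) (by simp)).tsum_eq (fun p => thetaTerm 0 0 0 p.1 z t)

/-- Applying ∂_z̄ to θ(1/t) = cθ(t) + d kills d and brings out 1/t on the left and t on the right,
so c becomes t²c. The first step removes the constant t - 1 contributed by the zero vector. -/
lemma tsum_thetaTerm_two_mul_inv (j : ℕ) {z : ℂ} (hz : 0 < z.im) {t : ℝ} (ht : 0 < t) :
    ∑' p : {p : ℤ × ℤ // p ≠ 0}, thetaTerm 0 (2 * j + 2) 0 p z t⁻¹ =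
      (t : ℂ) ^ (2 * j + 3) * ∑' p : {p : ℤ × ℤ // p ≠ 0}, thetaTerm 0 (2 * j + 2) 0 p z t := by
  have ht' : 0 < t⁻¹ := by positivity
  have htc : (t : ℂ) ≠ 0 := by exact_mod_cast ht.ne'
  have hstep (a : ℕ) (c d : ℂ) (h : ∀ w : ℂ, 0 < w.im →
      ∑' p : {p : ℤ × ℤ // p ≠ 0}, thetaTerm 0 a 0 p w t⁻¹ =
        c * (∑' p : {p : ℤ × ℤ // p ≠ 0}, thetaTerm 0 a 0 p w t) + d) (w : ℂ) (hw : 0 < w.im) :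
      ∑' p : {p : ℤ × ℤ // p ≠ 0}, thetaTerm 0 (a + 2) 0 p w t⁻¹ =
        (t : ℂ) ^ 2 * c * ∑' p : {p : ℤ × ℤ // p ≠ 0}, thetaTerm 0 (a + 2) 0 p w t := by
    have hy : (w.im : ℂ) ≠ 0 := by exact_mod_cast hw.ne'
    have h1 := hasWirtingerDerivAt_tsum_thetaTerm 0 a 0 hw ht'
    have h2 := ((hasWirtingerDerivAt_tsum_thetaTerm 0 a 0 hw ht).const_mul c).add (.const d)
    have h3 := h1.ext_bar (h2.congr_fun (by
      filter_upwards [isOpen_upper.mem_nhds hw] with v hv using h v hv))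
    have hpi : (Real.pi : ℂ) ≠ 0 := by exact_mod_cast Real.pi_ne_zero
    simp only [Nat.cast_zero, zero_mul, zero_add, add_zero] at h3
    push_cast at h3
    have hc : Complex.I / 2 * Real.pi * ((w.im : ℂ)⁻¹) ^ 2 ≠ 0 := by
      simp [hpi, hy]
    apply mul_left_cancel₀ hc
    have := congrArg (fun u : ℂ => (t : ℂ) * u) h3
    field_simp at this
    field_simp
    linear_combination this
  induction j generalizing z with
  | zero =>
    have h0 : ∀ w : ℂ, 0 < w.im → ∑' p : {p : ℤ × ℤ // p ≠ 0}, thetaTerm 0 0 0 p w t⁻¹ =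
        t * (∑' p : {p : ℤ × ℤ // p ≠ 0}, thetaTerm 0 0 0 p w t) + (t - 1) := by
      intro w hw
      have := tsum_thetaTerm_prod_inv hw ht
      rw [tsum_thetaTerm_prod_eq hw ht, tsum_thetaTerm_prod_eq hw ht'] at this
      linear_combination this
    have := hstep 0 _ _ h0 z hz
    simpa [← pow_succ] using this
  | succ j ih =>
    have := hstep (2 * j + 2) _ 0 (fun w hw => by rw [ih hw, add_zero]) z hz
    rw [show 2 * (j + 1) + 2 = 2 * j + 2 + 2 by ring, this, ← pow_add]
    ring_nf

/-- The theta series of `(m z + n) ^ a` satisfies `θ(1/t) = t ^ (a + 1) θ(t)` for even `a > 0`. -/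
theorem tsum_thetaTerm_inv {a : ℕ} (ha : Even a) (ha0 : a ≠ 0) {z : ℂ} (hz : 0 < z.im) {t : ℝ}
    (ht : 0 < t) :
    ∑' p : {p : ℤ × ℤ // p ≠ 0}, thetaTerm 0 a 0 p z t⁻¹ =
      (t : ℂ) ^ (a + 1) * ∑' p : {p : ℤ × ℤ // p ≠ 0}, thetaTerm 0 a 0 p z t := by
  obtain ⟨j, rfl⟩ : ∃ j, a = 2 * j + 2 := by
    obtain ⟨r, rfl⟩ := ha
    exact ⟨r - 1, by omega⟩
  exact tsum_thetaTerm_two_mul_inv j hz ht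

lemma conj_thetaTerm (i a b : ℕ) (p : ℤ × ℤ) (z : ℂ) (t : ℝ) :
    starRingEnd ℂ (thetaTerm i a b p z t) = thetaTerm i b a p z t := by
  simp only [thetaTerm, map_mul, map_pow, ← Complex.exp_conj, map_neg, map_inv₀, conj_ofReal,
    conj_conj, map_intCast]
  ring_nf

theorem tsum_thetaTerm_conj_inv {b : ℕ} (hb : Even b) (hb0 : b ≠ 0) {z : ℂ} (hz : 0 < z.im)
    {t : ℝ} (ht : 0 < t) :
    ∑' p : {p : ℤ × ℤ // p ≠ 0}, thetaTerm 0 0 b p z t⁻¹ =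
      (t : ℂ) ^ (b + 1) * ∑' p : {p : ℤ × ℤ // p ≠ 0}, thetaTerm 0 0 b p z t := by
  have h := congrArg (starRingEnd ℂ) (tsum_thetaTerm_inv hb hb0 hz ht)
  simpa only [map_mul, map_pow, conj_ofReal, Complex.conj_tsum, conj_thetaTerm] using h

/-! ### Tails of Mellin transforms of theta series -/

/-- Lebesgue measure on `(1, ∞)`. -/
def tailMeasure : Measure ℝ := volume.restrict (Set.Ioi 1)

instance : SFinite tailMeasure := by unfold tailMeasure; infer_instance

lemma ae_tailMeasure_one_lt : ∀ᵐ t ∂tailMeasure, 1 < t :=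
  ae_restrict_mem measurableSet_Ioi

lemma ae_tailMeasure_pos : ∀ᵐ t ∂tailMeasure, 0 < t :=
  ae_tailMeasure_one_lt.mono fun _ h => one_pos.trans h

/-- The function `t ^ s (log t) ^ n`. -/
def cpowMulLogPow (s : ℂ) (n : ℕ) (t : ℝ) : ℂ := (t : ℂ) ^ s * (Real.log t : ℂ) ^ n

lemma norm_cpowMulLogPow (s : ℂ) (n : ℕ) {t : ℝ} (ht : 1 < t) :
    ‖cpowMulLogPow s n t‖ = t ^ s.re * Real.log t ^ n := by
  rw [cpowMulLogPow, norm_mul, norm_cpow_eq_rpow_re_of_pos (one_pos.trans ht), norm_pow,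
    norm_real, Real.norm_of_nonneg (Real.log_pos ht).le]

lemma measurable_cpowMulLogPow (s : ℂ) (n : ℕ) : Measurable (cpowMulLogPow s n) := by
  unfold cpowMulLogPow
  fun_prop

lemma admissible_cpowMulLogPow (s : ℂ) (n : ℕ) : Admissible tailMeasure (cpowMulLogPow s n) := by
  refine ⟨(measurable_cpowMulLogPow s n).aestronglyMeasurable, ⌈s.re⌉₊ + n + 2, fun N hN => ?_⟩
  have hlt : s.re + n - N < -1 := by
    have h1 := Nat.le_ceil s.re
    have h2 : ((⌈s.re⌉₊ + n + 2 : ℕ) : ℝ) ≤ N := by exact_mod_cast hN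
    push_cast at h2
    linarith
  refine (integrableOn_Ioi_rpow_of_lt hlt one_pos).mono' ?_ ?_
  · exact ((measurable_cpowMulLogPow s n).norm.mul (by fun_prop)).aestronglyMeasurable
  · filter_upwards [ae_tailMeasure_one_lt] with t ht
    have ht0 : 0 < t := one_pos.trans ht
    have hlog := Real.log_pos ht
    rw [norm_cpowMulLogPow s n ht, Real.norm_of_nonneg (by positivity), Real.rpow_sub ht0,
      Real.rpow_add ht0, Real.rpow_natCast, Real.rpow_natCast, div_eq_mul_inv]
    gcongr
    exact (Real.log_le_sub_one_of_pos ht0).trans (by linarith)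

/-- `∫_1^∞ t ^ s (log t) ^ n ∑ m ^ i w ^ a w̄ ^ b exp (-π t |w|² / y) dt`, where `w = m z + n`. -/
def tailTheta (i a b n : ℕ) (s z : ℂ) : ℂ := thetaIntegral tailMeasure i a b (cpowMulLogPow s n) z

lemma thetaIntegral_congr_ae {ν : Measure ℝ} [SFinite ν] (i a b : ℕ) {h h' : ℝ → ℂ}
    (hh : h =ᵐ[ν] h') (z : ℂ) : thetaIntegral ν i a b h z = thetaIntegral ν i a b h' z := by
  refine integral_congr_ae ?_
  filter_upwards [Measure.quasiMeasurePreserving_fst.ae hh] with x hx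
  rw [hx]

lemma thetaIntegral_mul_cpowMulLogPow (i a b n : ℕ) (s z : ℂ) :
    thetaIntegral tailMeasure i a b (fun t => t * cpowMulLogPow s n t) z =
      tailTheta i a b n (s + 1) z := by
  refine thetaIntegral_congr_ae i a b ?_ z
  filter_upwards [ae_tailMeasure_pos] with t ht
  rw [cpowMulLogPow, cpowMulLogPow, cpow_add _ _ (by exact_mod_cast ht.ne'), cpow_one]
  ring

lemma hasWirtingerDerivAt_tailTheta (i a b n : ℕ) (s : ℂ) {z : ℂ} (hz : 0 < z.im) :
    HasWirtingerDerivAt (tailTheta i a b n s)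
      (a * tailTheta (i + 1) (a - 1) b n s z -
        Complex.I / 2 * Real.pi * ((z.im : ℂ)⁻¹) ^ 2 * tailTheta i a (b + 2) n (s + 1) z)
      (b * tailTheta (i + 1) a (b - 1) n s z +
        Complex.I / 2 * Real.pi * ((z.im : ℂ)⁻¹) ^ 2 * tailTheta i (a + 2) b n (s + 1) z) z := by
  simp only [← thetaIntegral_mul_cpowMulLogPow]
  exact hasWirtingerDerivAt_thetaIntegral ae_tailMeasure_pos (admissible_cpowMulLogPow s n) i a b hz

lemma contDiffOn_tailTheta (i a b n : ℕ) (s : ℂ) :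
    ContDiffOn ℝ ∞ (tailTheta i a b n s) {z : ℂ | 0 < z.im} :=
  contDiffOn_thetaIntegral ae_tailMeasure_pos (admissible_cpowMulLogPow s n) i a b

lemma conj_tailTheta (i a b n : ℕ) (s z : ℂ) :
    starRingEnd ℂ (tailTheta i a b n s z) = tailTheta i b a n (starRingEnd ℂ s) z := by
  rw [tailTheta, thetaIntegral, ← integral_conj]
  refine integral_congr_ae ?_
  filter_upwards [ae_prod_count_pos ae_tailMeasure_pos] with x hx
  have hc : starRingEnd ℂ ((x.1 : ℂ) ^ s) = (x.1 : ℂ) ^ starRingEnd ℂ s := by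
    rw [cpow_conj _ _ (by rw [arg_ofReal_of_nonneg hx.le]; exact Real.pi_pos.ne), conj_ofReal]
  rw [map_mul, conj_thetaTerm, cpowMulLogPow, cpowMulLogPow, map_mul, map_pow, conj_ofReal, hc]

lemma exists_norm_tailTheta_le (i a b n : ℕ) (s : ℂ) (A : ℝ) {B : ℝ} (hB : 0 < B) :
    ∃ (N : ℕ) (C : ℝ), ∀ z : ℂ, |z.re| ≤ A → B ≤ z.im → ‖tailTheta i a b n s z‖ ≤ C * z.im ^ N := by
  obtain ⟨N, g, hg, hb⟩ := exists_dominating ae_tailMeasure_pos (admissible_cpowMulLogPow s n)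
    i a b A hB
  refine ⟨N, ∫ x, g x ∂(tailMeasure.prod Measure.count), fun z hA hz => ?_⟩
  rw [mul_comm, ← integral_const_mul]
  refine norm_integral_le_of_norm_le (hg.const_mul _) ?_
  filter_upwards [hb] with x hx using hx.2 z hA hz

/-- Differentiating t^s brings down log t, which is why the family carries a log power. For t > 1
and |w - s| < 1, t^(Re w) is at most t^(Re s + 1), which dominates. -/
lemma hasDerivAt_tailTheta (i a b n : ℕ) (s : ℂ) {z : ℂ} (hz : 0 < z.im) :
    HasDerivAt (fun s => tailTheta i a b n s z) (tailTheta i a b (n + 1) s z) s := by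
  have hm (n : ℕ) (w : ℂ) := aestronglyMeasurable_mul_thetaTerm (ν := tailMeasure)
    (measurable_cpowMulLogPow w n).aestronglyMeasurable i a b z
  refine (hasDerivAt_integral_of_dominated_loc_of_deriv_le
    (F := fun w (x : ℝ × {p : ℤ × ℤ // p ≠ 0}) =>
      cpowMulLogPow w n x.1 * thetaTerm i a b x.2 z x.1)
    (F' := fun w x => cpowMulLogPow w (n + 1) x.1 * thetaTerm i a b x.2 z x.1)
    (bound := fun x => ‖cpowMulLogPow (s.re + 1 : ℝ) (n + 1) x.1 * thetaTerm i a b x.2 z x.1‖)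
    (Metric.ball_mem_nhds s one_pos) (.of_forall fun w => hm n w)
    (integrable_mul_thetaTerm ae_tailMeasure_pos (admissible_cpowMulLogPow s n) i a b hz)
    (hm (n + 1) s) ?_
    (integrable_mul_thetaTerm ae_tailMeasure_pos (admissible_cpowMulLogPow _ _) i a b hz).norm
    ?_).2
  · filter_upwards [Measure.quasiMeasurePreserving_fst.ae ae_tailMeasure_one_lt] with x hx w hw
    have hlog := (Real.log_pos hx).le
    rw [norm_mul, norm_mul, norm_cpowMulLogPow _ _ hx, norm_cpowMulLogPow _ _ hx, ofReal_re]
    gcongr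
    · exact hx.le
    · have h1 : |(w - s).re| ≤ ‖w - s‖ := abs_re_le_norm _
      have h2 : ‖w - s‖ < 1 := by simpa [dist_eq_norm] using hw
      rw [sub_re] at h1
      linarith [le_abs_self (w.re - s.re)]
  · filter_upwards [ae_prod_count_pos ae_tailMeasure_pos] with x hx w hw
    refine HasDerivAt.mul_const ?_ _
    unfold cpowMulLogPow
    have hx' : (x.1 : ℂ) ≠ 0 := by exact_mod_cast hx.ne'
    refine (((hasDerivAt_id w).const_cpow (Or.inl hx')).mul_const _).congr_deriv ?_
    rw [ofReal_log hx.le, id]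
    ring

lemma differentiable_tailTheta (i a b n : ℕ) {z : ℂ} (hz : 0 < z.im) :
    Differentiable ℂ fun s => tailTheta i a b n s z :=
  fun s => (hasDerivAt_tailTheta i a b n s hz).differentiableAt

lemma iteratedDeriv_tailTheta (i a b n : ℕ) {z : ℂ} (hz : 0 < z.im) :
    iteratedDeriv n (fun s => tailTheta i a b 0 s z) = fun s => tailTheta i a b n s z := by
  induction n with
  | zero => simp
  | succ n ih =>
    rw [iteratedDeriv_succ, ih]
    ext s
    exact (hasDerivAt_tailTheta i a b n s hz).deriv

/-! ### Analytic continuation by the Mellin transform -/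

/-- Riemann's argument: the part over (0, 1) is mapped to (1, ∞) by t ↦ 1/t. There are no polar
terms because the inversion formula is exact. -/
lemma mellin_eq_add_of_inv_eq {F : ℝ → ℂ} {a : ℕ}
    (hF : ∀ t : ℝ, 0 < t → F t⁻¹ = (t : ℂ) ^ (a + 1) * F t)
    (hF_int : ∀ s : ℂ, IntegrableOn (fun t : ℝ => (t : ℂ) ^ s * F t) (Set.Ioi 1)) (s : ℂ) :
    mellin F s = (∫ t in Set.Ioi (1 : ℝ), (t : ℂ) ^ (s - 1) * F t) +
      ∫ t in Set.Ioi (1 : ℝ), (t : ℂ) ^ (a - s) * F t := by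
  set f : ℝ → ℂ := (Set.Ioi 1).indicator F with hf
  have hsub : Set.Ioi (1 : ℝ) ⊆ Set.Ioi 0 := Set.Ioi_subset_Ioi zero_le_one
  have hind (s : ℂ) : (fun t : ℝ => (t : ℂ) ^ (s - 1) • f t) =
      (Set.Ioi 1).indicator fun t : ℝ => (t : ℂ) ^ (s - 1) * F t := by
    ext t
    by_cases ht : t ∈ Set.Ioi (1 : ℝ) <;> simp [f, ht]
  have hfc (s : ℂ) : MellinConvergent f s := by
    rw [MellinConvergent, hind, integrableOn_indicator_iff measurableSet_Ioi,
      Set.inter_eq_left.2 hsub]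
    exact hF_int _
  have hfm (s : ℂ) : mellin f s = ∫ t in Set.Ioi (1 : ℝ), (t : ℂ) ^ (s - 1) * F t := by
    rw [mellin, hind, setIntegral_indicator measurableSet_Ioi, Set.inter_eq_right.2 hsub]
  set g : ℝ → ℂ := fun t => (t : ℂ) ^ (-(a + 1 : ℂ)) • f t⁻¹ with hg
  have hgc : MellinConvergent g s := by
    rw [hg, MellinConvergent.cpow_smul]
    have := (MellinConvergent.comp_rpow (f := f) (s := s + -(a + 1 : ℂ)) (a := -1) (by norm_num)).2
      (hfc _)
    simpa only [Real.rpow_neg_one] using this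
  have hgm : mellin g s = ∫ t in Set.Ioi (1 : ℝ), (t : ℂ) ^ (a - s) * F t := by
    rw [hg, mellin_cpow_smul, mellin_comp_inv, hfm]
    congr 1
    ext t
    ring_nf
  rw [← hgm, ← hfm, ← (hasMellin_add (hfc s) hgc).2]
  refine setIntegral_congr_ae measurableSet_Ioi ?_
  -- At t = 1 both indicators vanish, so the decomposition only holds almost everywhere.
  have h1 : ∀ᵐ t : ℝ, t ≠ 1 := by simp [ae_iff]
  filter_upwards [h1] with t ht1 ht0
  congr 1
  have ht0' : (0 : ℝ) < t := ht0
  have htc : (t : ℂ) ≠ 0 := by exact_mod_cast ht0'.ne'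
  rcases lt_or_gt_of_ne ht1 with h | h
  · have hn : ¬ (1 < t) := by linarith
    have hn' : 1 < t⁻¹ := (one_lt_inv₀ ht0').2 h
    simp only [f, g, Set.indicator, Set.mem_Ioi, hn, hn', if_true, if_false, zero_add, smul_eq_mul]
    rw [hF t ht0', cpow_neg, ← mul_assoc]
    have : (t : ℂ) ^ (a + 1 : ℂ) = (t : ℂ) ^ (a + 1) := by
      rw [← cpow_natCast]; push_cast; rfl
    rw [this, inv_mul_cancel₀ (pow_ne_zero _ htc), one_mul]
  · have hn' : ¬ (1 < t⁻¹) := by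
      rw [not_lt]; exact (inv_lt_one_of_one_lt₀ h).le
    simp [f, g, h, hn']

lemma tailTheta_zero_eq (i a b : ℕ) (s : ℂ) {z : ℂ} (hz : 0 < z.im) :
    tailTheta i a b 0 s z = ∫ t in Set.Ioi (1 : ℝ), (t : ℂ) ^ s *
      ∑' p : {p : ℤ × ℤ // p ≠ 0}, thetaTerm i a b p z t := by
  rw [tailTheta, thetaIntegral_eq_integral_tsum ae_tailMeasure_pos (admissible_cpowMulLogPow s 0)
    i a b hz]
  simp [cpowMulLogPow, tailMeasure]

lemma integrableOn_cpow_mul_tsum_thetaTerm (i a b : ℕ) (s : ℂ) {z : ℂ} (hz : 0 < z.im) :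
    IntegrableOn (fun t : ℝ => (t : ℂ) ^ s *
      ∑' p : {p : ℤ × ℤ // p ≠ 0}, thetaTerm i a b p z t) (Set.Ioi 1) := by
  have hi := integrable_mul_thetaTerm ae_tailMeasure_pos (admissible_cpowMulLogPow s 0) i a b hz
  have h2 := hi.integral_prod_left
  refine Integrable.congr h2 ?_
  filter_upwards [hi.prod_right_ae] with t ht
  rw [integral_countable ht, ← tsum_mul_left]
  simp [cpowMulLogPow]

lemma norm_linForm_pos {z : ℂ} (hz : 0 < z.im) {p : ℤ × ℤ} (hp : p ≠ 0) : 0 < ‖linForm p z‖ := by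
  obtain ⟨r, hr, h⟩ := exists_mul_norm_le_norm_linForm |z.re| hz
  have := one_le_norm_of_ne_zero hp
  exact lt_of_lt_of_le (by positivity) (h z le_rfl le_rfl p hp)

/-- Termwise integration gives Γ(s). Absolute convergence needs |w|^(a+b-2 Re s) summable over the
lattice, that is 2 Re s - (a + b) > 2. -/
lemma hasSum_mellin_theta (a b : ℕ) {z : ℂ} (hz : 0 < z.im) {s : ℂ}
    (hs : 1 + ((a + b : ℕ) : ℝ) / 2 < s.re) :
    HasSum (fun p : {p : ℤ × ℤ // p ≠ 0} => (Real.pi : ℂ) ^ (-s) * Gamma s *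
        (linForm p z ^ a * starRingEnd ℂ (linForm p z) ^ b) /
          ((‖linForm p z‖ ^ 2 / z.im : ℝ) : ℂ) ^ s)
      (mellin (fun t => ∑' p : {p : ℤ × ℤ // p ≠ 0}, thetaTerm 0 a b p z t) s) := by
  have hs0 : 0 < s.re := lt_trans (by positivity) hs
  refine hasSum_mellin_pi_mul (fun p => Or.inr ?_) hs0 (fun t ht => ?_) ?_
  · have := norm_linForm_pos hz p.2
    positivity
  · convert! (summable_thetaTerm 0 a b hz ht).hasSum using 2 with p
    simp only [thetaTerm, pow_zero, one_mul, ofReal_exp]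
    congr 2
    rw [mul_conj, normSq_eq_norm_sq]
    push_cast
    ring
  · obtain ⟨r, hr, h⟩ := exists_mul_norm_le_norm_linForm |z.re| hz
    set d : ℝ := 2 * s.re - ((a + b : ℕ) : ℝ) with hd
    have hd2 : 2 < d := by rw [hd]; linarith
    refine Summable.of_nonneg_of_le (fun p => by positivity) (fun p => ?_)
      ((summable_norm_prod_int_rpow hd2).mul_left (z.im ^ s.re * r ^ (-d)))
    have hw := norm_linForm_pos hz p.2
    have hp := one_le_norm_of_ne_zero p.2
    have hp0 : 0 < ‖p.1‖ := by positivity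
    have hle := h z le_rfl le_rfl p.1 p.2
    calc ‖linForm p z ^ a * starRingEnd ℂ (linForm p z) ^ b‖ / (‖linForm p z‖ ^ 2 / z.im) ^ s.re
        = z.im ^ s.re * ‖linForm p z‖ ^ (-d) := by
          rw [norm_mul, norm_pow, norm_pow, RCLike.norm_conj, ← pow_add,
            Real.div_rpow (by positivity) hz.le, ← Real.rpow_natCast _ 2,
            ← Real.rpow_mul hw.le, ← Real.rpow_natCast, hd, neg_sub, Real.rpow_sub hw]
          push_cast
          field_simp
      _ ≤ z.im ^ s.re * (r * ‖p.1‖) ^ (-d) := by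
          gcongr ?_ * ?_
          exact Real.rpow_le_rpow_of_nonpos (by positivity) hle (by linarith)
      _ = z.im ^ s.re * r ^ (-d) * ‖p.1‖ ^ (-d) := by
          rw [Real.mul_rpow hr.le hp0.le]; ring

/-- The completed Eisenstein series of weight `-a`, for even `a > 0`, as an entire function. -/
def completedNeg (a : ℕ) (z s : ℂ) : ℂ :=
  (Real.pi : ℂ) ^ (a / 2) / 2 * (tailTheta 0 a 0 0 (s - 1) z + tailTheta 0 a 0 0 (a - s) z)

/-- The completed Eisenstein series of weight `b`, for even `b > 0`, as an entire function. -/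
def completedPos (b : ℕ) (z s : ℂ) : ℂ :=
  (Real.pi : ℂ) ^ (b / 2) / 2 * ((z.im : ℂ)⁻¹) ^ b *
    (tailTheta 0 0 b 0 (s + b - 1) z + tailTheta 0 0 b 0 (-s) z)

lemma differentiable_completedNeg (a : ℕ) {z : ℂ} (hz : 0 < z.im) :
    Differentiable ℂ (completedNeg a z) := by
  unfold completedNeg
  have h := differentiable_tailTheta 0 a 0 0 hz
  exact ((h.comp (differentiable_id.sub_const 1)).add
    (h.comp (differentiable_id.const_sub (a : ℂ)))).const_mul _

lemma differentiable_completedPos (b : ℕ) {z : ℂ} (hz : 0 < z.im) :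
    Differentiable ℂ (completedPos b z) := by
  unfold completedPos
  have h := differentiable_tailTheta 0 0 b 0 hz
  exact ((h.comp ((differentiable_id.add_const (b : ℂ)).sub_const 1)).add
    (h.comp differentiable_id.neg)).const_mul _

lemma cpow_norm_sq_div {w y : ℝ} (hw : 0 < w) (hy : 0 < y) (s : ℂ) :
    ((w ^ 2 / y : ℝ) : ℂ) ^ s = (w : ℂ) ^ (2 * s) / (y : ℂ) ^ s := by
  rw [div_eq_mul_inv, ofReal_mul, mul_cpow_ofReal_nonneg (by positivity) (by positivity),
    ofReal_inv, inv_cpow _ _ (by rw [arg_ofReal_of_nonneg hy.le]; exact Real.pi_pos.ne)]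
  congr 1
  rw [pow_two, ofReal_mul, mul_cpow_ofReal_nonneg hw.le hw.le, two_mul,
    cpow_add _ _ (by exact_mod_cast hw.ne')]

lemma completedNeg_eq {a : ℕ} (ha : Even a) (ha0 : a ≠ 0) (z : ℍ) {s : ℂ}
    (hs : 1 + (a : ℝ) / 2 < s.re) :
    completedNeg a z s = (Real.pi : ℂ) ^ (-(s - a / 2)) * Gamma s *
      eisensteinSeries (-(a : ℤ)) z s := by
  have hz : 0 < (z : ℂ).im := z.2
  have h1 := hasSum_mellin_theta a 0 hz (s := s) (by simpa using hs)
  rw [mellin_eq_add_of_inv_eq (a := a) (fun t ht => tsum_thetaTerm_inv ha ha0 hz ht)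
    (fun s => integrableOn_cpow_mul_tsum_thetaTerm 0 a 0 s hz),
    ← tailTheta_zero_eq 0 a 0 _ hz, ← tailTheta_zero_eq 0 a 0 _ hz] at h1
  rw [completedNeg, ← h1.tsum_eq, eisensteinSeries]
  have hpi : (Real.pi : ℂ) ≠ 0 := by exact_mod_cast Real.pi_ne_zero
  -- The exponent `a / 2` on the right is natural-number division, exact since a is even.
  have hpow : (Real.pi : ℂ) ^ (-(s - a / 2)) = Real.pi ^ (-s) * Real.pi ^ (a / 2) := by
    obtain ⟨r, rfl⟩ := ha
    rw [neg_sub, sub_eq_neg_add, cpow_add _ _ hpi]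
    congr 1
    rw [← cpow_natCast, show (r + r) / 2 = r by omega]
    push_cast
    ring_nf
  have hterm (p : {p : ℤ × ℤ // p ≠ 0}) : (Real.pi : ℂ) ^ (-s) * Gamma s *
        (linForm p z ^ a * starRingEnd ℂ (linForm p z) ^ 0) /
          ((‖linForm p z‖ ^ 2 / (z : ℂ).im : ℝ) : ℂ) ^ s =
      (Real.pi : ℂ) ^ (-s) * Gamma s * ((z.im : ℂ) ^ s /
      (((‖(p.1.1 : ℂ) * (z : ℂ) + (p.1.2 : ℂ)‖ : ℝ) : ℂ) ^ (2 * s) *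
        ((p.1.1 : ℂ) * (z : ℂ) + (p.1.2 : ℂ)) ^ (-(a : ℤ)))) := by
    have hw := norm_linForm_pos hz p.2
    rw [cpow_norm_sq_div hw hz]
    change _ = _ * (_ / (((‖linForm p z‖ : ℝ) : ℂ) ^ (2 * s) * linForm p z ^ (-(a : ℤ))))
    have hy : ((z : ℂ).im : ℂ) = (z.im : ℂ) := rfl
    rw [hy, zpow_neg, zpow_natCast]
    have h2 : (z.im : ℂ) ^ s ≠ 0 := by
      rw [cpow_ne_zero_iff_of_exponent_ne_zero]
      · exact_mod_cast z.im_ne_zero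
      · rintro rfl
        simp at hs
        have : (0 : ℝ) ≤ a := by positivity
        linarith
    field_simp
  rw [tsum_congr hterm, tsum_mul_left, hpow]
  ring

/-- Since 1/w^b = w̄^b / |w|^(2b), the Mellin variable is s + b; the factor y^(-b) restores y^s from
y^(s+b). -/
lemma completedPos_eq {b : ℕ} (hb : Even b) (hb0 : b ≠ 0) (z : ℍ) {s : ℂ}
    (hs : 1 - (b : ℝ) / 2 < s.re) :
    completedPos b z s = (Real.pi : ℂ) ^ (-(s + b / 2)) * Gamma (s + b) *
      eisensteinSeries (b : ℤ) z s := by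
  have hz : 0 < (z : ℂ).im := z.2
  have h1 := hasSum_mellin_theta 0 b hz (s := s + b) (by simp; linarith)
  rw [mellin_eq_add_of_inv_eq (a := b) (fun t ht => tsum_thetaTerm_conj_inv hb hb0 hz ht)
    (fun s => integrableOn_cpow_mul_tsum_thetaTerm 0 0 b s hz),
    ← tailTheta_zero_eq 0 0 b _ hz, ← tailTheta_zero_eq 0 0 b _ hz,
    show (b : ℂ) - (s + b) = -s by ring] at h1
  rw [completedPos, ← h1.tsum_eq, eisensteinSeries]
  have hpi : (Real.pi : ℂ) ≠ 0 := by exact_mod_cast Real.pi_ne_zero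
  have hpow : (Real.pi : ℂ) ^ (-(s + b / 2)) = Real.pi ^ (-(s + b)) * Real.pi ^ (b / 2) := by
    obtain ⟨r, rfl⟩ := hb
    rw [← cpow_natCast _ ((r + r) / 2), ← cpow_add _ _ hpi, show (r + r) / 2 = r by omega]
    congr 1
    push_cast
    ring
  have hterm (p : {p : ℤ × ℤ // p ≠ 0}) : (Real.pi : ℂ) ^ (-(s + b)) * Gamma (s + b) *
        (linForm p z ^ 0 * starRingEnd ℂ (linForm p z) ^ b) /
          ((‖linForm p z‖ ^ 2 / (z : ℂ).im : ℝ) : ℂ) ^ (s + b) =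
      (Real.pi : ℂ) ^ (-(s + b)) * Gamma (s + b) * (z.im : ℂ) ^ b * ((z.im : ℂ) ^ s /
      (((‖(p.1.1 : ℂ) * (z : ℂ) + (p.1.2 : ℂ)‖ : ℝ) : ℂ) ^ (2 * s) *
        ((p.1.1 : ℂ) * (z : ℂ) + (p.1.2 : ℂ)) ^ (b : ℤ))) := by
    have hw := norm_linForm_pos hz p.2
    have hw' : ((‖linForm p z‖ : ℝ) : ℂ) ≠ 0 := by exact_mod_cast hw.ne'
    have hl0 : linForm p z ≠ 0 := norm_pos_iff.1 hw
    have hz0 : (z.im : ℂ) ≠ 0 := by exact_mod_cast z.im_ne_zero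
    rw [cpow_norm_sq_div hw hz]
    change _ = _ * (_ / (((‖linForm p z‖ : ℝ) : ℂ) ^ (2 * s) * linForm p z ^ (b : ℤ)))
    have hy : ((z : ℂ).im : ℂ) = (z.im : ℂ) := rfl
    rw [hy, zpow_natCast, mul_add, cpow_add _ _ hw', cpow_add _ _ hz0, cpow_natCast]
    have h3 : ((‖linForm p z‖ : ℝ) : ℂ) ^ (2 * (b : ℂ)) =
        linForm p z ^ b * starRingEnd ℂ (linForm p z) ^ b := by
      rw [← mul_pow, mul_conj, normSq_eq_norm_sq, ofReal_pow, ← pow_mul, ← cpow_natCast]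
      push_cast; rfl
    have hc0 : starRingEnd ℂ (linForm p z) ≠ 0 := by simpa using hl0
    have h2 : (z.im : ℂ) ^ s ≠ 0 := by
      rw [cpow_def_of_ne_zero hz0]; exact exp_ne_zero _
    have h4 : ((‖linForm p z‖ : ℝ) : ℂ) ^ (2 * s) ≠ 0 := by
      rw [cpow_def_of_ne_zero hw']; exact exp_ne_zero _
    rw [h3]
    field_simp
  have hz0 : (z.im : ℂ) ≠ 0 := by exact_mod_cast z.im_ne_zero
  rw [tsum_congr hterm, tsum_mul_left, hpow]
  have hy : ((z : ℂ).im : ℂ) = (z.im : ℂ) := rfl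
  have hinv : ((z.im : ℂ)⁻¹) ^ b * (z.im : ℂ) ^ b = 1 := by
    rw [← mul_pow, inv_mul_cancel₀ hz0, one_pow]
  rw [hy]
  linear_combination ((Real.pi : ℂ) ^ (b / 2) / 2 * (Real.pi ^ (-(s + b)) * Gamma (s + b) *
    ∑' p : {p : ℤ × ℤ // p ≠ 0}, (z.im : ℂ) ^ s /
      (((‖(p.1.1 : ℂ) * (z : ℂ) + (p.1.2 : ℂ)‖ : ℝ) : ℂ) ^ (2 * s) *
        ((p.1.1 : ℂ) * (z : ℂ) + (p.1.2 : ℂ)) ^ (b : ℤ)))) * hinv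

/-! ### Existence and uniqueness of the entire continuation -/

lemma IsEntireContinuation.eq {k : ℤ} {z : ℍ} {f g : ℂ → ℂ} (hf : IsEntireContinuation k z f)
    (hg : IsEntireContinuation k z g) : f = g := by
  set c : ℂ := ((1 - (k : ℝ) / 2 + 1 : ℝ) : ℂ) with hc
  refine AnalyticOnNhd.eq_of_eventuallyEq (z₀ := c)
    (fun s _ => hf.1.analyticAt s) (fun s _ => hg.1.analyticAt s) ?_
  have hopen : IsOpen {s : ℂ | 1 - (k : ℝ) / 2 < s.re} :=
    isOpen_lt continuous_const Complex.continuous_re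
  filter_upwards [hopen.mem_nhds (show c ∈ _ by simp [hc])] with s hs
  rw [hf.2 s hs, hg.2 s hs]

lemma doublyCompleted_eq {k : ℤ} {z : ℍ} {f : ℂ → ℂ} (hf : IsEntireContinuation k z f) :
    doublyCompleted k z = f := by
  have h : ∃ f : ℂ → ℂ, IsEntireContinuation k z f := ⟨f, hf⟩
  rw [doublyCompleted, dif_pos h]
  exact h.choose_spec.eq hf

lemma isEntireContinuation_neg {a : ℕ} (ha : Even a) (ha0 : a ≠ 0) (z : ℍ) :
    IsEntireContinuation (-(a : ℤ)) z fun s =>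
      (s - a / 2) * (s - a / 2 - 1) * completedNeg a z s := by
  refine ⟨?_, fun s hs => ?_⟩
  · have := differentiable_completedNeg a (z := z) z.2
    fun_prop
  · beta_reduce
    rw [completedNeg_eq ha ha0 z (s := s) (by push_cast at hs; linarith), doublyCompletedSeries, abs_neg,
      Nat.abs_cast]
    push_cast
    ring_nf

lemma isEntireContinuation_pos {b : ℕ} (hb : Even b) (hb0 : b ≠ 0) (z : ℍ) :
    IsEntireContinuation (b : ℤ) z fun s =>
      (s + b / 2) * (s + b / 2 - 1) * completedPos b z s := by
  refine ⟨?_, fun s hs => ?_⟩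
  · have := differentiable_completedPos b (z := z) z.2
    fun_prop
  · beta_reduce
    rw [completedPos_eq hb hb0 z (s := s) (by push_cast at hs; linarith), doublyCompletedSeries,
      Nat.abs_cast]
    push_cast
    ring_nf

/-! ### Taylor coefficients -/

/-- The `n`-th Taylor coefficient of `f` at `0`. -/
def taylorAt (f : ℂ → ℂ) (n : ℕ) : ℂ := iteratedDeriv n f 0 / n.factorial

lemma taylorCoeff_eq_taylorAt (k : ℤ) (n : ℕ) (z : ℍ) :
    taylorCoeff k n z = taylorAt (doublyCompleted k z) n := rfl

section taylorAt

variable {f g : ℂ → ℂ}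

lemma taylorAt_add (hf : Differentiable ℂ f) (hg : Differentiable ℂ g) (n : ℕ) :
    taylorAt (fun s => f s + g s) n = taylorAt f n + taylorAt g n := by
  rw [taylorAt, iteratedDeriv_fun_add hf.contDiff.contDiffAt hg.contDiff.contDiffAt, add_div]
  rfl

lemma taylorAt_const_mul (c : ℂ) (f : ℂ → ℂ) (n : ℕ) :
    taylorAt (fun s => c * f s) n = c * taylorAt f n := by
  rw [taylorAt, iteratedDeriv_const_mul_field, mul_div_assoc]
  rfl

lemma taylorAt_comp_neg (f : ℂ → ℂ) (n : ℕ) :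
    taylorAt (fun s => f (-s)) n = (-1) ^ n * taylorAt f n := by
  rw [taylorAt, iteratedDeriv_comp_neg, neg_zero, smul_eq_mul, mul_div_assoc]
  rfl

lemma taylorAt_id_mul_zero (f : ℂ → ℂ) : taylorAt (fun s => s * f s) 0 = 0 := by
  simp [taylorAt]

lemma taylorAt_id_mul_succ (hf : Differentiable ℂ f) (n : ℕ) :
    taylorAt (fun s => s * f s) (n + 1) = taylorAt f n := by
  have h : ∀ n : ℕ, iteratedDeriv (n + 1) (fun s => s * f s) =
      fun s => s * iteratedDeriv (n + 1) f s + (n + 1) * iteratedDeriv n f s := by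
    have hd (n : ℕ) (s : ℂ) : HasDerivAt (iteratedDeriv n f) (iteratedDeriv (n + 1) f s) s := by
      rw [iteratedDeriv_succ]
      exact ((hf.contDiff (n := (n + 1 : ℕ))).differentiable_iteratedDeriv n
        (by norm_cast; omega) s).hasDerivAt
    intro n
    induction n with
    | zero =>
      ext s
      rw [iteratedDeriv_one]
      have := (hasDerivAt_id s).mul (hd 0 s)
      simp only [iteratedDeriv_zero] at this
      rw [show (fun s => s * f s) = id * f from rfl, this.deriv]
      simp; ring
    | succ n ih =>
      rw [iteratedDeriv_succ, ih]
      ext s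
      have := ((hasDerivAt_id s).mul (hd (n + 1) s)).add ((hd n s).const_mul ((n : ℂ) + 1))
      refine this.deriv.trans ?_
      push_cast
      simp
      ring
  rw [taylorAt, taylorAt, h n, Nat.factorial_succ]
  have : ((n : ℂ) + 1) ≠ 0 := by exact_mod_cast Nat.succ_ne_zero n
  have h2 : (n.factorial : ℂ) ≠ 0 := by exact_mod_cast n.factorial_ne_zero
  push_cast
  field_simp
  ring

/-- `c n` shifted by one, with value `0` at `0`. -/
def shift (c : ℕ → ℂ) : ℕ → ℂ
  | 0 => 0
  | n + 1 => c n

lemma taylorAt_id_mul (hf : Differentiable ℂ f) (n : ℕ) :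
    taylorAt (fun s => s * f s) n = shift (taylorAt f) n := by
  cases n with
  | zero => exact taylorAt_id_mul_zero f
  | succ n => exact taylorAt_id_mul_succ hf n

/-- Multiplying by a polynomial in s acts on Taylor coefficients by shifts. It serves for the
completing factors and for the eigenvalue s(s + a + 1). -/
lemma taylorAt_quadratic_mul (hf : Differentiable ℂ f) (c₀ c₁ : ℂ) (n : ℕ) :
    taylorAt (fun s => (c₀ + c₁ * s + s * s) * f s) n =
      c₀ * taylorAt f n + c₁ * shift (taylorAt f) n + shift (shift (taylorAt f)) n := by
  have h1 : Differentiable ℂ fun s => s * f s := differentiable_id.mul hf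
  have e : (fun s => (c₀ + c₁ * s + s * s) * f s) = fun s =>
      (c₀ * f s + c₁ * (s * f s)) + s * (s * f s) := by ext s; ring
  rw [e, taylorAt_add (f := fun s => c₀ * f s + c₁ * (s * f s)) (g := fun s => s * (s * f s))
      (by fun_prop) (by fun_prop), taylorAt_add (by fun_prop) (by fun_prop), taylorAt_const_mul, taylorAt_const_mul,
    taylorAt_id_mul hf, taylorAt_id_mul h1, show taylorAt (fun s => s * f s) = shift (taylorAt f)
      from funext (taylorAt_id_mul hf)]

end taylorAt

lemma taylorAt_tailTheta_add (i a b n : ℕ) (c : ℂ) {z : ℂ} (hz : 0 < z.im) :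
    taylorAt (fun s => tailTheta i a b 0 (s + c) z) n = tailTheta i a b n c z / n.factorial := by
  rw [taylorAt, iteratedDeriv_comp_add_const n (fun s => tailTheta i a b 0 s z) c,
    iteratedDeriv_tailTheta i a b n hz]
  simp only [zero_add]

lemma taylorAt_tailTheta_sub (i a b n : ℕ) (c : ℂ) {z : ℂ} (hz : 0 < z.im) :
    taylorAt (fun s => tailTheta i a b 0 (c - s) z) n =
      (-1) ^ n * (tailTheta i a b n c z / n.factorial) := by
  rw [← taylorAt_tailTheta_add i a b n c hz, ← taylorAt_comp_neg]
  congr 1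
  ext s
  ring_nf

/-! ### Integration by parts in the Mellin variable -/

lemma thetaTerm_succ_succ (i a b : ℕ) (p : ℤ × ℤ) (z : ℂ) (t : ℝ) :
    thetaTerm i (a + 1) (b + 1) p z t =
      linForm p z * starRingEnd ℂ (linForm p z) * thetaTerm i a b p z t := by
  simp only [thetaTerm]
  ring

lemma hasDerivAt_thetaTerm (i a b : ℕ) (p : ℤ × ℤ) (z : ℂ) (t : ℝ) :
    HasDerivAt (fun t : ℝ => thetaTerm i a b p z t)
      (-(Real.pi * (z.im : ℂ)⁻¹) * thetaTerm i (a + 1) (b + 1) p z t) t := by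
  rw [thetaTerm_succ_succ]
  unfold thetaTerm
  have h1 : HasDerivAt (fun t : ℝ => (-(Real.pi * t) : ℂ) *
      (linForm p z * starRingEnd ℂ (linForm p z) * (z.im : ℂ)⁻¹))
      ((-(Real.pi * ((1 : ℝ) : ℂ)) : ℂ) * (linForm p z * starRingEnd ℂ (linForm p z) * (z.im : ℂ)⁻¹)) t :=
    ((((hasDerivAt_id t).ofReal_comp).const_mul (Real.pi : ℂ)).fun_neg).mul_const _
  refine (h1.cexp.const_mul _).congr_deriv ?_
  push_cast
  ring

lemma hasDerivAt_tsum_thetaTerm (i a b : ℕ) {z : ℂ} (hz : 0 < z.im) :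
    HasDerivAt (fun t : ℝ => ∑' p : {p : ℤ × ℤ // p ≠ 0}, thetaTerm i a b p z t)
      (∑' p : {p : ℤ × ℤ // p ≠ 0}, -(Real.pi * (z.im : ℂ)⁻¹) *
        thetaTerm i (a + 1) (b + 1) p z 1) 1 := by
  set N := i + (a + 1) + (b + 1) + 3
  obtain ⟨C, hC, hC'⟩ := exists_norm_thetaTerm_le i (a + 1) (b + 1) N (by omega) |z.re| hz
  refine hasDerivAt_tsum_of_isPreconnected (t := Set.Ioi (1 / 2 : ℝ)) (y₀ := 1)
    (u := fun p : {p : ℤ × ℤ // p ≠ 0} =>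
      Real.pi * z.im⁻¹ * (C * (z.im / (1 / 2)) ^ N) * (‖p.1‖ ^ 3)⁻¹)
    (summable_norm_prod_int.mul_left _) isOpen_Ioi isPreconnected_Ioi
    (fun p t _ => hasDerivAt_thetaTerm i a b p z t) (fun p t ht => ?_)
    (Set.mem_Ioi.2 (by norm_num)) (summable_thetaTerm i a b hz one_pos)
    (Set.mem_Ioi.2 (by norm_num))
  have ht' : (1 : ℝ) / 2 < t := ht
  have ht0 : 0 < t := by linarith
  rw [norm_mul, norm_neg, norm_mul, norm_inv, norm_real, norm_real,
    Real.norm_of_nonneg Real.pi_pos.le, Real.norm_of_nonneg hz.le, mul_assoc (Real.pi * z.im⁻¹)]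
  gcongr
  refine (hC' z le_rfl le_rfl p.1 p.2 t ht0).trans ?_
  gcongr

/-- Differentiating θ(1/t) = t^(a+1) θ(t) at t = 1 gives (a + 1)θ(1) + 2θ'(1) = 0. -/
lemma tsum_boundary_eq_zero {a : ℕ} (ha : Even a) (ha0 : a ≠ 0) {z : ℂ} (hz : 0 < z.im) :
    ∑' p : {p : ℤ × ℤ // p ≠ 0}, ((a + 1) * thetaTerm 0 0 a p z 1 +
      2 * (-(Real.pi * (z.im : ℂ)⁻¹) * thetaTerm 0 1 (a + 1) p z 1)) = 0 := by
  have hd := hasDerivAt_tsum_thetaTerm 0 0 a hz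
  set θ : ℝ → ℂ := fun t => ∑' p : {p : ℤ × ℤ // p ≠ 0}, thetaTerm 0 0 a p z t with hθ
  set D := ∑' p : {p : ℤ × ℤ // p ≠ 0}, -(Real.pi * (z.im : ℂ)⁻¹) *
        thetaTerm 0 (0 + 1) (a + 1) p z 1 with hD
  have h1 : HasDerivAt (fun t : ℝ => θ t⁻¹) (-D) 1 := by
    have hi := hasDerivAt_inv (one_ne_zero (α := ℝ))
    have hd' : HasDerivAt θ D (1 : ℝ)⁻¹ := by simpa using hd
    simpa [Function.comp_def] using hd'.scomp (1 : ℝ) hi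
  have h2 : HasDerivAt (fun t : ℝ => (t : ℂ) ^ (a + 1) * θ t) ((a + 1) * θ 1 + D) 1 := by
    refine ((((hasDerivAt_id (1 : ℝ)).ofReal_comp).fun_pow (a + 1)).mul hd).congr_deriv ?_
    simp
  have h3 : (fun t : ℝ => θ t⁻¹) =ᶠ[𝓝 1] fun t : ℝ => (t : ℂ) ^ (a + 1) * θ t := by
    filter_upwards [Ioi_mem_nhds one_pos] with t ht using tsum_thetaTerm_conj_inv ha ha0 hz ht
  have h4 := h1.unique (h2.congr_of_eventuallyEq h3)
  rw [Summable.tsum_add ((summable_thetaTerm 0 0 a hz one_pos).mul_left _)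
    (((summable_thetaTerm 0 1 (a + 1) hz one_pos).mul_left _).mul_left _), tsum_mul_left,
    tsum_mul_left]
  change (a + 1) * θ 1 + 2 * D = 0
  linear_combination -h4

lemma tendsto_cpow_mul_thetaTerm (a b : ℕ) {p : ℤ × ℤ} (hp : p ≠ 0) {z : ℂ} (hz : 0 < z.im)
    (s : ℂ) : Tendsto (fun t : ℝ => (t : ℂ) ^ s * thetaTerm 0 a b p z t) atTop (𝓝 0) := by
  rw [tendsto_zero_iff_norm_tendsto_zero]
  have hw := norm_linForm_pos hz hp
  have h := (tendsto_rpow_mul_exp_neg_mul_atTop_nhds_zero s.re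
    (Real.pi * ‖linForm p z‖ ^ 2 / z.im) (by positivity)).mul_const (‖linForm p z‖ ^ (a + b))
  rw [zero_mul] at h
  refine h.congr' ?_
  filter_upwards [eventually_gt_atTop 0] with t ht
  rw [norm_mul, norm_cpow_eq_rpow_re_of_pos ht, norm_thetaTerm]
  rw [show -(Real.pi * ‖linForm p z‖ ^ 2 / z.im) * t = -(Real.pi * t * ‖linForm p z‖ ^ 2 / z.im)
    by ring]
  ring

/-- The antiderivative used for the integration by parts. -/
def partsPrimitive (a : ℕ) (p : ℤ × ℤ) (z s : ℂ) (t : ℝ) : ℂ :=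
  -(Real.pi * (z.im : ℂ)⁻¹) * ((t : ℂ) ^ (s + a + 2) * thetaTerm 0 1 (a + 1) p z t) -
    s * ((t : ℂ) ^ (s + a + 1) * thetaTerm 0 0 a p z t) -
    Real.pi * (z.im : ℂ)⁻¹ * ((t : ℂ) ^ (-s + 1) * thetaTerm 0 1 (a + 1) p z t) +
    (s + a + 1) * ((t : ℂ) ^ (-s) * thetaTerm 0 0 a p z t)

/-- The derivative of `partsPrimitive`. -/
def partsIntegrand (a : ℕ) (p : ℤ × ℤ) (z s : ℂ) (t : ℝ) : ℂ :=
  -(Real.pi * (z.im : ℂ)⁻¹) *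
    ((a + 2) * ((t : ℂ) ^ (s + a + 1) * thetaTerm 0 1 (a + 1) p z t) -
      Real.pi * (z.im : ℂ)⁻¹ * ((t : ℂ) ^ (s + a + 2) * thetaTerm 0 2 (a + 2) p z t)) -
  Real.pi * (z.im : ℂ)⁻¹ *
    ((a + 2) * ((t : ℂ) ^ (-s) * thetaTerm 0 1 (a + 1) p z t) -
      Real.pi * (z.im : ℂ)⁻¹ * ((t : ℂ) ^ (-s + 1) * thetaTerm 0 2 (a + 2) p z t)) -
  s * (s + a + 1) * ((t : ℂ) ^ (s + a) * thetaTerm 0 0 a p z t +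
    (t : ℂ) ^ (-s - 1) * thetaTerm 0 0 a p z t)

lemma hasDerivAt_ofReal_cpow_mul_thetaTerm (c : ℂ) (i a b : ℕ) (p : ℤ × ℤ) (z : ℂ) {t : ℝ}
    (ht : 0 < t) :
    HasDerivAt (fun t : ℝ => (t : ℂ) ^ c * thetaTerm i a b p z t)
      (c * (t : ℂ) ^ (c - 1) * thetaTerm i a b p z t +
        (t : ℂ) ^ c * (-(Real.pi * (z.im : ℂ)⁻¹) * thetaTerm i (a + 1) (b + 1) p z t)) t := by
  refine HasDerivAt.mul ?_ (hasDerivAt_thetaTerm i a b p z t)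
  have := (hasDerivAt_id (t : ℂ)).cpow_const (c := c) (Or.inl (by simpa using ht))
  simpa using this.comp_ofReal

lemma hasDerivAt_partsPrimitive (a : ℕ) (p : ℤ × ℤ) (z s : ℂ) {t : ℝ} (ht : 0 < t) :
    HasDerivAt (partsPrimitive a p z s) (partsIntegrand a p z s t) t := by
  have h1 := (hasDerivAt_ofReal_cpow_mul_thetaTerm (s + a + 2) 0 1 (a + 1) p z ht).const_mul
    (-(Real.pi * (z.im : ℂ)⁻¹))
  have h2 := (hasDerivAt_ofReal_cpow_mul_thetaTerm (s + a + 1) 0 0 a p z ht).const_mul s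
  have h3 := (hasDerivAt_ofReal_cpow_mul_thetaTerm (-s + 1) 0 1 (a + 1) p z ht).const_mul
    (Real.pi * (z.im : ℂ)⁻¹)
  have h4 := (hasDerivAt_ofReal_cpow_mul_thetaTerm (-s) 0 0 a p z ht).const_mul (s + a + 1)
  refine (((h1.sub h2).sub h3).add h4).congr_deriv ?_
  rw [partsIntegrand, show s + a + 2 - 1 = s + a + 1 by ring, show s + a + 1 - 1 = s + a by ring,
    show -s + 1 - 1 = -s by ring]
  ring

/-- Only t = 1 contributes, since the primitive decays at infinity. There the coefficients -s and s
+ a + 1 add up to a + 1, so the value does not depend on s. -/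
lemma integral_partsIntegrand {a : ℕ} {p : ℤ × ℤ} (hp : p ≠ 0) {z : ℂ} (hz : 0 < z.im) (s : ℂ)
    (hF_int : Integrable (partsIntegrand a p z s) tailMeasure) :
    ∫ t, partsIntegrand a p z s t ∂tailMeasure =
      -((a + 1) * thetaTerm 0 0 a p z 1 +
      2 * (-(Real.pi * (z.im : ℂ)⁻¹) * thetaTerm 0 1 (a + 1) p z 1)) := by
  have hlim : Tendsto (partsPrimitive a p z s) atTop (𝓝 0) := by
    have h (c : ℂ) (a b : ℕ) := tendsto_cpow_mul_thetaTerm a b hp hz c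
    have := ((((h (s + a + 2) 1 (a + 1)).const_mul (-(Real.pi * (z.im : ℂ)⁻¹))).sub
      ((h (s + a + 1) 0 a).const_mul s)).sub ((h (-s + 1) 1 (a + 1)).const_mul
        (Real.pi * (z.im : ℂ)⁻¹))).add ((h (-s) 0 a).const_mul (s + a + 1))
    simp only [mul_zero, sub_zero, add_zero] at this
    exact this
  rw [tailMeasure, integral_Ioi_of_hasDerivAt_of_tendsto'
    (fun t ht => hasDerivAt_partsPrimitive a p z s (one_pos.trans_le ht)) hF_int hlim, partsPrimitive]
  simp only [ofReal_one, one_cpow]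
  ring

/-- Two integrations by parts, carried out for each lattice vector through an explicit primitive.
The boundary terms vanish only after summation over the lattice, by the inversion formula; this
produces the eigenvalue s(s + a + 1). -/
lemma tailTheta_parts {a : ℕ} (ha : Even a) (ha0 : a ≠ 0) {z : ℂ} (hz : 0 < z.im) (s : ℂ) :
    ((a + 2) * tailTheta 0 1 (a + 1) 0 (s + a + 1) z -
        Real.pi * (z.im : ℂ)⁻¹ * tailTheta 0 2 (a + 2) 0 (s + a + 2) z) +
      ((a + 2) * tailTheta 0 1 (a + 1) 0 (-s) z -
        Real.pi * (z.im : ℂ)⁻¹ * tailTheta 0 2 (a + 2) 0 (-s + 1) z) =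
      -(z.im / Real.pi) * (s * (s + a + 1) *
        (tailTheta 0 0 a 0 (s + a) z + tailTheta 0 0 a 0 (-s - 1) z)) := by
  have hi (c : ℂ) (a b : ℕ) : Integrable (fun x : ℝ × {p : ℤ × ℤ // p ≠ 0} =>
      (x.1 : ℂ) ^ c * thetaTerm 0 a b x.2 z x.1) (tailMeasure.prod Measure.count) := by
    simpa [cpowMulLogPow] using
      integrable_mul_thetaTerm ae_tailMeasure_pos (admissible_cpowMulLogPow c 0) 0 a b hz
  have ht (c : ℂ) (a b : ℕ) : tailTheta 0 a b 0 c z = ∫ x : ℝ × {p : ℤ × ℤ // p ≠ 0},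
      (x.1 : ℂ) ^ c * thetaTerm 0 a b x.2 z x.1 ∂(tailMeasure.prod Measure.count) := by
    simp [tailTheta, thetaIntegral, cpowMulLogPow]
  have j1 : Integrable (fun x : ℝ × {p : ℤ × ℤ // p ≠ 0} =>
      (a + 2) * ((x.1 : ℂ) ^ (s + a + 1) * thetaTerm 0 1 (a + 1) x.2 z x.1) -
      Real.pi * (z.im : ℂ)⁻¹ * ((x.1 : ℂ) ^ (s + a + 2) * thetaTerm 0 2 (a + 2) x.2 z x.1))
      (tailMeasure.prod Measure.count) := ((hi _ _ _).const_mul _).sub ((hi _ _ _).const_mul _)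
  have j2 : Integrable (fun x : ℝ × {p : ℤ × ℤ // p ≠ 0} =>
      (a + 2) * ((x.1 : ℂ) ^ (-s) * thetaTerm 0 1 (a + 1) x.2 z x.1) -
      Real.pi * (z.im : ℂ)⁻¹ * ((x.1 : ℂ) ^ (-s + 1) * thetaTerm 0 2 (a + 2) x.2 z x.1))
      (tailMeasure.prod Measure.count) := ((hi _ _ _).const_mul _).sub ((hi _ _ _).const_mul _)
  have j3 : Integrable (fun x : ℝ × {p : ℤ × ℤ // p ≠ 0} =>
      (x.1 : ℂ) ^ (s + a) * thetaTerm 0 0 a x.2 z x.1 +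
      (x.1 : ℂ) ^ (-s - 1) * thetaTerm 0 0 a x.2 z x.1)
      (tailMeasure.prod Measure.count) := (hi _ _ _).add (hi _ _ _)
  have j12 : Integrable (fun x : ℝ × {p : ℤ × ℤ // p ≠ 0} =>
      -(Real.pi * (z.im : ℂ)⁻¹) *
      ((a + 2) * ((x.1 : ℂ) ^ (s + a + 1) * thetaTerm 0 1 (a + 1) x.2 z x.1) -
      Real.pi * (z.im : ℂ)⁻¹ * ((x.1 : ℂ) ^ (s + a + 2) * thetaTerm 0 2 (a + 2) x.2 z x.1)) -
      Real.pi * (z.im : ℂ)⁻¹ * ((a + 2) * ((x.1 : ℂ) ^ (-s) * thetaTerm 0 1 (a + 1) x.2 z x.1) -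
      Real.pi * (z.im : ℂ)⁻¹ * ((x.1 : ℂ) ^ (-s + 1) * thetaTerm 0 2 (a + 2) x.2 z x.1)))
      (tailMeasure.prod Measure.count) := (j1.const_mul _).sub (j2.const_mul _)
  have hF_int : Integrable (fun x : ℝ × {p : ℤ × ℤ // p ≠ 0} => partsIntegrand a x.2 z s x.1)
      (tailMeasure.prod Measure.count) := j12.sub (j3.const_mul _)
  have hzero : ∫ x : ℝ × {p : ℤ × ℤ // p ≠ 0}, partsIntegrand a x.2 z s x.1
      ∂(tailMeasure.prod Measure.count) = 0 := by
    have hae : ∀ p : {p : ℤ × ℤ // p ≠ 0}, Integrable (partsIntegrand a p z s) tailMeasure := by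
      have := hF_int.prod_left_ae
      rwa [Measure.ae_count_iff] at this
    rw [integral_prod_symm _ hF_int, integral_countable hF_int.integral_prod_right]
    simp only [Measure.real, Measure.count_singleton, ENNReal.toReal_one, one_smul]
    rw [tsum_congr fun p => integral_partsIntegrand p.2 hz s (hae p), tsum_neg,
      tsum_boundary_eq_zero ha ha0 hz, neg_zero]
  have hexp : ∫ x : ℝ × {p : ℤ × ℤ // p ≠ 0}, partsIntegrand a x.2 z s x.1
      ∂(tailMeasure.prod Measure.count) =
      -(Real.pi * (z.im : ℂ)⁻¹) * ((a + 2) * tailTheta 0 1 (a + 1) 0 (s + a + 1) z -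
        Real.pi * (z.im : ℂ)⁻¹ * tailTheta 0 2 (a + 2) 0 (s + a + 2) z) -
      Real.pi * (z.im : ℂ)⁻¹ * ((a + 2) * tailTheta 0 1 (a + 1) 0 (-s) z -
        Real.pi * (z.im : ℂ)⁻¹ * tailTheta 0 2 (a + 2) 0 (-s + 1) z) -
      s * (s + a + 1) * (tailTheta 0 0 a 0 (s + a) z + tailTheta 0 0 a 0 (-s - 1) z) := by
    simp only [ht, partsIntegrand]
    rw [← integral_const_mul, ← integral_const_mul, ← integral_const_mul, ← integral_const_mul,
      ← integral_sub ((hi _ _ _).const_mul _) ((hi _ _ _).const_mul _),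
      ← integral_sub ((hi _ _ _).const_mul _) ((hi _ _ _).const_mul _),
      ← integral_add (hi _ _ _) (hi _ _ _), ← integral_const_mul, ← integral_const_mul,
      ← integral_const_mul, ← integral_sub (j1.const_mul _) (j2.const_mul _),
      ← integral_sub j12 (j3.const_mul _)]
  rw [hexp] at hzero
  have hpi : (Real.pi : ℂ) ≠ 0 := by exact_mod_cast Real.pi_ne_zero
  have hy : (z.im : ℂ) ≠ 0 := by exact_mod_cast hz.ne'
  have hyi : (z.im : ℂ) * (z.im : ℂ)⁻¹ = 1 := mul_inv_cancel₀ hy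
  have hpp : (Real.pi : ℂ) * (Real.pi : ℂ)⁻¹ = 1 := mul_inv_cancel₀ hpi
  generalize (a + 2) * tailTheta 0 1 (a + 1) 0 (s + a + 1) z -
        Real.pi * (z.im : ℂ)⁻¹ * tailTheta 0 2 (a + 2) 0 (s + a + 2) z = D₁ at *
  generalize (a + 2) * tailTheta 0 1 (a + 1) 0 (-s) z -
        Real.pi * (z.im : ℂ)⁻¹ * tailTheta 0 2 (a + 2) 0 (-s + 1) z = D₂ at *
  field_simp at hzero
  field_simp
  linear_combination -hzero

/-! ### Taylor coefficients of the completed series and the operator `ξ` -/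

/-- The Taylor coefficients at `s = 0` of the completed Eisenstein series of weight `-a`. -/
def negCoeff (a n : ℕ) (z : ℂ) : ℂ :=
  (Real.pi : ℂ) ^ (a / 2) / 2 / n.factorial *
    (tailTheta 0 a 0 n (-1) z + (-1) ^ n * tailTheta 0 a 0 n a z)

/-- The Taylor coefficients at `s = 0` of the completed Eisenstein series of weight `b`. -/
def posCoeff (b n : ℕ) (z : ℂ) : ℂ :=
  (Real.pi : ℂ) ^ (b / 2) / 2 / n.factorial *
    (((z.im : ℂ)⁻¹) ^ b * tailTheta 0 0 b n (b - 1) z +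
      (-1) ^ n * (((z.im : ℂ)⁻¹) ^ b * tailTheta 0 0 b n 0 z))

lemma differentiable_tailTheta_add (i a b n : ℕ) (c : ℂ) {z : ℂ} (hz : 0 < z.im) :
    Differentiable ℂ fun s => tailTheta i a b n (s + c) z :=
  (differentiable_tailTheta i a b n hz).comp (differentiable_id.add_const c)

lemma differentiable_tailTheta_sub (i a b n : ℕ) (c : ℂ) {z : ℂ} (hz : 0 < z.im) :
    Differentiable ℂ fun s => tailTheta i a b n (c - s) z :=
  (differentiable_tailTheta i a b n hz).comp (differentiable_id.const_sub c)

lemma taylorAt_completedNeg (a n : ℕ) {z : ℂ} (hz : 0 < z.im) :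
    taylorAt (completedNeg a z) n = negCoeff a n z := by
  unfold completedNeg
  simp only [sub_eq_add_neg _ (1 : ℂ)]
  rw [taylorAt_const_mul, taylorAt_add (differentiable_tailTheta_add _ _ _ _ _ hz)
    (differentiable_tailTheta_sub _ _ _ _ _ hz), taylorAt_tailTheta_add _ _ _ _ _ hz,
    taylorAt_tailTheta_sub _ _ _ _ _ hz, negCoeff]
  ring

lemma taylorAt_completedPos (b n : ℕ) {z : ℂ} (hz : 0 < z.im) :
    taylorAt (completedPos b z) n = posCoeff b n z := by
  unfold completedPos
  simp only [add_sub_assoc, ← zero_sub (_ : ℂ)]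
  rw [taylorAt_const_mul, taylorAt_add (differentiable_tailTheta_add _ _ _ _ _ hz)
    (differentiable_tailTheta_sub _ _ _ _ _ hz), taylorAt_tailTheta_add _ _ _ _ _ hz,
    taylorAt_tailTheta_sub _ _ _ _ _ hz, posCoeff]
  ring

lemma contDiffOn_im_inv_pow (b : ℕ) :
    ContDiffOn ℝ ∞ (fun z : ℂ => ((z.im : ℂ)⁻¹) ^ b) {z : ℂ | 0 < z.im} := by
  refine (ContDiffOn.inv ?_ fun z hz => ?_).pow b
  · exact (ofRealCLM.comp imCLM).contDiff.contDiffOn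
  · exact_mod_cast (ne_of_gt hz)

lemma mem_smoothFunctions_of_contDiffOn {φ : ℂ → ℂ} (h : ContDiffOn ℝ ∞ φ {z : ℂ | 0 < z.im}) :
    (fun z : ℍ => φ z) ∈ smoothFunctions := by
  refine ContDiffOn.congr h fun z hz => ?_
  simp [ofComplex_apply_of_im_pos hz]

lemma negCoeff_smooth (a n : ℕ) : (fun z : ℍ => negCoeff a n z) ∈ smoothFunctions := by
  refine mem_smoothFunctions_of_contDiffOn ?_
  unfold negCoeff
  exact contDiffOn_const.mul ((contDiffOn_tailTheta _ _ _ _ _).add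
    (contDiffOn_const.mul (contDiffOn_tailTheta _ _ _ _ _)))

lemma posCoeff_smooth (b n : ℕ) : (fun z : ℍ => posCoeff b n z) ∈ smoothFunctions := by
  refine mem_smoothFunctions_of_contDiffOn ?_
  unfold posCoeff
  have h := contDiffOn_im_inv_pow b
  exact contDiffOn_const.mul ((h.mul (contDiffOn_tailTheta _ _ _ _ _)).add
    (contDiffOn_const.mul (h.mul (contDiffOn_tailTheta _ _ _ _ _))))

/-- The derivative ∂_z̄ meets only the Gaussian, replacing w^a by t w^(a+2), and conjugation gives
w̄^(a+2). The exponents -1 and a of t become 0 and a + 1, those of weight a + 2 in the opposite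
order, whence the sign. -/
lemma xi_negCoeff (a n : ℕ) (z : ℍ) :
    xi (-(a : ℤ)) (fun z : ℍ => negCoeff a n z) z = (-1) ^ n * posCoeff (a + 2) n z := by
  have hz : 0 < (z : ℂ).im := z.2
  have h := ((hasWirtingerDerivAt_tailTheta 0 a 0 n (-1) hz).add
    ((hasWirtingerDerivAt_tailTheta 0 a 0 n a hz).const_mul ((-1) ^ n))).const_mul
    ((Real.pi : ℂ) ^ (a / 2) / 2 / n.factorial)
  rw [xi_eq_of_hasWirtingerDerivAt (φ := negCoeff a n) (fun _ => rfl) _ h]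
  have hy : ((z : ℂ).im : ℂ) = (z.im : ℂ) := rfl
  have hy0 : (z.im : ℂ) ≠ 0 := by exact_mod_cast z.im_ne_zero
  simp only [posCoeff, map_mul, map_add, map_div₀, map_pow, map_neg, map_one, conj_tailTheta,
    map_inv₀, conj_ofReal, conj_I, map_natCast, map_ofNat, Nat.cast_zero, zero_mul, zero_add, hy,
    show (a + 2) / 2 = a / 2 + 1 by omega, zpow_neg, zpow_natCast]
  have h1 : ((-1 : ℂ)) ^ n * (-1) ^ n = 1 := by rw [← mul_pow]; simp
  have h2 : (-1 + 1 : ℂ) = 0 := by ring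
  have h3 : ((a + 2 : ℕ) : ℂ) - 1 = a + 1 := by push_cast; ring
  rw [h2, h3]
  have hfac : (n.factorial : ℂ) ≠ 0 := by exact_mod_cast n.factorial_ne_zero
  have hI : Complex.I * Complex.I = -1 := I_mul_I
  linear_combination (-((Real.pi : ℂ) ^ (a / 2) * Real.pi / 2 / n.factorial *
      (z.im : ℂ)⁻¹ ^ (a + 2))) * (tailTheta 0 0 (a + 2) n 0 z +
    (-1) ^ n * tailTheta 0 0 (a + 2) n (a + 1) z) * hI -
    (Real.pi : ℂ) ^ (a / 2) * Real.pi / 2 / n.factorial * (z.im : ℂ)⁻¹ ^ (a + 2) *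
      tailTheta 0 0 (a + 2) n 0 z * h1

/-- Substitute m = (w - w̄)/(2iy) to remove the factor m created by differentiating w̄. -/
lemma tailTheta_one_eq (b n : ℕ) (s : ℂ) {z : ℂ} (hz : 0 < z.im) :
    tailTheta 1 0 b n s z =
      -(Complex.I / 2) * (z.im : ℂ)⁻¹ * (tailTheta 0 1 b n s z - tailTheta 0 0 (b + 1) n s z) := by
  have hi (a b : ℕ) := integrable_mul_thetaTerm ae_tailMeasure_pos
    (admissible_cpowMulLogPow s n) 0 a b hz
  simp only [tailTheta, thetaIntegral]
  rw [← integral_sub (hi 1 b) (hi 0 (b + 1)), ← integral_const_mul]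
  congr 1
  ext x
  have hy : (z.im : ℂ) ≠ 0 := by exact_mod_cast hz.ne'
  have hsub : linForm x.2 z - starRingEnd ℂ (linForm x.2 z) = 2 * Complex.I * x.2.1.1 * z.im := by
    rw [Complex.sub_conj]
    simp [linForm]; ring
  have hm : (x.2.1.1 : ℂ) = -(Complex.I / 2) * (z.im : ℂ)⁻¹ *
      (linForm x.2 z - starRingEnd ℂ (linForm x.2 z)) := by
    rw [hsub]
    field_simp
    linear_combination (x.2.1.1 : ℂ) * I_sq
  simp only [thetaTerm, pow_one, pow_zero, one_mul, mul_one]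
  rw [hm]
  ring

/-- The derivative of y^(-(a+2)) cancels the w̄^(a+2) part of the derivative of w̄^(a+2); what is
left has the form needed for integration by parts. Only the dz̄-coefficient enters ξ, so the other
one stays unspecified. -/
lemma hasWirtingerDerivAt_im_inv_pow_mul_tailTheta (a n : ℕ) (s : ℂ) {z : ℂ} (hz : 0 < z.im) :
    ∃ A, HasWirtingerDerivAt (fun w => ((w.im : ℂ)⁻¹) ^ (a + 2) * tailTheta 0 0 (a + 2) n s w) A
      (-(Complex.I / 2) * ((z.im : ℂ)⁻¹) ^ (a + 3) * ((a + 2) * tailTheta 0 1 (a + 1) n s z -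
        Real.pi * (z.im : ℂ)⁻¹ * tailTheta 0 2 (a + 2) n (s + 1) z)) z := by
  have hy : (z.im : ℂ) ≠ 0 := by exact_mod_cast hz.ne'
  refine ⟨_, (((HasWirtingerDerivAt.im'.inv hy).pow (a + 2)).mul
    (hasWirtingerDerivAt_tailTheta 0 0 (a + 2) n s hz)).congr_val rfl ?_⟩
  rw [show a + 2 - 1 = a + 1 by omega, tailTheta_one_eq (a + 1) n s hz]
  push_cast
  ring

lemma taylorAt_parts {a : ℕ} (ha : Even a) (ha0 : a ≠ 0) (n : ℕ) {z : ℂ} (hz : 0 < z.im) :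
    ((a + 2) * tailTheta 0 1 (a + 1) n (a + 1) z -
        Real.pi * (z.im : ℂ)⁻¹ * tailTheta 0 2 (a + 2) n (a + 2) z) +
      (-1) ^ n * ((a + 2) * tailTheta 0 1 (a + 1) n 0 z -
        Real.pi * (z.im : ℂ)⁻¹ * tailTheta 0 2 (a + 2) n 1 z) =
      -(z.im / Real.pi) * n.factorial *
        ((a + 1) * shift (fun n => (tailTheta 0 0 a n a z + (-1) ^ n * tailTheta 0 0 a n (-1) z) /
          n.factorial) n + shift (shift (fun n =>
            (tailTheta 0 0 a n a z + (-1) ^ n * tailTheta 0 0 a n (-1) z) / n.factorial)) n) := by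
  have hR : (taylorAt fun s => tailTheta 0 0 a 0 (s + a) z + tailTheta 0 0 a 0 (-1 - s) z) =
      fun n => (tailTheta 0 0 a n a z + (-1) ^ n * tailTheta 0 0 a n (-1) z) / n.factorial := by
    ext n
    rw [taylorAt_add (differentiable_tailTheta_add _ _ _ _ _ hz)
      (differentiable_tailTheta_sub _ _ _ _ _ hz), taylorAt_tailTheta_add _ _ _ _ _ hz,
      taylorAt_tailTheta_sub _ _ _ _ _ hz]
    ring
  have hfun : (fun s => ((a + 2 : ℂ) * tailTheta 0 1 (a + 1) 0 (s + (a + 1)) z +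
        -(Real.pi * (z.im : ℂ)⁻¹) * tailTheta 0 2 (a + 2) 0 (s + (a + 2)) z) +
      ((a + 2 : ℂ) * tailTheta 0 1 (a + 1) 0 (0 - s) z +
        -(Real.pi * (z.im : ℂ)⁻¹) * tailTheta 0 2 (a + 2) 0 (1 - s) z)) =
      fun s => -(z.im / Real.pi : ℂ) * ((0 + (a + 1 : ℂ) * s + s * s) *
        (tailTheta 0 0 a 0 (s + a) z + tailTheta 0 0 a 0 (-1 - s) z)) := by
    ext s
    have := tailTheta_parts ha ha0 hz s
    rw [show s + (a + 1 : ℂ) = s + a + 1 by ring, show s + (a + 2 : ℂ) = s + a + 2 by ring,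
      show 0 - s = -s by ring, show 1 - s = -s + 1 by ring, show -1 - s = -s - 1 by ring]
    linear_combination this
  have hd1 := differentiable_tailTheta_add 0 1 (a + 1) 0 (a + 1) hz
  have hd2 := differentiable_tailTheta_add 0 2 (a + 2) 0 (a + 2) hz
  have hd3 := differentiable_tailTheta_sub 0 1 (a + 1) 0 0 hz
  have hd4 := differentiable_tailTheta_sub 0 2 (a + 2) 0 1 hz
  have hd5 := differentiable_tailTheta_add 0 0 a 0 a hz
  have hd6 := differentiable_tailTheta_sub 0 0 a 0 (-1) hz
  have h := congrArg (fun f => taylorAt f n) hfun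
  rw [taylorAt_add (by fun_prop) (by fun_prop), taylorAt_add (by fun_prop) (by fun_prop),
    taylorAt_add (by fun_prop) (by fun_prop), taylorAt_const_mul, taylorAt_const_mul,
    taylorAt_const_mul, taylorAt_const_mul, taylorAt_const_mul, taylorAt_tailTheta_add _ _ _ _ _ hz,
    taylorAt_tailTheta_add _ _ _ _ _ hz, taylorAt_tailTheta_sub _ _ _ _ _ hz,
    taylorAt_tailTheta_sub _ _ _ _ _ hz, taylorAt_quadratic_mul (by fun_prop), hR] at h
  have hfac : (n.factorial : ℂ) ≠ 0 := by exact_mod_cast n.factorial_ne_zero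
  have h' := congrArg (fun u => (n.factorial : ℂ) * u) h
  refine Eq.trans ?_ (h'.trans ?_)
  · field_simp
    ring
  · ring

lemma map_shift (φ : ℂ →+* ℂ) (c : ℕ → ℂ) (n : ℕ) : φ (shift c n) = shift (fun n => φ (c n)) n := by
  cases n <;> simp [shift]

lemma mul_shift (x : ℂ) (c : ℕ → ℂ) (n : ℕ) : x * shift c n = shift (fun n => x * c n) n := by
  cases n <;> simp [shift]

/-- The integration by parts, read on Taylor coefficients: the eigenvalue (a + 1)s + s² becomes one
shift with weight a + 1 plus a double shift. -/
lemma xi_posCoeff {a : ℕ} (ha : Even a) (ha0 : a ≠ 0) (n : ℕ) (z : ℍ) :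
    xi ((a + 2 : ℕ) : ℤ) (fun z : ℍ => posCoeff (a + 2) n z) z =
      (a + 1) * shift (fun n => (-1) ^ n * negCoeff a n z) n +
        shift (shift fun n => (-1) ^ n * negCoeff a n z) n := by
  have hz : 0 < (z : ℂ).im := z.2
  obtain ⟨A₁, h1⟩ := hasWirtingerDerivAt_im_inv_pow_mul_tailTheta a n ((a + 2 : ℕ) - 1 : ℂ) hz
  obtain ⟨A₂, h2⟩ := hasWirtingerDerivAt_im_inv_pow_mul_tailTheta a n 0 hz
  have h := (h1.add (h2.const_mul ((-1) ^ n))).const_mul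
    ((Real.pi : ℂ) ^ ((a + 2) / 2) / 2 / n.factorial)
  have hy0 : (z.im : ℂ) ≠ 0 := by exact_mod_cast z.im_ne_zero
  have hpi : (Real.pi : ℂ) ≠ 0 := by exact_mod_cast Real.pi_ne_zero
  have hfac : (n.factorial : ℂ) ≠ 0 := by exact_mod_cast n.factorial_ne_zero
  set R : ℕ → ℂ := fun n =>
    (tailTheta 0 0 a n a z + (-1) ^ n * tailTheta 0 0 a n (-1) z) / n.factorial with hR
  have hp : _ = -(((z : ℂ).im : ℂ) / Real.pi) * n.factorial *
    ((a + 1) * shift R n + shift (shift R) n) := taylorAt_parts ha ha0 n hz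
  have hconj : ∀ n, (-1) ^ n * negCoeff a n z =
      (Real.pi : ℂ) ^ (a / 2) / 2 * starRingEnd ℂ (R n) := by
    intro n
    have h1 : ((-1 : ℂ)) ^ n * (-1) ^ n = 1 := by rw [← mul_pow]; simp
    simp only [hR, negCoeff, map_div₀, map_add, map_mul, map_pow, map_neg, map_one,
      conj_tailTheta, map_natCast]
    linear_combination (Real.pi : ℂ) ^ (a / 2) / 2 / n.factorial * tailTheta 0 a 0 n a z * h1
  have hB : (Real.pi : ℂ) ^ ((a + 2) / 2) / 2 / n.factorial *
      (-(Complex.I / 2) * (((z : ℂ).im : ℂ)⁻¹) ^ (a + 3) *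
        ((a + 2) * tailTheta 0 1 (a + 1) n ((a + 2 : ℕ) - 1 : ℂ) z - Real.pi * ((z : ℂ).im : ℂ)⁻¹ *
          tailTheta 0 2 (a + 2) n ((a + 2 : ℕ) - 1 + 1 : ℂ) z) +
      (-1) ^ n * (-(Complex.I / 2) * (((z : ℂ).im : ℂ)⁻¹) ^ (a + 3) *
        ((a + 2) * tailTheta 0 1 (a + 1) n 0 z - Real.pi * ((z : ℂ).im : ℂ)⁻¹ *
          tailTheta 0 2 (a + 2) n (0 + 1) z))) =
      (Complex.I / 2) * ((Real.pi : ℂ) ^ (a / 2) / 2) * ((z.im : ℂ)⁻¹) ^ (a + 2) *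
        ((a + 1) * shift R n + shift (shift R) n) := by
    have e1 : (((a + 2 : ℕ) : ℂ) - 1) = a + 1 := by push_cast; ring
    have e2 : ((a : ℂ) + 1 + 1) = a + 2 := by ring
    rw [e1, e2, zero_add, show (a + 2) / 2 = a / 2 + 1 by omega]
    have hy : ((z : ℂ).im : ℂ) = (z.im : ℂ) := rfl
    rw [hy] at hp ⊢
    have hyi : (z.im : ℂ)⁻¹ ^ (a + 3) = (z.im : ℂ)⁻¹ ^ (a + 2) * (z.im : ℂ)⁻¹ := pow_succ _ _
    have hc : (Real.pi : ℂ) ^ (a / 2 + 1) / 2 / n.factorial * (-(Complex.I / 2)) *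
        ((z.im : ℂ)⁻¹ ^ (a + 2) * (z.im : ℂ)⁻¹) * (-((z.im : ℂ) / Real.pi) * n.factorial) =
        (Complex.I / 2) * ((Real.pi : ℂ) ^ (a / 2) / 2) * ((z.im : ℂ)⁻¹) ^ (a + 2) := by
      rw [pow_succ]
      field_simp
    rw [hyi]
    linear_combination (Real.pi : ℂ) ^ (a / 2 + 1) / 2 / n.factorial * (-(Complex.I / 2)) *
        ((z.im : ℂ)⁻¹ ^ (a + 2) * (z.im : ℂ)⁻¹) * hp + ((a + 1) * shift R n + shift (shift R) n) * hc
  rw [xi_eq_of_hasWirtingerDerivAt (φ := posCoeff (a + 2) n) (fun _ => rfl) _ h, hB]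
  simp only [hconj, ← mul_shift]
  have hss : shift (shift fun n => (Real.pi : ℂ) ^ (a / 2) / 2 * starRingEnd ℂ (R n)) n
      = (Real.pi : ℂ) ^ (a / 2) / 2 * shift (shift fun n => starRingEnd ℂ (R n)) n := by
    rw [mul_shift]
    congr 1
    ext m
    rw [mul_shift]
  simp only [map_mul, map_add, map_div₀, map_pow, conj_ofReal, conj_I, map_natCast, map_ofNat,
    map_inv₀, map_one, map_shift, hss, zpow_natCast]
  have hyy : (z.im : ℂ) ^ (a + 2) * (z.im : ℂ)⁻¹ ^ (a + 2) = 1 := by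
    rw [← mul_pow, mul_inv_cancel₀ hy0, one_pow]
  linear_combination (-Complex.I * Complex.I * ((Real.pi : ℂ) ^ (a / 2) / 2) *
    ((a + 1) * shift (fun n => starRingEnd ℂ (R n)) n +
      shift (shift fun n => starRingEnd ℂ (R n)) n)) * hyy - ((Real.pi : ℂ) ^ (a / 2) / 2) *
    ((a + 1) * shift (fun n => starRingEnd ℂ (R n)) n +
      shift (shift fun n => starRingEnd ℂ (R n)) n) * I_mul_I

/-! ### Modularity and growth -/

/-- Right multiplication of nonzero integral row vectors by a matrix in `SL(2, ℤ)`. -/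
def vecMulEquiv (γ : SL(2, ℤ)) : {p : ℤ × ℤ // p ≠ 0} ≃ {p : ℤ × ℤ // p ≠ 0} :=
  have hdet : γ 0 0 * γ 1 1 - γ 0 1 * γ 1 0 = 1 := by rw [← Matrix.det_fin_two, γ.det_coe]
  let e : ℤ × ℤ ≃ ℤ × ℤ :=
    { toFun := fun p => (p.1 * γ 0 0 + p.2 * γ 1 0, p.1 * γ 0 1 + p.2 * γ 1 1)
      invFun := fun p => (p.1 * γ 1 1 - p.2 * γ 1 0, -p.1 * γ 0 1 + p.2 * γ 0 0)
      left_inv := fun p => by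
        ext
        · linear_combination p.1 * hdet
        · linear_combination p.2 * hdet
      right_inv := fun p => by
        ext
        · linear_combination p.1 * hdet
        · linear_combination p.2 * hdet }
  e.subtypeEquiv fun p => not_congr <| by
    rw [← e.apply_eq_iff_eq]
    simp [e]

/-- The automorphy factor `c z + d`. -/
def autFactor (γ : SL(2, ℤ)) (z : ℍ) : ℂ := (γ 1 0 : ℂ) * z + γ 1 1

lemma autFactor_ne_zero (γ : SL(2, ℤ)) (z : ℍ) : autFactor γ z ≠ 0 := by
  have := UpperHalfPlane.denom_ne_zero (γ : GL (Fin 2) ℝ) z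
  simpa [autFactor, UpperHalfPlane.denom] using this

lemma autFactor_mul_conj (γ : SL(2, ℤ)) (z : ℍ) :
    autFactor γ z * starRingEnd ℂ (autFactor γ z) * ((γ • z : ℍ).im : ℂ) = z.im := by
  have h := ModularGroup.im_smul_eq_div_normSq γ z
  have hd : UpperHalfPlane.denom (γ : GL (Fin 2) ℝ) z = autFactor γ z := by
    simp [autFactor, UpperHalfPlane.denom]
  rw [h, mul_conj, hd, ← ofReal_mul, mul_div_cancel₀]
  exact normSq_eq_zero.not.mpr (autFactor_ne_zero γ z)

lemma autFactor_mul_linForm (γ : SL(2, ℤ)) (z : ℍ) (p : {p : ℤ × ℤ // p ≠ 0}) :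
    autFactor γ z * linForm p (γ • z : ℍ) = linForm (vecMulEquiv γ p) z := by
  have hj := autFactor_ne_zero γ z
  rw [linForm, UpperHalfPlane.coe_specialLinearGroup_apply]
  have : (((γ 1 0 : ℤ) : ℝ) : ℂ) * z + ((γ 1 1 : ℤ) : ℝ) = autFactor γ z := by simp [autFactor]
  simp only [algebraMap_int_eq, Int.coe_castRingHom, this]
  field_simp
  simp [vecMulEquiv, linForm, autFactor]
  ring

lemma autFactor_mul_thetaTerm (a b : ℕ) (γ : SL(2, ℤ)) (z : ℍ) (p : {p : ℤ × ℤ // p ≠ 0}) (t : ℝ) :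
    autFactor γ z ^ a * starRingEnd ℂ (autFactor γ z) ^ b * thetaTerm 0 a b p (γ • z : ℍ) t =
      thetaTerm 0 a b (vecMulEquiv γ p) z t := by
  have hj := autFactor_ne_zero γ z
  have hj' : starRingEnd ℂ (autFactor γ z) ≠ 0 := by simpa using hj
  have hy : ((γ • z : ℍ).im : ℂ) ≠ 0 := by exact_mod_cast (γ • z : ℍ).im_pos.ne'
  have hi : (z : ℂ).im = z.im := rfl
  have hi' : ((γ • z : ℍ) : ℂ).im = (γ • z : ℍ).im := rfl
  rw [thetaTerm, thetaTerm, ← autFactor_mul_linForm, hi, hi', ← autFactor_mul_conj γ z]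
  simp only [map_mul, mul_pow, pow_zero]
  have : autFactor γ z * linForm p (γ • z : ℍ) * (starRingEnd ℂ (autFactor γ z) *
      starRingEnd ℂ (linForm p (γ • z : ℍ))) *
      (autFactor γ z * starRingEnd ℂ (autFactor γ z) * ((γ • z : ℍ).im : ℂ))⁻¹ =
      linForm p (γ • z : ℍ) * starRingEnd ℂ (linForm p (γ • z : ℍ)) * ((γ • z : ℍ).im : ℂ)⁻¹ := by
    field_simp
  rw [this]
  ring

/-- The quantity |w|²/y is invariant when (m, n) is multiplied on the right by γ, so the lattice sum
is merely reindexed and only w^a w̄^b produces automorphy factors. -/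
lemma autFactor_mul_tailTheta (a b n : ℕ) (s : ℂ) (γ : SL(2, ℤ)) (z : ℍ) :
    autFactor γ z ^ a * starRingEnd ℂ (autFactor γ z) ^ b * tailTheta 0 a b n s (γ • z : ℍ) =
      tailTheta 0 a b n s z := by
  rw [tailTheta, tailTheta,
    thetaIntegral_eq_integral_tsum ae_tailMeasure_pos (admissible_cpowMulLogPow s n) 0 a b
      (γ • z : ℍ).im_pos,
    thetaIntegral_eq_integral_tsum ae_tailMeasure_pos (admissible_cpowMulLogPow s n) 0 a b z.im_pos,
    ← integral_const_mul]
  refine integral_congr_ae (ae_of_all _ fun t => ?_)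
  beta_reduce
  rw [mul_left_comm, ← tsum_mul_left]
  congr 1
  simp only [autFactor_mul_thetaTerm]
  exact (vecMulEquiv γ).tsum_eq fun p : {p : ℤ × ℤ // p ≠ 0} => thetaTerm 0 a b p z t

lemma negCoeff_smul (a n : ℕ) (γ : SL(2, ℤ)) (z : ℍ) :
    negCoeff a n (γ • z : ℍ) = autFactor γ z ^ (-(a : ℤ)) * negCoeff a n z := by
  have hj := autFactor_ne_zero γ z
  rw [negCoeff, negCoeff, ← autFactor_mul_tailTheta a 0 n (-1) γ z,
    ← autFactor_mul_tailTheta a 0 n a γ z, zpow_neg, zpow_natCast]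
  field_simp

lemma posCoeff_smul (b n : ℕ) (γ : SL(2, ℤ)) (z : ℍ) :
    posCoeff b n (γ • z : ℍ) = autFactor γ z ^ (b : ℤ) * posCoeff b n z := by
  have hj := autFactor_ne_zero γ z
  have hj' : starRingEnd ℂ (autFactor γ z) ≠ 0 := by simpa using hj
  have hy : ((γ • z : ℍ).im : ℂ) ≠ 0 := by exact_mod_cast (γ • z : ℍ).im_pos.ne'
  have hi : (z : ℂ).im = z.im := rfl
  have hi' : ((γ • z : ℍ) : ℂ).im = (γ • z : ℍ).im := rfl
  rw [posCoeff, posCoeff, ← autFactor_mul_tailTheta 0 b n (b - 1) γ z,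
    ← autFactor_mul_tailTheta 0 b n 0 γ z, zpow_natCast, hi, hi', ← autFactor_mul_conj γ z]
  simp only [inv_pow, mul_pow]
  field_simp

/-- Smooth functions that are modular of weight `k` and of moderate growth at the cusp. -/
def moderateForms (k : ℤ) : Submodule ℂ (ℍ → ℂ) where
  carrier := {f | f ∈ smoothFunctions ∧ (∀ γ : SL(2, ℤ), f ∣[k] γ = f) ∧
    ∃ α : ℝ, f =O[atImInfty] fun z : ℍ => z.im ^ α}
  zero_mem' := ⟨smoothFunctions.zero_mem, fun γ => by simp, 0, Asymptotics.isBigO_zero _ _⟩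
  add_mem' := by
    rintro f g ⟨hf, hf', α, hα⟩ ⟨hg, hg', β, hβ⟩
    refine ⟨smoothFunctions.add_mem hf hg, fun γ => ?_, max α β, ?_⟩
    · rw [SlashAction.add_slash, hf', hg']
    · have key {α γ : ℝ} (h : α ≤ γ) :
          (fun z : ℍ => z.im ^ α) =O[atImInfty] fun z : ℍ => z.im ^ γ := by
        refine Asymptotics.IsBigO.of_bound 1 ?_
        filter_upwards [(atImInfty_mem _).mpr ⟨1, fun z hz => hz⟩] with z (hz : 1 ≤ z.im)
        rw [one_mul, Real.norm_of_nonneg (by positivity), Real.norm_of_nonneg (by positivity)]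
        exact Real.rpow_le_rpow_of_exponent_le hz h
      exact (hα.trans (key (le_max_left _ _))).add (hβ.trans (key (le_max_right _ _)))
  smul_mem' := by
    rintro c f ⟨hf, hf', α, hα⟩
    refine ⟨smoothFunctions.smul_mem c hf, fun γ => ?_, α, hα.const_smul_left c⟩
    rw [ModularForm.SL_smul_slash, hf']

/-- Translating by the integer nearest to Re z reduces uniformity in x to a bound on |x| ≤ 1. -/
lemma exists_isBigO_of_modular {k : ℤ} {f : ℍ → ℂ} (hf : ∀ γ : SL(2, ℤ), f ∣[k] γ = f) {N : ℕ}
    {C : ℝ} (h : ∀ z : ℍ, |z.re| ≤ 1 → 1 ≤ z.im → ‖f z‖ ≤ C * z.im ^ N) :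
    ∃ α : ℝ, f =O[atImInfty] fun z : ℍ => z.im ^ α := by
  refine ⟨N, Asymptotics.IsBigO.of_bound C ?_⟩
  filter_upwards [(atImInfty_mem _).mpr ⟨1, fun z hz => hz⟩] with z (hz : 1 ≤ z.im)
  have hper : f (ModularGroup.T ^ (-round z.re) • z) = f z := by
    have := (ModularForm.slash_action_eq'_iff k f (ModularGroup.T ^ (-round z.re)) z).mp
      (congrFun (hf _) z)
    rw [this]
    simp [ModularGroup.coe_T_zpow]
  have hc := ModularGroup.coe_T_zpow_smul_eq (z := z) (n := -round z.re)
  have hre : (ModularGroup.T ^ (-round z.re) • z).re = z.re - round z.re := by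
    have := congrArg Complex.re hc
    simpa [sub_eq_add_neg] using this
  have him : (ModularGroup.T ^ (-round z.re) • z).im = z.im := by
    have := congrArg Complex.im hc
    simpa using this
  have := h (ModularGroup.T ^ (-round z.re) • z) (by
    rw [hre]; exact (abs_sub_round _).trans (by norm_num)) (him ▸ hz)
  rw [hper, him] at this
  rw [Real.norm_of_nonneg (by positivity), Real.rpow_natCast]
  exact this

lemma norm_mul_add_le_of_norm_le {f g : ℂ → ℂ} {N M : ℕ} {C D : ℝ} {S : Set ℂ}
    (hS : ∀ z ∈ S, 1 ≤ z.im)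
    (hf : ∀ z ∈ S, ‖f z‖ ≤ C * z.im ^ N) (hg : ∀ z ∈ S, ‖g z‖ ≤ D * z.im ^ M) (c d : ℂ) :
    ∀ z ∈ S, ‖c * (f z + d * g z)‖ ≤ ‖c‖ * (|C| + ‖d‖ * |D|) * z.im ^ max N M := by
  intro z hz
  have hy := hS z hz
  have hy0 : 0 ≤ z.im := by linarith
  have h1 : ‖f z‖ ≤ |C| * z.im ^ max N M := (hf z hz).trans <| by
    gcongr
    · exact le_abs_self C
    · exact le_max_left _ _
  have h2 : ‖g z‖ ≤ |D| * z.im ^ max N M := (hg z hz).trans <| by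
    gcongr
    · exact le_abs_self D
    · exact le_max_right _ _
  rw [norm_mul, mul_assoc]
  gcongr
  calc ‖f z + d * g z‖ ≤ ‖f z‖ + ‖d‖ * ‖g z‖ := (norm_add_le _ _).trans_eq (by rw [norm_mul])
    _ ≤ |C| * z.im ^ max N M + ‖d‖ * (|D| * z.im ^ max N M) := by gcongr
    _ = _ := by ring

lemma negCoeff_mem_moderateForms (a n : ℕ) :
    (fun z : ℍ => negCoeff a n z) ∈ moderateForms (-(a : ℤ)) := by
  have hm : ∀ γ : SL(2, ℤ), (fun z : ℍ => negCoeff a n z) ∣[-(a : ℤ)] γ =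
      fun z : ℍ => negCoeff a n z := fun γ => funext fun z =>
    (ModularForm.slash_action_eq'_iff _ _ γ z).mpr (negCoeff_smul a n γ z)
  refine ⟨negCoeff_smooth a n, hm, ?_⟩
  obtain ⟨N, C, h⟩ := exists_norm_tailTheta_le 0 a 0 n (-1) 1 one_pos
  obtain ⟨M, D, h'⟩ := exists_norm_tailTheta_le 0 a 0 n a 1 one_pos
  exact exists_isBigO_of_modular hm fun z hz hz' =>
    norm_mul_add_le_of_norm_le (S := {z | |z.re| ≤ 1 ∧ 1 ≤ z.im}) (fun z hz => hz.2)
      (fun z hz => h z hz.1 hz.2) (fun z hz => h' z hz.1 hz.2) _ _ z ⟨hz, hz'⟩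

lemma norm_im_inv_pow_mul_le {f : ℂ → ℂ} {B : ℝ} {z : ℂ} (hz : 1 ≤ z.im) (b : ℕ)
    (h : ‖f z‖ ≤ B) : ‖((z.im : ℂ)⁻¹) ^ b * f z‖ ≤ B := by
  rw [norm_mul, norm_pow, norm_inv, norm_real, Real.norm_of_nonneg (by linarith)]
  exact (mul_le_of_le_one_left (norm_nonneg _)
    (pow_le_one₀ (by positivity) (inv_le_one_of_one_le₀ hz))).trans h

lemma posCoeff_mem_moderateForms (b n : ℕ) :
    (fun z : ℍ => posCoeff b n z) ∈ moderateForms (b : ℤ) := by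
  have hm : ∀ γ : SL(2, ℤ), (fun z : ℍ => posCoeff b n z) ∣[(b : ℤ)] γ =
      fun z : ℍ => posCoeff b n z := fun γ => funext fun z =>
    (ModularForm.slash_action_eq'_iff _ _ γ z).mpr (posCoeff_smul b n γ z)
  refine ⟨posCoeff_smooth b n, hm, ?_⟩
  obtain ⟨N, C, h⟩ := exists_norm_tailTheta_le 0 0 b n (b - 1) 1 one_pos
  obtain ⟨M, D, h'⟩ := exists_norm_tailTheta_le 0 0 b n 0 1 one_pos
  exact exists_isBigO_of_modular hm fun z hz hz' =>
    norm_mul_add_le_of_norm_le (S := {z | |z.re| ≤ 1 ∧ 1 ≤ z.im}) (fun z hz => hz.2)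
      (f := fun z => ((z.im : ℂ)⁻¹) ^ b * tailTheta 0 0 b n (b - 1) z)
      (g := fun z => ((z.im : ℂ)⁻¹) ^ b * tailTheta 0 0 b n 0 z)
      (fun z hz => norm_im_inv_pow_mul_le hz.2 b (h z hz.1 hz.2))
      (fun z hz => norm_im_inv_pow_mul_le hz.2 b (h' z hz.1 hz.2)) _ _ z ⟨hz, hz'⟩

/-! ### Bases of the polyharmonic Eisenstein spaces from tower relations -/

lemma smooth_of_mem_moderateForms {k : ℤ} {f : ℍ → ℂ} (hf : f ∈ moderateForms k) :
    f ∈ smoothFunctions := hf.1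

/-- The Laplacian as a linear map on smooth functions. -/
def laplacianLin (k : ℤ) : smoothFunctions →ₗ[ℂ] (ℍ → ℂ) :=
  have h0 : laplacian k 0 = 0 := by
    simpa using laplacian_smul_add k smoothFunctions.zero_mem smoothFunctions.zero_mem 1
  { toFun := fun f => laplacian k f
    map_add' := fun f g => by simpa using laplacian_smul_add k f.2 g.2 1
    map_smul' := fun c f => by
      simpa [h0] using laplacian_smul_add k f.2 smoothFunctions.zero_mem c }

/-- The operator `ξ` as a conjugate-linear map on smooth functions. -/
def xiLin (k : ℤ) : smoothFunctions →ₛₗ[starRingEnd ℂ] (ℍ → ℂ) :=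
  have h0 : xi k 0 = 0 := by
    simpa using xi_smul_add k smoothFunctions.zero_mem smoothFunctions.zero_mem 1
  { toFun := fun f => xi k f
    map_add' := fun f g => by simpa using xi_smul_add k f.2 g.2 1
    map_smul' := fun c f => by
      simpa [h0] using xi_smul_add k f.2 smoothFunctions.zero_mem c }

lemma laplacian_sum {ι : Type*} (k : ℤ) (s : Finset ι) (c : ι → ℂ) {X : ι → ℍ → ℂ}
    (hX : ∀ i, X i ∈ smoothFunctions) :
    laplacian k (∑ i ∈ s, c i • X i) = ∑ i ∈ s, c i • laplacian k (X i) := by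
  have := map_sum (laplacianLin k) (fun i => c i • (⟨X i, hX i⟩ : smoothFunctions)) s
  simp only [map_smul] at this
  have e : ∑ i ∈ s, c i • X i = (∑ i ∈ s, c i • (⟨X i, hX i⟩ : smoothFunctions) : smoothFunctions) := by
    simp
  rw [e]
  exact this

lemma xi_sum {ι : Type*} (k : ℤ) (s : Finset ι) (c : ι → ℂ) {X : ι → ℍ → ℂ}
    (hX : ∀ i, X i ∈ smoothFunctions) :
    xi k (∑ i ∈ s, c i • X i) = ∑ i ∈ s, starRingEnd ℂ (c i) • xi k (X i) := by
  have := map_sum (xiLin k) (fun i => c i • (⟨X i, hX i⟩ : smoothFunctions)) s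
  simp only [map_smulₛₗ] at this
  have e : ∑ i ∈ s, c i • X i = (∑ i ∈ s, c i • (⟨X i, hX i⟩ : smoothFunctions) : smoothFunctions) := by
    simp
  rw [e]
  exact this

section tower

variable {k : ℤ} {κ : ℂ} {X : ℕ → ℍ → ℂ}

lemma laplacian_sum_range (hX : ∀ n, X n ∈ smoothFunctions)
    (hΔ : ∀ n, laplacian k (X n) = κ • prev X n) (N : ℕ) (c : ℕ → ℂ) :
    laplacian k (∑ n ∈ Finset.range N, c n • X n) =
      ∑ n ∈ Finset.range (N - 1), (κ * c (n + 1)) • X n := by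
  rw [laplacian_sum k _ c hX]
  cases N with
  | zero => simp
  | succ N =>
    rw [Finset.sum_range_succ']
    simp [hΔ, prev, smul_smul, mul_comm]

lemma laplacian_iterate_sum_range (hX : ∀ n, X n ∈ smoothFunctions)
    (hΔ : ∀ n, laplacian k (X n) = κ • prev X n) (m N : ℕ) (c : ℕ → ℂ) :
    (laplacian k)^[m] (∑ n ∈ Finset.range N, c n • X n) =
      ∑ n ∈ Finset.range (N - m), (κ ^ m * c (n + m)) • X n := by
  induction m generalizing N c with
  | zero => simp
  | succ m ih =>
    rw [Function.iterate_succ_apply, laplacian_sum_range hX hΔ,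
      ih (N - 1) fun n => κ * c (n + 1), Nat.sub_sub, add_comm 1 m]
    exact Finset.sum_congr rfl fun n _ => by rw [pow_succ, mul_assoc, add_assoc]

/-- Applying Δ shortens a linear relation by one term, so induction kills all coefficients but the
bottom one, and X_0 ≠ 0 kills that. -/
lemma eq_zero_of_sum_range_eq_zero (hκ : κ ≠ 0) (hX : ∀ n, X n ∈ smoothFunctions)
    (hΔ : ∀ n, laplacian k (X n) = κ • prev X n) (hX0 : X 0 ≠ 0) (N : ℕ) (c : ℕ → ℂ)
    (h : ∑ n ∈ Finset.range N, c n • X n = 0) : ∀ n < N, c n = 0 := by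
  induction N generalizing c with
  | zero => simp
  | succ N ih =>
    have h1 := laplacian_sum_range hX hΔ (N + 1) c
    have h0 : laplacian k 0 = 0 := map_zero (laplacianLin k)
    rw [h, h0] at h1
    have h2 : ∀ n < N, c (n + 1) = 0 := fun n hn =>
      (mul_eq_zero.mp (ih (fun n => κ * c (n + 1)) h1.symm n hn)).resolve_left hκ
    rw [Finset.sum_range_succ', Finset.sum_eq_zero fun n hn => by
      rw [h2 n (Finset.mem_range.mp hn), zero_smul], zero_add] at h
    intro n hn
    cases n with
    | zero => exact (smul_eq_zero.mp h).resolve_right hX0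
    | succ n => exact h2 n (by omega)

lemma exists_sum_range_of_mem_span {f : ℍ → ℂ} (hf : f ∈ Submodule.span ℂ (Set.range X)) :
    ∃ (N : ℕ) (c : ℕ → ℂ), f = ∑ n ∈ Finset.range N, c n • X n := by
  obtain ⟨c, rfl⟩ := Finsupp.mem_span_range_iff_exists_finsupp.mp hf
  refine ⟨c.support.sup id + 1, c, ?_⟩
  refine Finset.sum_subset (fun n hn => ?_) fun n _ hn => ?_
  · exact Finset.mem_range.mpr (Nat.lt_succ_of_le (Finset.le_sup (f := id) hn))
  · beta_reduce
    rw [Finsupp.notMem_support_iff.mp hn, zero_smul]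

/-- On the span of the tower, Δ^m is κ^m times a shift by m. By linear independence its kernel there
is the span of the first m members. -/
theorem isEisensteinBasis_of_tower (hκ : κ ≠ 0) (hX : ∀ n, X n ∈ moderateForms k)
    (hΔ : ∀ n, laplacian k (X n) = κ • prev X n) (hX0 : X 0 ≠ 0)
    (hspan : Submodule.span ℂ (Set.range X) = Submodule.span ℂ (Set.range (taylorCoeff k))) :
    IsEisensteinBasis k X := by
  have hs := fun n => smooth_of_mem_moderateForms (hX n)
  have hext {m : ℕ} (c : Fin m → ℂ) : ∑ i : Fin m, c i • X i =
      ∑ n ∈ Finset.range m, (if h : n < m then c ⟨n, h⟩ else 0) • X n := by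
    rw [← Fin.sum_univ_eq_sum_range fun n => (if h : n < m then c ⟨n, h⟩ else 0) • X n]
    simp
  intro m _
  refine ⟨Fintype.linearIndependent_iff.mpr fun c hc i => ?_, Set.ext fun f => ⟨fun hf => ?_, ?_⟩⟩
  · rw [hext] at hc
    simpa using eq_zero_of_sum_range_eq_zero hκ hs hΔ hX0 m _ hc i i.2
  · have hf1 : f ∈ Submodule.span ℂ (Set.range X) :=
      Submodule.span_mono (by rintro _ ⟨i, rfl⟩; exact ⟨i, rfl⟩) hf
    have hf2 : f ∈ moderateForms k :=
      Submodule.span_le.mpr (by rintro _ ⟨i, rfl⟩; exact hX i) hf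
    obtain ⟨c, rfl⟩ := (Submodule.mem_span_range_iff_exists_fun ℂ).mp hf
    refine ⟨⟨hf2.1, hf2.2.1, ?_, hf2.2.2⟩, hspan ▸ hf1⟩
    rw [hext, laplacian_iterate_sum_range hs hΔ]
    simp
  · rintro ⟨hf, hf'⟩
    rw [← hspan] at hf'
    obtain ⟨N, c, rfl⟩ := exists_sum_range_of_mem_span hf'
    have h0 := hf.harmonic
    rw [laplacian_iterate_sum_range hs hΔ] at h0
    have h1 := eq_zero_of_sum_range_eq_zero hκ hs hΔ hX0 _ (fun n => κ ^ m * c (n + m)) h0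
    refine Submodule.sum_mem _ fun n hn => ?_
    by_cases hnm : n < m
    -- Coefficients with index n ≥ m must vanish: κ^m c_n is the coefficient of X_{n-m} in the
    -- vanishing sum Δ^m f.
    · exact Submodule.smul_mem _ _ (Submodule.subset_span ⟨⟨n, hnm⟩, rfl⟩)
    · have h2 := h1 (n - m) (by have := Finset.mem_range.mp hn; omega)
      rw [Nat.sub_add_cancel (not_lt.mp hnm)] at h2
      rw [(mul_eq_zero.mp h2).resolve_left (pow_ne_zero m hκ), zero_smul]
      exact Submodule.zero_mem _

end tower

/-- A triangular system with nonzero diagonal is inverted by strong induction. -/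
lemma span_range_eq_of_triangular {X Y : ℕ → ℍ → ℂ} {d : ℕ → ℕ → ℂ} (hd : ∀ n, d n 0 ≠ 0)
    (h : ∀ n, X n = ∑ l ∈ Finset.range (n + 1), d n l • Y (n - l)) :
    Submodule.span ℂ (Set.range X) = Submodule.span ℂ (Set.range Y) := by
  refine le_antisymm (Submodule.span_le.mpr ?_) (Submodule.span_le.mpr ?_)
  · rintro _ ⟨n, rfl⟩
    rw [h]
    exact Submodule.sum_mem _ fun l _ => Submodule.smul_mem _ _ (Submodule.subset_span ⟨_, rfl⟩)
  · rintro _ ⟨n, rfl⟩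
    induction n using Nat.strong_induction_on with
    | _ n ih =>
      have h1 := h n
      rw [Finset.sum_range_succ', Nat.sub_zero] at h1
      have h2 : Y n = (d n 0)⁻¹ •
          (X n - ∑ l ∈ Finset.range n, d n (l + 1) • Y (n - (l + 1))) := by
        rw [h1, add_sub_cancel_left, inv_smul_smul₀ (hd n)]
      rw [h2]
      refine Submodule.smul_mem _ _ (Submodule.sub_mem _ (Submodule.subset_span ⟨n, rfl⟩)
        (Submodule.sum_mem _ fun l hl => Submodule.smul_mem _ _ (ih _ ?_)))
      have := Finset.mem_range.mp hl
      omega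

/-! ### Taylor coefficients of the doubly completed series -/

lemma prev_apply (X : ℕ → ℍ → ℂ) (n : ℕ) (z : ℍ) : prev X n z = shift (fun n => X n z) n := by
  cases n <;> rfl

lemma prev_add (X Y : ℕ → ℍ → ℂ) : prev (X + Y) = prev X + prev Y := by
  funext n; cases n <;> simp [prev]

lemma prev_smul (c : ℂ) (X : ℕ → ℍ → ℂ) : prev (c • X) = c • prev X := by
  funext n; cases n <;> simp [prev]

lemma prev_mem {S : Submodule ℂ (ℍ → ℂ)} {X : ℕ → ℍ → ℂ} (hX : ∀ n, X n ∈ S) (n : ℕ) :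
    prev X n ∈ S := by
  cases n with
  | zero => exact S.zero_mem
  | succ n => exact hX n

lemma xi_prev (k : ℤ) (X : ℕ → ℍ → ℂ) :
    (fun n => xi k (prev X n)) = prev fun n => xi k (X n) := by
  funext n
  cases n with
  | zero => exact map_zero (xiLin k)
  | succ n => rfl

/-- The sequence `c X_n + κ X_{n-1} + X_{n-2}`. -/
def quadraticShift (c κ : ℂ) (X : ℕ → ℍ → ℂ) : ℕ → ℍ → ℂ := c • X + κ • prev X + prev (prev X)

lemma quadraticShift_mem {S : Submodule ℂ (ℍ → ℂ)} {X : ℕ → ℍ → ℂ} (hX : ∀ n, X n ∈ S) (c κ : ℂ)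
    (n : ℕ) : quadraticShift c κ X n ∈ S :=
  S.add_mem (S.add_mem (S.smul_mem _ (hX n)) (S.smul_mem _ (prev_mem hX n)))
    (prev_mem (prev_mem hX) n)

/-- The coefficients are real, so conjugate-linearity of ξ does not affect them. -/
lemma xi_quadraticShift (k : ℤ) {X : ℕ → ℍ → ℂ} (hX : ∀ n, X n ∈ smoothFunctions) (c κ : ℝ) :
    (fun n => xi k (quadraticShift c κ X n)) = quadraticShift c κ fun n => xi k (X n) := by
  have h1 := prev_mem hX
  have h2 := prev_mem h1
  have e2 := xi_prev k (prev X)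
  rw [xi_prev k X] at e2
  funext n
  have e : quadraticShift c κ X n = (c : ℂ) • X n + ((κ : ℂ) • prev X n + prev (prev X) n) :=
    add_assoc _ _ _
  rw [e, xi_smul_add k (hX n) (smoothFunctions.add_mem (smoothFunctions.smul_mem _ (h1 n)) (h2 n)),
    xi_smul_add k (h1 n) (h2 n), conj_ofReal, conj_ofReal, congrFun (xi_prev k X) n, congrFun e2 n,
    ← add_assoc]
  rfl

/-- The Taylor coefficients of the completed series of weight `-a` with alternating signs. -/
def altNegCoeff (a : ℕ) (n : ℕ) (z : ℍ) : ℂ := (-1) ^ n * negCoeff a n z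

lemma altNegCoeff_eq (a n : ℕ) :
    altNegCoeff a n = (-1 : ℂ) ^ n • fun z : ℍ => negCoeff a n z := rfl

lemma altNegCoeff_mem (a n : ℕ) : altNegCoeff a n ∈ moderateForms (-(a : ℤ)) :=
  (moderateForms _).smul_mem _ (negCoeff_mem_moderateForms a n)

/-- The value at `s = 0` of the polynomial factor of the doubly completed series of weights
`-a` and `a + 2`. -/
def factorAtZero (a : ℕ) : ℝ := a / 2 * (a / 2 + 1)

/-- The sign replaces s by -s, which turns the factor s² - (a + 1)s + c into s² + (a + 1)s + c, the
factor of weight a + 2. The same shift operator then describes both weights. -/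
lemma neg_one_pow_smul_taylorCoeff_neg {a : ℕ} (ha : Even a) (ha0 : a ≠ 0) (n : ℕ) :
    (-1 : ℂ) ^ n • taylorCoeff (-(a : ℤ)) n =
    quadraticShift (factorAtZero a) ((a + 1 : ℝ)) (altNegCoeff a) n := by
  funext z
  have hd := differentiable_completedNeg a (z := z) z.2
  rw [Pi.smul_apply, taylorCoeff_eq_taylorAt, doublyCompleted_eq (isEntireContinuation_neg ha ha0 z)]
  have e : (fun s : ℂ => (s - a / 2) * (s - a / 2 - 1) * completedNeg a z s) = fun s =>
      ((factorAtZero a : ℂ) + (-(a + 1)) * s + s * s) * completedNeg a z s := by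
    funext s; simp only [factorAtZero]; push_cast; ring
  rw [e, taylorAt_quadratic_mul hd]
  have ec : taylorAt (completedNeg a z) = fun n => negCoeff a n z :=
    funext fun n => taylorAt_completedNeg a n z.2
  rw [ec]
  simp only [quadraticShift, Pi.add_apply, Pi.smul_apply, prev_apply, smul_eq_mul, altNegCoeff]
  rcases n with _ | _ | n <;> simp [shift] <;> ring

lemma taylorCoeff_pos {a : ℕ} (ha : Even a) :
    taylorCoeff ((a + 2 : ℕ) : ℤ) = quadraticShift (factorAtZero a) ((a + 1 : ℝ))
      fun n (z : ℍ) => posCoeff (a + 2) n z := by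
  funext n z
  have hd := differentiable_completedPos (a + 2) (z := z) z.2
  rw [taylorCoeff_eq_taylorAt,
    doublyCompleted_eq (isEntireContinuation_pos (ha.add even_two) (by omega) z)]
  have e : (fun s : ℂ => (s + (a + 2 : ℕ) / 2) * (s + (a + 2 : ℕ) / 2 - 1) *
      completedPos (a + 2) z s) = fun s =>
      ((factorAtZero a : ℂ) + (a + 1) * s + s * s) * completedPos (a + 2) z s := by
    funext s; simp only [factorAtZero]; push_cast; ring
  rw [e, taylorAt_quadratic_mul hd]
  have ec : taylorAt (completedPos (a + 2) z) = fun n => posCoeff (a + 2) n z :=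
    funext fun n => taylorAt_completedPos (a + 2) n z.2
  rw [ec]
  simp [quadraticShift, prev_apply]

/-! ### Ramp and tower relations for the modified coefficients -/

lemma xi_altNegCoeff (a : ℕ) :
    (fun n => xi (-(a : ℤ)) (altNegCoeff a n)) = fun n (z : ℍ) => posCoeff (a + 2) n z := by
  funext n z
  have h := xi_smul_add (-(a : ℤ)) (negCoeff_smooth a n) smoothFunctions.zero_mem ((-1 : ℂ) ^ n)
  have h0 : xi (-(a : ℤ)) 0 = 0 := map_zero (xiLin _)
  rw [h0, add_zero, add_zero, ← altNegCoeff_eq] at h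
  rw [h, Pi.smul_apply, xi_negCoeff, smul_eq_mul, ← mul_assoc]
  simp [← mul_pow]

lemma xi_posCoeff_eq {a : ℕ} (ha : Even a) (ha0 : a ≠ 0) :
    (fun n => xi ((a + 2 : ℕ) : ℤ) (fun z : ℍ => posCoeff (a + 2) n z)) =
      ((a + 1 : ℝ) : ℂ) • prev (altNegCoeff a) + prev (prev (altNegCoeff a)) := by
  funext n z
  rw [xi_posCoeff ha ha0]
  simp [prev_apply, altNegCoeff]

lemma xi_neg_one_pow_smul_taylorCoeff {a : ℕ} (ha : Even a) (ha0 : a ≠ 0) (n : ℕ) :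
    xi (-(a : ℤ)) ((-1 : ℂ) ^ n • taylorCoeff (-(a : ℤ)) n) = taylorCoeff ((a + 2 : ℕ) : ℤ) n := by
  rw [neg_one_pow_smul_taylorCoeff_neg ha ha0, taylorCoeff_pos ha, ← xi_altNegCoeff,
    ← xi_quadraticShift _ fun n => smooth_of_mem_moderateForms (altNegCoeff_mem a n)]

lemma xi_taylorCoeff_pos {a : ℕ} (ha : Even a) (ha0 : a ≠ 0) (n : ℕ) :
    xi ((a + 2 : ℕ) : ℤ) (taylorCoeff ((a + 2 : ℕ) : ℤ) n) =
      ((a + 1 : ℝ) : ℂ) • prev (fun n => (-1 : ℂ) ^ n • taylorCoeff (-(a : ℤ)) n) n +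
        prev (prev fun n => (-1 : ℂ) ^ n • taylorCoeff (-(a : ℤ)) n) n := by
  have h := congrFun (xi_quadraticShift ((a + 2 : ℕ) : ℤ) (posCoeff_smooth (a + 2)) (factorAtZero a)
    (a + 1)) n
  rw [xi_posCoeff_eq ha ha0, ← taylorCoeff_pos ha] at h
  simp only [neg_one_pow_smul_taylorCoeff_neg ha ha0, h]
  change _ = (((a + 1 : ℝ) : ℂ) • prev (quadraticShift _ _ (altNegCoeff a)) +
    prev (prev (quadraticShift _ _ (altNegCoeff a)))) n
  refine congrFun ?_ n
  simp only [quadraticShift, prev_add, prev_smul]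
  module

/-- The coefficients `(-1)^ℓ κ^{-ℓ} C(n+ℓ, n)`. -/
def modifiedCoeff (κ : ℂ) (n l : ℕ) : ℂ := (-1) ^ l * (1 / κ ^ l) * ((n + l).choose n : ℂ)

/-- The sequence `∑_{ℓ ≤ n} (-1)^ℓ κ^{-ℓ} C(n+ℓ, n) X_{n-ℓ}`. -/
def modified (κ : ℂ) (X : ℕ → ℍ → ℂ) (n : ℕ) : ℍ → ℂ :=
  ∑ l ∈ Finset.range (n + 1), modifiedCoeff κ n l • X (n - l)

lemma modifiedCoeff_zero (κ : ℂ) (n : ℕ) : modifiedCoeff κ n 0 = 1 := by simp [modifiedCoeff]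

/-- Pascal's rule; this recursion is what determines the modified coefficients. -/
lemma mul_modifiedCoeff_succ {κ : ℂ} (hκ : κ ≠ 0) (n l : ℕ) :
    κ * modifiedCoeff κ (n + 1) (l + 1) + modifiedCoeff κ (n + 1) l =
      κ * modifiedCoeff κ n (l + 1) := by
  have h : ((n + 1 + (l + 1)).choose (n + 1) : ℂ) =
      (n + (l + 1)).choose n + (n + 1 + l).choose (n + 1) := by
    rw [show n + 1 + (l + 1) = n + 1 + l + 1 by ring, Nat.choose_succ_succ]
    push_cast
    congr 3; ring
  rw [modifiedCoeff, modifiedCoeff, modifiedCoeff, h]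
  field_simp
  ring

/-- Collecting the coefficient of each X_j merges the single and double shifts through the
recursion, so the operator κ·(shift) + (shift)² acts on the modified sequence as κ·(shift). -/
lemma sum_modifiedCoeff_smul {κ : ℂ} (hκ : κ ≠ 0) (X : ℕ → ℍ → ℂ) (n : ℕ) :
    ∑ l ∈ Finset.range (n + 1), modifiedCoeff κ n l • (κ • prev X (n - l) + prev (prev X) (n - l)) =
      κ • prev (modified κ X) n := by
  have h0 (Y : ℕ → ℍ → ℂ) : prev Y 0 = 0 := rfl
  cases n with
  | zero => simp [h0]
  | succ n =>
    have h1 : ∑ l ∈ Finset.range (n + 1 + 1), modifiedCoeff κ (n + 1) l •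
        (κ • prev X (n + 1 - l) + prev (prev X) (n + 1 - l)) =
        ∑ l ∈ Finset.range (n + 1), (κ * modifiedCoeff κ (n + 1) l) • X (n - l) +
        ∑ l ∈ Finset.range (n + 1), modifiedCoeff κ (n + 1) l • prev X (n - l) := by
      -- The top term vanishes, since both shifts are zero at index 0.
      rw [Finset.sum_range_succ, ← Finset.sum_add_distrib]
      simp only [Nat.sub_self, h0, smul_zero, add_zero]
      refine Finset.sum_congr rfl fun l hl => ?_
      rw [Nat.succ_sub (Nat.lt_succ_iff.mp (Finset.mem_range.mp hl))]
      change modifiedCoeff κ (n + 1) l • (κ • X (n - l) + prev X (n - l)) = _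
      module
    have h2 : ∑ l ∈ Finset.range (n + 1), modifiedCoeff κ (n + 1) l • prev X (n - l) =
        ∑ l ∈ Finset.range n, modifiedCoeff κ (n + 1) l • X (n - (l + 1)) := by
      rw [Finset.sum_range_succ, Nat.sub_self]
      simp only [h0, smul_zero, add_zero]
      refine Finset.sum_congr rfl fun l hl => ?_
      have : n - l = n - (l + 1) + 1 := by have := Finset.mem_range.mp hl; omega
      rw [this, prev]
    rw [h1, h2, Finset.sum_range_succ', add_right_comm, ← Finset.sum_add_distrib]
    simp only [← add_smul, mul_modifiedCoeff_succ hκ, prev, modified, Finset.smul_sum, smul_smul]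
    rw [Finset.sum_range_succ' _ n, modifiedCoeff_zero, modifiedCoeff_zero]

lemma modified_mem {S : Submodule ℂ (ℍ → ℂ)} {X : ℕ → ℍ → ℂ} (hX : ∀ n, X n ∈ S) (κ : ℂ) (n : ℕ) :
    modified κ X n ∈ S :=
  S.sum_mem fun _ _ => S.smul_mem _ (hX _)

lemma xi_modified (k : ℤ) {X : ℕ → ℍ → ℂ} (hX : ∀ n, X n ∈ smoothFunctions) (κ : ℝ) (n : ℕ) :
    xi k (modified κ X n) = ∑ l ∈ Finset.range (n + 1), modifiedCoeff κ n l • xi k (X (n - l)) := by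
  rw [modified, xi_sum k _ (modifiedCoeff κ n) (X := fun l => X (n - l)) fun l => hX _]
  simp [modifiedCoeff]

lemma modifiedG_eq (k : ℤ) : modifiedG k = modified ((k : ℂ) - 1) (taylorCoeff k) := by
  funext n z
  simp [modifiedG, modified, modifiedCoeff]

/-- The alternating sign is absorbed by (-1)^(n-ℓ) (-1)^ℓ = (-1)^n, so both modified sequences come
from one construction. -/
lemma modifiedF_eq (k : ℤ) :
    modifiedF k = modified ((k : ℂ) - 1) fun n => (-1 : ℂ) ^ n • taylorCoeff (2 - k) n := by
  funext n z
  simp only [modifiedF, modified, modifiedCoeff, Finset.mul_sum, Finset.sum_apply, Pi.smul_apply,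
    smul_eq_mul]
  refine Finset.sum_congr rfl fun l hl => ?_
  obtain ⟨j, rfl⟩ := Nat.exists_eq_add_of_le (Nat.lt_succ_iff.mp (Finset.mem_range.mp hl))
  have : (-1 : ℂ) ^ (l + j - l) * (-1) ^ l = (-1) ^ (l + j) := by
    rw [← pow_add]; congr 1; omega
  rw [← this]
  ring

/-! ### Nonvanishing -/

/-- At s = 0 the lattice sum is ζ(b) times the coprime sum, and the normalised holomorphic
Eisenstein series is nonzero. -/
lemma exists_eisensteinSeries_ne_zero {b : ℕ} (hb : Even b) (hb3 : 3 ≤ b) :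
    ∃ z : ℍ, eisensteinSeries (b : ℤ) z 0 ≠ 0 := by
  by_contra! h
  refine EisensteinSeries.E_ne_zero hb3 hb (ModularForm.ext fun z => ?_)
  have h1 := tsum_eisSummand_eq_riemannZeta_mul_eisensteinSeries hb3 z
  have hz : riemannZeta b ≠ 0 := riemannZeta_ne_zero_of_one_lt_re (by
    rw [natCast_re]; exact_mod_cast (by omega : 1 < b))
  have h2 : ∑' v : Fin 2 → ℤ, EisensteinSeries.eisSummand b v z = 0 := by
    rw [← (finTwoArrowEquiv ℤ).symm.tsum_eq]
    have h3 := h z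
    rw [eisensteinSeries] at h3
    have h4 := (mul_eq_zero.mp h3).resolve_left (by norm_num)
    rw [← h4]
    -- The zero vector contributes nothing to the full sum, because inverting 0 gives 0 and b ≠ 0.
    refine (tsum_subtype_eq_of_support_subset (s := {p : ℤ × ℤ | p ≠ 0}) (fun p hp h0 => hp ?_)).symm.trans
      (tsum_congr fun p => ?_)
    · subst h0
      simp [EisensteinSeries.eisSummand, show b ≠ 0 by omega]
    · simp [EisensteinSeries.eisSummand]
  rw [h2] at h1
  have h5 := (mul_eq_zero.mp h1.symm).resolve_left hz
  have h6 : ModularForm.E hb3 z = (1 / 2 : ℂ) • _root_.eisensteinSeries (N := 1) 0 b z := rfl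
  rw [h6, h5]
  simp

/-- For b ≥ 3 the point s = 0 lies in the half-plane of convergence, and there the polynomial, Γ and
π factors are nonzero. -/
lemma taylorCoeff_pos_zero_ne_zero {b : ℕ} (hb : Even b) (hb3 : 3 ≤ b) :
    taylorCoeff (b : ℤ) 0 ≠ 0 := by
  obtain ⟨z, hz⟩ := exists_eisensteinSeries_ne_zero hb hb3
  intro h
  have h1 := isEntireContinuation_pos hb (by omega) z
  have hb3' : (3 : ℝ) ≤ b := by exact_mod_cast hb3
  have h2 := (doublyCompleted_eq h1 ▸ h1).2 0 (by rw [zero_re]; push_cast; linarith)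
  have h3 := congrFun h z
  rw [taylorCoeff] at h3
  simp only [iteratedDeriv_zero, Nat.factorial_zero, Nat.cast_one, div_one, h2, Pi.zero_apply,
    doublyCompletedSeries] at h3
  have hb0 : (b : ℂ) ≠ 0 := by exact_mod_cast (by omega : b ≠ 0)
  have hb2 : (b : ℂ) / 2 - 1 ≠ 0 := by
    have : (b : ℂ) ≠ 2 := by exact_mod_cast (by omega : b ≠ 2)
    intro h; apply this; linear_combination 2 * h
  have hG : Complex.Gamma ((b : ℂ)) ≠ 0 :=
    Complex.Gamma_ne_zero_of_re_pos (by rw [natCast_re]; linarith)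
  have hpi : (Real.pi : ℂ) ^ (-((b : ℂ) / 2)) ≠ 0 := by
    simp [cpow_eq_zero_iff, Real.pi_ne_zero]
  simp [hb0, hb2, hG, hpi, hz] at h3

/-! ### The modified basis -/

theorem isModifiedBasis_modified {a : ℕ} (ha : Even a) (ha0 : a ≠ 0) {k : ℤ}
    (hk : k = ((a + 2 : ℕ) : ℤ)) : IsModifiedBasis k (modifiedG k) (modifiedF k) := by
  have hk2 : 2 - k = -(a : ℤ) := by rw [hk]; push_cast; ring
  have hk1 : (k : ℂ) - 1 = ((a + 1 : ℝ) : ℂ) := by rw [hk]; push_cast; ring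
  have hκ : ((a + 1 : ℝ) : ℂ) ≠ 0 := by exact_mod_cast (Nat.succ_ne_zero a)
  have hG : ∀ n, taylorCoeff k n ∈ moderateForms k := fun n => by
    rw [hk, taylorCoeff_pos ha]
    exact quadraticShift_mem (posCoeff_mem_moderateForms (a + 2)) _ _ n
  have hF : ∀ n, (-1 : ℂ) ^ n • taylorCoeff (2 - k) n ∈ moderateForms (2 - k) := fun n => by
    rw [hk2, neg_one_pow_smul_taylorCoeff_neg ha ha0]
    exact quadraticShift_mem (altNegCoeff_mem a) _ _ n
  have hG' := fun n => smooth_of_mem_moderateForms (hG n)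
  have hF' := fun n => smooth_of_mem_moderateForms (hF n)
  have mG : ∀ n, modifiedG k n ∈ moderateForms k := fun n => modifiedG_eq k ▸ modified_mem hG _ n
  have mF : ∀ n, modifiedF k n ∈ moderateForms (2 - k) := fun n =>
    modifiedF_eq k ▸ modified_mem hF _ n
  have rF : ∀ n, xi (2 - k) (modifiedF k n) = modifiedG k n := fun n => by
    rw [modifiedF_eq, modifiedG_eq, hk1, xi_modified _ hF', modified]
    refine Finset.sum_congr rfl fun l _ => ?_
    rw [hk2, hk, xi_neg_one_pow_smul_taylorCoeff ha ha0]
  have rG : ∀ n, xi k (modifiedG k n) = ((k : ℂ) - 1) • prev (modifiedF k) n := fun n => by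
    rw [modifiedF_eq, modifiedG_eq, hk1, xi_modified _ hG', ← sum_modifiedCoeff_smul hκ]
    refine Finset.sum_congr rfl fun l _ => ?_
    rw [hk2, hk, xi_taylorCoeff_pos ha ha0]
  have xi_smul_prev (n : ℕ) : xi (2 - k) (((k : ℂ) - 1) • prev (modifiedF k) n) =
      ((k : ℂ) - 1) • prev (modifiedG k) n := by
    have h0 : xi (2 - k) 0 = 0 := map_zero (xiLin _)
    have h := xi_smul_add (2 - k)
      (prev_mem (fun n => smooth_of_mem_moderateForms (mF n)) n) smoothFunctions.zero_mem
      ((k : ℂ) - 1)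
    rw [h0, add_zero, add_zero, congrFun (xi_prev (2 - k) (modifiedF k)) n, funext rF] at h
    simpa using h
  have tG : ∀ n, laplacian k (modifiedG k n) = ((k : ℂ) - 1) • prev (modifiedG k) n := fun n => by
    rw [laplacian_eq_xi_xi k (mG n).1, rG, xi_smul_prev]
  have tF : ∀ n, laplacian (2 - k) (modifiedF k n) = ((k : ℂ) - 1) • prev (modifiedF k) n :=
    fun n => by rw [laplacian_eq_xi_xi _ (mF n).1, rF, sub_sub_cancel, rG]
  have nG : modifiedG k 0 ≠ 0 := by
    have h : modifiedG k 0 = taylorCoeff k 0 := by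
      simp [modifiedG_eq, modified, modifiedCoeff_zero]
    rw [h, hk]
    exact taylorCoeff_pos_zero_ne_zero (ha.add even_two) (by omega)
  have nF : modifiedF k 0 ≠ 0 := fun h => nG <| by
    rw [← rF, h]
    exact map_zero (xiLin _)
  refine ⟨isEisensteinBasis_of_tower (hk1 ▸ hκ) mG tG nG ?_,
    isEisensteinBasis_of_tower (hk1 ▸ hκ) mF tF nF ?_, rG, rF, tG, tF⟩
  · refine span_range_eq_of_triangular (d := modifiedCoeff ((k : ℂ) - 1)) (fun n => ?_) fun n => ?_
    · rw [modifiedCoeff_zero]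
      exact one_ne_zero
    · rw [modifiedG_eq, modified]
  · have h1 : Submodule.span ℂ (Set.range (modifiedF k)) =
        Submodule.span ℂ (Set.range fun n => (-1 : ℂ) ^ n • taylorCoeff (2 - k) n) :=
      span_range_eq_of_triangular (d := modifiedCoeff ((k : ℂ) - 1))
        (fun n => by rw [modifiedCoeff_zero]; exact one_ne_zero)
        fun n => by rw [modifiedF_eq, modified]
    rw [h1]
    -- The signs only rescale the generators, so the matrix is diagonal.
    refine span_range_eq_of_triangular (d := fun n l => if l = 0 then (-1 : ℂ) ^ n else 0)
      (fun n => by simp) fun n => ?_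
    rw [Finset.sum_range_succ']
    simp

end PolyharmonicMaass

end

/-! ### The main theorem -/

theorem theorem2 (k : ℤ) (hk : Even k) (hk4 : 4 ≤ k) :
    (∀ z : UpperHalfPlane,
      PolyharmonicMaass.IsEntireContinuation k z (PolyharmonicMaass.doublyCompleted k z) ∧
      PolyharmonicMaass.IsEntireContinuation (2 - k) z
        (PolyharmonicMaass.doublyCompleted (2 - k) z)) ∧
    (∃ G F : ℕ → UpperHalfPlane → ℂ, PolyharmonicMaass.IsModifiedBasis k G F) ∧
    PolyharmonicMaass.IsModifiedBasis k
      (PolyharmonicMaass.modifiedG k) (PolyharmonicMaass.modifiedF k) := by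
  obtain ⟨j, hj⟩ := hk
  -- Writing k = 2j with j = i + 2 makes a = k - 2 = 2i + 2 a positive even natural number.
  obtain ⟨i, rfl⟩ : ∃ i : ℕ, j = i + 2 := ⟨(j - 2).toNat, by omega⟩
  have ha : Even (2 * i + 2) := ⟨i + 1, by ring⟩
  have ha0 : 2 * i + 2 ≠ 0 := by omega
  have hk : k = ((2 * i + 2 + 2 : ℕ) : ℤ) := by rw [hj]; push_cast; ring
  have hk2 : 2 - k = -((2 * i + 2 : ℕ) : ℤ) := by rw [hk]; push_cast; ring
  have hbasis := PolyharmonicMaass.isModifiedBasis_modified ha ha0 hk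
  refine ⟨fun z => ⟨?_, ?_⟩, ⟨_, _, hbasis⟩, hbasis⟩
  · have h := PolyharmonicMaass.isEntireContinuation_pos (ha.add even_two)
      (Nat.succ_ne_zero _) z
    rw [hk, PolyharmonicMaass.doublyCompleted_eq h]
    exact h
  · have h := PolyharmonicMaass.isEntireContinuation_neg ha ha0 z
    rw [hk2, PolyharmonicMaass.doublyCompleted_eq h]
    exact h
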